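/- Let $(G,\Omega)$ be an oligomorphic permutation group, i.e. $G$ acts faithfully on $\Omega$ with finitely many orbits on $\Omega^n$ for every $n\ge 0$. For finite $A\subset\Omega$ let $G(A)$ and $G[A]$ be the pointwise and setwise stabilizers of $A$. A $G$-set is called smooth (relative to $\Omega$) if it has finitely many orbits and the stabilizer of each of its points is of the form $G(A)$ with $A\subset\Omega$ finite; it is transitive if it has exactly one orbit. Let $\Theta(G,\Omega)$ be the commutative ring generated by symbols $[f]$, one for each $G$-equivariant map $f\colon Y\to X$ of smooth $G$-sets with $X$ transitive, modulo the relations: (i) $[f]=1$ if $f$ is an isomorphism; (ii) $[f]=[f|_{Y_1}]+[f|_{Y_2}]$ if $Y=Y_1\sqcup Y_2$ as $G$-sets; (iii) $[f\circ g]=[f][g]$ for maps $g\colon Z\to Y$, $f\colon Y\to X$ of transitive smooth $G$-sets; (iv) $[f]=[f']$ if $f'\colon Y'\to X'$ is the base change of $f\colon Y\to X$ along a map $X'\to X$ with $X$ and $X'$ transitive. Let $\Theta^*(G,\Omega)$ be the localization of $\Theta(G,\Omega)$ at the multiplicative set generated by the classes $[f]$ of maps $f$ of transitive smooth $G$-sets.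 Let $\Theta_{\le 1}(G,\Omega)$ be the additive subgroup of $\Theta(G,\Omega)$ generated by the basic classes, that is, the classes of the maps $Y\to X$ where $Y$ is a $G$-orbit on $\Omega^{k+1}$ for some $k\ge 0$, $X$ is its image in $\Omega^k$, and the map is the projection onto the first $k$ coordinates. Let $m$ be a positive integer, and suppose that - $\mathrm{IND}(m)$: for every finite $A\subset\Omega$, the index $[G[A]:G(A)]$ divides a power of $m$; - $\mathrm{GEN}(m)$: $\Theta_{\le 1}(G,\Omega)[1/m]$ is a finitely generated $\mathbf{Z}[1/m]$-module. Then: (a) There is a ring isomorphism $\Theta^*(G,\Omega)[1/m]\cong\mathbf{Z}[1/m]^{\ell}$ for some integer $\ell\ge 0$. (b) If $f\colon Y\to X$ is a map of transitive smooth $G$-sets and $(a_1,\dots,a_\ell)\in\mathbf{Z}[1/m]^\ell$ is the element corresponding to $[f]$, then each $a_i$ is a unit of $\mathbf{Z}[1/m]$. (c) If $\Theta_{\le 1}(G,\Omega)[1/m]$ is generated by $r$ elements as a $\mathbf{Z}[1/m]$-module and $p$ is the smallest prime not dividing $m$, then $\ell\le(p-1)^r$. -/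

import Mathlib

universe u

open scoped Pointwise

/-- `(G, Ω)` is oligomorphic: `G` acts faithfully on `Ω` (a permutation group), with finitely many
orbits on `Ω ^ n` for every `n`. -/
structure IsOligomorphic (G Ω : Type u) [Group G] [MulAction G Ω] : Prop where
  faithful : FaithfulSMul G Ω
  finite_orbits : ∀ n : ℕ, Finite (MulAction.orbitRel.Quotient G (Fin n → Ω))

/-- The stabilizer class `ℰ(Ω)`: all subgroups `G(A)` (pointwise stabilizer of `A`), for finite
subsets `A` of `Ω`. -/
def stabClass (G Ω : Type u) [Group G] [MulAction G Ω] : Set (Subgroup G) :=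
  {U | ∃ A : Finset Ω, U = fixingSubgroup G (A : Set Ω)}

/-- The condition `IND(m)`: for every finite `A ⊆ Ω`, the index of the pointwise stabilizer `G(A)`
in the setwise stabilizer `G[A]` divides a power of `m`. -/
def IND (G Ω : Type u) [Group G] [MulAction G Ω] (m : ℕ) : Prop :=
  ∀ A : Finset Ω, ∃ k : ℕ,
    (fixingSubgroup G (A : Set Ω)).relIndex (MulAction.stabilizer G (A : Set Ω)) ∣ m ^ k

/-- An `E`-smooth `G`-set: a set with an action of `G` which has finitely many orbits and all of
whose point stabilizers belong to the class `E` of subgroups. -/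
structure SmoothSet (G : Type u) [Group G] (E : Set (Subgroup G)) : Type (u + 1) where
  carrier : Type u
  [action : MulAction G carrier]
  finitary : Finite (MulAction.orbitRel.Quotient G carrier)
  smooth : ∀ x : carrier, MulAction.stabilizer G x ∈ E

namespace SmoothSet

variable {G : Type u} [Group G] {E : Set (Subgroup G)}

instance : CoeSort (SmoothSet G E) (Type u) := ⟨SmoothSet.carrier⟩

instance (X : SmoothSet G E) : MulAction G X := X.action

/-- A transitive `G`-set has exactly one orbit; in particular it is nonempty. -/
def IsTransitive (X : SmoothSet G E) : Prop :=
  Nonempty X ∧ MulAction.IsPretransitive G X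

/-- The commutative square with sides `g' : Y' → Y`, `f' : Y' → X'`, `f : Y → X`, `g : X' → X`
is cartesian, i.e. `f'` is the base change of `f` along `g`. -/
def IsCartesian {Y' Y X' X : SmoothSet G E} (g' : Y' →[G] Y) (f' : Y' →[G] X')
    (f : Y →[G] X) (g : X' →[G] X) : Prop :=
  (∀ y', f (g' y') = g (f' y')) ∧
    ∀ (y : Y) (x' : X'), f y = g x' → ∃! y' : Y', g' y' = y ∧ f' y' = x'

end SmoothSet

/-- The symbols generating `Θ(G, E)`: maps `f : Y → X` of `E`-smooth `G`-sets, with `X`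
transitive. -/
structure ThetaSymbol (G : Type u) [Group G] (E : Set (Subgroup G)) : Type (u + 1) where
  {source : SmoothSet G E}
  {target : SmoothSet G E}
  map : source →[G] target
  transitive : target.IsTransitive

section Theta

variable (G : Type u) [Group G] (E : Set (Subgroup G))

/-- The defining relations of `Θ(G, E)`, as elements of the polynomial ring in the symbols. -/
inductive ThetaRel : MvPolynomial (ThetaSymbol G E) ℤ → Prop
  /-- Isomorphisms have class `1`. -/
  | iso {Y X : SmoothSet G E} (hX : X.IsTransitive) (f : Y →[G] X)
      (hf : Function.Bijective f) :
      ThetaRel (MvPolynomial.X ⟨f, hX⟩ - 1)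
  /-- Additivity: `Y` is the disjoint union of (the images of) `Y₁` and `Y₂`. -/
  | add {Y Y₁ Y₂ X : SmoothSet G E} (hX : X.IsTransitive) (f : Y →[G] X)
      (i₁ : Y₁ →[G] Y) (i₂ : Y₂ →[G] Y) (h₁ : Function.Injective i₁)
      (h₂ : Function.Injective i₂) (h : IsCompl (Set.range i₁) (Set.range i₂)) :
      ThetaRel (MvPolynomial.X ⟨f, hX⟩ - (MvPolynomial.X ⟨f.comp i₁, hX⟩ + MvPolynomial.X ⟨f.comp i₂, hX⟩))
  /-- Multiplicativity for composable maps of transitive sets. -/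
  | comp {Z Y X : SmoothSet G E} (hZ : Z.IsTransitive) (hY : Y.IsTransitive)
      (hX : X.IsTransitive) (g : Z →[G] Y) (f : Y →[G] X) :
      ThetaRel (MvPolynomial.X ⟨f.comp g, hX⟩ - MvPolynomial.X ⟨f, hX⟩ * MvPolynomial.X ⟨g, hY⟩)
  /-- Invariance under base change. -/
  | baseChange {Y' Y X' X : SmoothSet G E} (hX : X.IsTransitive) (hX' : X'.IsTransitive)
      (g' : Y' →[G] Y) (f' : Y' →[G] X') (f : Y →[G] X) (g : X' →[G] X)
      (h : SmoothSet.IsCartesian g' f' f g) :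
      ThetaRel (MvPolynomial.X ⟨f, hX⟩ - MvPolynomial.X ⟨f', hX'⟩)

/-- The ring `Θ(G, E)` carrying the universal measure. -/
def Theta : Type (u + 1) :=
  MvPolynomial (ThetaSymbol G E) ℤ ⧸ Ideal.span {q | ThetaRel G E q}

noncomputable instance : CommRing (Theta G E) :=
  inferInstanceAs (CommRing (MvPolynomial (ThetaSymbol G E) ℤ ⧸ Ideal.span {q | ThetaRel G E q}))

variable {G E}

/-- The class `[f]` in `Θ(G, E)` of a map `f : Y → X` with `X` transitive. -/
noncomputable def thetaClass {Y X : SmoothSet G E} (f : Y →[G] X) (hX : X.IsTransitive) :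
    Theta G E :=
  Ideal.Quotient.mk (Ideal.span {q | ThetaRel G E q}) (MvPolynomial.X ⟨f, hX⟩)

variable (G E)

/-- The multiplicative set generated by the classes of maps between transitive sets. -/
noncomputable def regularSubmonoid : Submonoid (Theta G E) :=
  Submonoid.closure {x | ∃ (Y X : SmoothSet G E) (_ : Y.IsTransitive) (hX : X.IsTransitive)
    (f : Y →[G] X), x = thetaClass f hX}

/-- The ring `Θ*(G, E)` carrying the universal regular measure. -/
def ThetaStar : Type (u + 1) := Localization (regularSubmonoid G E)

noncomputable instance : CommRing (ThetaStar G E) :=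
  inferInstanceAs (CommRing (Localization (regularSubmonoid G E)))

noncomputable instance : Algebra (Theta G E) (ThetaStar G E) :=
  inferInstanceAs (Algebra (Theta G E) (Localization (regularSubmonoid G E)))

instance : IsLocalization (regularSubmonoid G E) (ThetaStar G E) :=
  inferInstanceAs (IsLocalization (regularSubmonoid G E) (Localization (regularSubmonoid G E)))

end Theta

section Filtration

variable {G Ω : Type u} [Group G] [MulAction G Ω]

theorem stabilizer_tuple_mem {n : ℕ} (a : Fin n → Ω) :
    MulAction.stabilizer G a ∈ stabClass G Ω := by
  classical
  refine ⟨Finset.univ.image a, ?_⟩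
  ext g
  simp [MulAction.mem_stabilizer_iff, mem_fixingSubgroup_iff, funext_iff]

/-- The orbit of a point `a` of `Ω ^ n`, as an `ℰ(Ω)`-smooth `G`-set. -/
def orbitSet {n : ℕ} (a : Fin n → Ω) : SmoothSet G (stabClass G Ω) where
  carrier := MulAction.orbit G a
  finitary := by
    have : Subsingleton (MulAction.orbitRel.Quotient G (MulAction.orbit G a)) :=
      (MulAction.pretransitive_iff_subsingleton_quotient G _).1 inferInstance
    infer_instance
  smooth := by
    intro x
    have h : MulAction.stabilizer G x = MulAction.stabilizer G (x : Fin n → Ω) := by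
      ext g
      simp [MulAction.mem_stabilizer_iff, Subtype.ext_iff]
    rw [h]
    exact stabilizer_tuple_mem _

theorem orbitSet_isTransitive {n : ℕ} (a : Fin n → Ω) :
    (orbitSet (G := G) a).IsTransitive :=
  ⟨⟨⟨a, MulAction.mem_orbit_self a⟩⟩,
    inferInstanceAs (MulAction.IsPretransitive G (MulAction.orbit G a))⟩

/-- The basic map from the orbit of `a ∈ Ω ^ (l + 1)` to an orbit on `Ω ^ l`: the projection onto
the first `l` coordinates. -/
def basicMap {l : ℕ} (a : Fin (l + 1) → Ω) :
    orbitSet (G := G) a →[G] orbitSet (G := G) (Fin.init a) where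
  toFun y := ⟨Fin.init y.1, by
    obtain ⟨_, g, rfl⟩ := y
    exact ⟨g, rfl⟩⟩
  map_smul' _ _ := rfl

variable (G Ω)

/-- `Θ_{≤ 1}(G, Ω)`: the additive subgroup of `Θ(G, Ω)` generated by the basic classes. -/
noncomputable def thetaLeOne : Submodule ℤ (Theta G (stabClass G Ω)) :=
  Submodule.span ℤ {x | ∃ (l : ℕ) (a : Fin (l + 1) → Ω),
    x = thetaClass (basicMap (G := G) a) (orbitSet_isTransitive _)}

/-- The `ℤ[1/m]`-module `Θ_{≤ 1}(G, Ω)[1/m]`. -/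
abbrev ThetaLeOneAway (m : ℕ) : Type (u + 1) :=
  LocalizedModule (Submonoid.powers (m : ℤ)) (thetaLeOne G Ω)

/-- The condition `GEN(m)`: `Θ_{≤ 1}(G, Ω)[1/m]` is a finitely generated `ℤ[1/m]`-module. -/
def GEN (m : ℕ) : Prop :=
  Module.Finite (Localization.Away (m : ℤ)) (ThetaLeOneAway G Ω m)

/-- The ring `Θ*(G, Ω)[1/m]`. -/
abbrev ThetaStarAway (m : ℕ) : Type (u + 1) :=
  Localization.Away (m : ThetaStar G (stabClass G Ω))

variable {G Ω}

/-- The image in `Θ*(G, Ω)[1/m]` of the class `[f]` of a map `f : Y → X` with `X` transitive. -/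
noncomputable def thetaStarAwayClass (m : ℕ) {Y X : SmoothSet G (stabClass G Ω)}
    (f : Y →[G] X) (hX : X.IsTransitive) : ThetaStarAway G Ω m :=
  algebraMap (ThetaStar G (stabClass G Ω)) (ThetaStarAway G Ω m)
    (algebraMap (Theta G (stabClass G Ω)) (ThetaStar G (stabClass G Ω)) (thetaClass f hX))

end Filtration

/-! Fix a prime p not dividing m. The nonconstant words of length p in a fibre of a map f, taken up
to rotation, again form a smooth set. Indeed, an element fixing such a necklace rotates the word, so
it normalizes the stabilizer of the word and its p-th power lies there; IND(m) then makes it fix the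
word itself (`IsOligomorphic.isPrimeToIndex`, `stabilizer_necklace`). Sorting all words into
constant ones and rotation classes gives [f]^p = [f] + p ν(f), where ν(f) is the measure of the
necklaces (`mu_pow_eq`). The operation ν respects the relations of Θ (`isDeltaOperation_nuSymbol`),
so −ν defines a δ-structure on Θ whose Frobenius lift is the identity. Hence Θ has no p-torsion, and
x^p ≡ x modulo p for every x.

The basic classes generate Θ as a ring, so GEN(m) makes Θ[1/m] a finitely generated ring. Writing dx
= d(x^p − p w) shows that its differentials are divisible by every p not dividing m, and Nakayama's
lemma kills them. Thus Θ ⊗ ℚ is a finite product of number fields K. If K ≠ ℚ, the congruences would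
force almost every p to be the norm of two distinct primes of K. Products of such primes would give
more ideals of norm at most s than any constant times s, whereas the ideal count grows linearly
(`NumberField.not_forall_exists_pair_absNorm_eq`). So K = ℚ: Θ has finitely many characters to ℚ,
and an element killed by all of them is torsion (`finite_ringHom_rat_and_exists_mul_eq_zero`).

The characters are integral away from m: they have bounded denominators on the basic classes, and
for a basic class b the element (b^p − b)/p is a sum of products of p basic classes, which pushes
the denominators down to 1 (`RingHom.mem_subring_of_pow_eq_add_mul`). If f is a map of transitive
sets, [f] divides ν(f), so a nonzero value x of [f] satisfies x^(p−1) = 1 + p w and is a p-adic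
unit. The characters vanishing on no class [f] therefore extend to Θ*[1/m] → ℤ[1/m]. The other
characters are disposed of by multiplying with a class they kill, which is a unit of Θ*, so the
extended characters detect all elements.

Two characters to ℤ[1/m] that agree modulo one p agree modulo all its powers, again by x = x^p − p w
(`RingHom.eq_of_forall_dvd_sub`). Distinct characters thus have comaximal kernels, and the Chinese
remainder theorem gives the isomorphism. Modulo p a character is determined by its nonzero values on
at most r basic classes, which leaves (p − 1)^r possibilities (`card_le_pow_of_forall_ne_zero`). -/

/-! ### Counting ideals: almost all primes cannot be norms of two prime ideals -/

open NumberField in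
theorem NumberField.exists_forall_card_absNorm_le_mul (K : Type*) [Field K] [NumberField K] :
    ∃ C : ℝ, ∀ᶠ s : ℝ in Filter.atTop,
      (Nat.card {I : Ideal (𝓞 K) // Ideal.absNorm I ≤ s} : ℝ) ≤ C * s := by
  have h := NumberField.Ideal.tendsto_norm_le_div_atTop K
  obtain ⟨C, hC⟩ : ∃ C : ℝ, Filter.Tendsto _ _ (nhds C) := ⟨_, h⟩
  refine ⟨C + 1, ?_⟩
  filter_upwards [hC.eventually_le_const (lt_add_one C), Filter.eventually_gt_atTop 0] with s hs hs0
  rwa [div_le_iff₀ hs0] at hs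

/-- Two choices of prime ideal above each prime number away from `N` give distinct ideals for
distinct pairs of natural numbers prime to `N`. -/
theorem Ideal.injOn_prod_map_primeFactorsList {A : Type*} [CommRing A] [IsDedekindDomain A]
    [Module.Free ℤ A] {N : ℕ} {P Q : ℕ → Ideal A}
    (hP : ∀ p, p.Prime → ¬ p ∣ N → Prime (P p) ∧ Ideal.absNorm (P p) = p)
    (hQ : ∀ p, p.Prime → ¬ p ∣ N → Prime (Q p) ∧ Ideal.absNorm (Q p) = p)
    (hPQ : ∀ p, p.Prime → ¬ p ∣ N → P p ≠ Q p) {n k n' k' : ℕ}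
    (hn : n.Coprime N) (hk : k.Coprime N) (hn' : n'.Coprime N) (hk' : k'.Coprime N)
    (n0 : n ≠ 0) (k0 : k ≠ 0) (n0' : n' ≠ 0) (k0' : k' ≠ 0)
    (h : (n.primeFactorsList.map P).prod * (k.primeFactorsList.map Q).prod =
      (n'.primeFactorsList.map P).prod * (k'.primeFactorsList.map Q).prod) : n = n' ∧ k = k' := by
  classical
  have good : ∀ {n : ℕ}, n.Coprime N → n ≠ 0 → ∀ p ∈ n.primeFactorsList, p.Prime ∧ ¬ p ∣ N := by
    intro n hn n0 p hp
    rw [Nat.mem_primeFactorsList n0] at hp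
    refine ⟨hp.1, fun hd => ?_⟩
    exact hp.1.one_lt.ne' (Nat.dvd_one.1 (hn ▸ Nat.dvd_gcd hp.2 hd))
  set g : ℕ ⊕ ℕ → Ideal A := Sum.elim P Q with hg
  let S : ℕ → ℕ → Multiset (ℕ ⊕ ℕ) := fun n k =>
    ((n.primeFactorsList : Multiset ℕ).map Sum.inl) + (k.primeFactorsList : Multiset ℕ).map Sum.inr
  have hS : ∀ n k, ((S n k).map g).prod =
      (n.primeFactorsList.map P).prod * (k.primeFactorsList.map Q).prod := by
    intro n k
    simp [S, hg, Function.comp_def]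
  have key : ∀ {n k : ℕ}, n.Coprime N → k.Coprime N → n ≠ 0 → k ≠ 0 → ∀ x ∈ S n k,
      Prime (g x) ∧ (Ideal.absNorm (g x)) = Sum.elim id id x ∧
      (Sum.elim id id x : ℕ).Prime ∧ ¬ Sum.elim id id x ∣ N := by
    intro n k hn hk n0 k0 x hx
    simp only [S, Multiset.mem_add, Multiset.mem_map, Multiset.mem_coe] at hx
    rcases hx with ⟨p, hp, rfl⟩ | ⟨p, hp, rfl⟩
    · have := good hn n0 p hp
      simp [hg, hP p this.1 this.2, this]
    · have := good hk k0 p hp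
      simp [hg, hQ p this.1 this.2, this]
  have hmap : (S n k).map g = (S n' k').map g := by
    have h1 := UniqueFactorizationMonoid.normalizedFactors_prod_of_prime (m := (S n k).map g)
      (by intro q hq; obtain ⟨x, hx, rfl⟩ := Multiset.mem_map.1 hq; exact (key hn hk n0 k0 x hx).1)
    have h2 := UniqueFactorizationMonoid.normalizedFactors_prod_of_prime (m := (S n' k').map g)
      (by intro q hq; obtain ⟨x, hx, rfl⟩ := Multiset.mem_map.1 hq
          exact (key hn' hk' n0' k0' x hx).1)
    rw [← h1, ← h2, hS, hS, h]
  -- recover the multiset of labels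
  have hSS : S n k = S n' k' := by
    -- The norm of a factor returns the prime number p, and comparison with `P p` tells which of the
    -- two chosen ideals it is.
    let inv : Ideal A → ℕ ⊕ ℕ := fun I =>
      if I = P (Ideal.absNorm I) then Sum.inl (Ideal.absNorm I) else Sum.inr (Ideal.absNorm I)
    have hinv : ∀ {n k : ℕ}, n.Coprime N → k.Coprime N → n ≠ 0 → k ≠ 0 →
        ((S n k).map g).map inv = S n k := by
      intro n k hn hk n0 k0
      rw [Multiset.map_map]
      refine (Multiset.map_congr rfl fun x hx => ?_).trans (Multiset.map_id _)
      obtain ⟨_, h2, h3, h4⟩ := key hn hk n0 k0 x hx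
      rcases x with p | p
      · simp only [Sum.elim_inl, id] at h2 h3 h4
        simp only [Function.comp, inv, h2, id]
        simp [hg]
      · simp only [Sum.elim_inr, id] at h2 h3 h4
        simp only [Function.comp, inv, h2, id]
        simp [hg, (hPQ p h3 h4).symm]
    rw [← hinv hn hk n0 k0, ← hinv hn' hk' n0' k0', hmap]
  have hL := congrArg (Multiset.filterMap Sum.getLeft?) hSS
  have hR := congrArg (Multiset.filterMap Sum.getRight?) hSS
  simp only [S, Multiset.filterMap_add, Multiset.filterMap_map] at hL hR
  have e1 : ∀ l : List ℕ, Multiset.filterMap (Sum.getLeft? ∘ (Sum.inl : ℕ → ℕ ⊕ ℕ)) (l : Multiset ℕ) = l := by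
    intro l
    exact Multiset.filterMap_some _
  have e2 : ∀ l : List ℕ, Multiset.filterMap (Sum.getLeft? ∘ (Sum.inr : ℕ → ℕ ⊕ ℕ)) (l : Multiset ℕ) = 0 := by
    intro l
    induction l with
    | nil => rfl
    | cons a l ih => rw [← Multiset.cons_coe, Multiset.filterMap_cons_none _ _ rfl, ih]
  have e3 : ∀ l : List ℕ, Multiset.filterMap (Sum.getRight? ∘ (Sum.inr : ℕ → ℕ ⊕ ℕ)) (l : Multiset ℕ) = l := by
    intro l
    exact Multiset.filterMap_some _
  have e4 : ∀ l : List ℕ, Multiset.filterMap (Sum.getRight? ∘ (Sum.inl : ℕ → ℕ ⊕ ℕ)) (l : Multiset ℕ) = 0 := by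
    intro l
    induction l with
    | nil => rfl
    | cons a l ih => rw [← Multiset.cons_coe, Multiset.filterMap_cons_none _ _ rfl, ih]
  rw [e1, e2, e1, e2, add_zero, add_zero, Multiset.coe_eq_coe] at hL
  rw [e3, e4, e3, e4, zero_add, zero_add, Multiset.coe_eq_coe] at hR
  exact ⟨Nat.eq_of_perm_primeFactorsList n0 n0' hL, Nat.eq_of_perm_primeFactorsList k0 k0' hR⟩

theorem Ideal.absNorm_prod_map_primeFactorsList {A : Type*} [CommRing A] [IsDedekindDomain A]
    [Module.Free ℤ A] {N : ℕ} {P : ℕ → Ideal A}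
    (hP : ∀ p, p.Prime → ¬ p ∣ N → Ideal.absNorm (P p) = p) {n : ℕ}
    (hn : n.Coprime N) (n0 : n ≠ 0) : Ideal.absNorm (n.primeFactorsList.map P).prod = n := by
  rw [map_list_prod, List.map_map]
  conv_rhs => rw [← Nat.prod_primeFactorsList n0]
  congr 1
  refine (List.map_congr_left fun p hp => ?_).trans (List.map_id _)
  rw [Nat.mem_primeFactorsList n0] at hp
  exact hP p hp.1 fun hd => hp.1.one_lt.ne' (Nat.dvd_one.1 (hn ▸ Nat.dvd_gcd hp.2 hd))

/-- Comparison with the harmonic series: 1 + N i ≤ (N + 1)(i + 1). -/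
theorem exists_lt_sum_one_div_one_add_mul (N : ℕ) (C : ℝ) :
    ∃ M : ℕ, C < ∑ i ∈ Finset.range M, (1 : ℝ) / (1 + N * i) := by
  have h := Real.tendsto_sum_range_one_div_nat_succ_atTop
  obtain ⟨M, hM⟩ := (h.eventually_gt_atTop (C * (N + 1))).exists
  refine ⟨M, ?_⟩
  have hN : (0 : ℝ) < N + 1 := by positivity
  rw [← lt_div_iff₀ hN] at hM
  refine hM.trans_le ?_
  rw [Finset.sum_div]
  refine Finset.sum_le_sum fun i _ => ?_
  rw [div_div]
  refine one_div_le_one_div_of_le (by positivity) ?_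
  have : (0:ℝ) ≤ i := by positivity
  have : (0:ℝ) ≤ N := by positivity
  nlinarith

open NumberField in
/-- It is impossible that almost all prime numbers are norms of two distinct prime ideals of a
number field. -/
theorem NumberField.not_forall_exists_pair_absNorm_eq (K : Type*) [Field K] [NumberField K]
    {N : ℕ} (hN : 0 < N)
    (h : ∀ p : ℕ, p.Prime → ¬ p ∣ N → ∃ P Q : Ideal (𝓞 K), P ≠ Q ∧ P.IsPrime ∧ Q.IsPrime ∧
      Ideal.absNorm P = p ∧ Ideal.absNorm Q = p) : False := by
  classical
  choose! P Q hne hP hQ nP nQ using h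
  have prm : ∀ (I : Ideal (𝓞 K)) (p : ℕ), p.Prime → I.IsPrime → Ideal.absNorm I = p → Prime I := by
    intro I p hp hI hn
    refine Ideal.prime_of_isPrime (fun h0 => ?_) hI
    rw [h0, Ideal.absNorm_bot] at hn
    exact hp.ne_zero hn.symm
  obtain ⟨C, hC⟩ := NumberField.exists_forall_card_absNorm_le_mul K
  -- Pairs (i, j) with (1 + N i)(1 + N j) ≤ s and i < M give distinct ideals, and there are at least
  -- (s Σ 1/(1 + N i) − M)/N of them. With Σ > N C + 1 and s ≥ M + 1 this exceeds C s.
  obtain ⟨M, hM⟩ := exists_lt_sum_one_div_one_add_mul N (N * C + 1)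
  obtain ⟨s, hs1, hs2⟩ := (hC.and (Filter.eventually_ge_atTop (M + 1 : ℝ))).exists
  have hs0 : 0 < s := lt_of_lt_of_le (by positivity) hs2
  have hNR : (0 : ℝ) < N := by exact_mod_cast hN
  -- the index set
  let L : ℕ → ℕ := fun i => ⌊(s / (1 + N * i) - 1) / N + 1⌋₊
  let T : Finset (Σ _ : ℕ, ℕ) := (Finset.range M).sigma fun i => Finset.range (L i)
  have hfin : Finite {I : Ideal (𝓞 K) // (Ideal.absNorm I : ℝ) ≤ s} := by
    have := Ideal.finite_setOfPred_absNorm_le (S := 𝓞 K) ⌊s⌋₊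
    simp_rw [← Nat.le_floor_iff hs0.le]
    exact this.to_subtype
  have cop : ∀ i : ℕ, (1 + N * i).Coprime N := fun i => by simp
  have ne0 : ∀ i : ℕ, 1 + N * i ≠ 0 := fun i => by omega
  let F : (Σ _ : ℕ, ℕ) → Ideal (𝓞 K) := fun x =>
    ((1 + N * x.1).primeFactorsList.map P).prod * ((1 + N * x.2).primeFactorsList.map Q).prod
  have hFn : ∀ x, Ideal.absNorm (F x) = (1 + N * x.1) * (1 + N * x.2) := by
    intro x
    rw [map_mul, Ideal.absNorm_prod_map_primeFactorsList nP (cop _) (ne0 _),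
      Ideal.absNorm_prod_map_primeFactorsList nQ (cop _) (ne0 _)]
  have hFT : ∀ x ∈ T, (Ideal.absNorm (F x) : ℝ) ≤ s := by
    rintro ⟨i, j⟩ hx
    simp only [T, Finset.mem_sigma, Finset.mem_range] at hx
    rw [hFn]
    have hj : (j + 1 : ℕ) ≤ L i := hx.2
    have hpos : (0:ℝ) < 1 + N * i := by positivity
    have hj' := (Nat.le_floor_iff' (Nat.succ_ne_zero j)).1 hj
    push_cast at hj' ⊢
    have h1 : (j : ℝ) ≤ (s / (1 + N * i) - 1) / N := by linarith
    rw [le_div_iff₀ hNR] at h1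
    have h2 : 1 + (N:ℝ) * j ≤ s / (1 + N * i) := by linarith
    rw [le_div_iff₀ hpos] at h2
    linarith
  have hinj : Set.InjOn F T := by
    rintro ⟨i, j⟩ _ ⟨i', j'⟩ _ hij
    have := Ideal.injOn_prod_map_primeFactorsList (N := N)
      (fun p hp hd => ⟨prm _ p hp (hP p hp hd) (nP p hp hd), nP p hp hd⟩)
      (fun p hp hd => ⟨prm _ p hp (hQ p hp hd) (nQ p hp hd), nQ p hp hd⟩) hne
      (cop i) (cop j) (cop i') (cop j') (ne0 i) (ne0 j) (ne0 i') (ne0 j') hij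
    have a : i = i' := Nat.eq_of_mul_eq_mul_left hN (by omega)
    have b : j = j' := Nat.eq_of_mul_eq_mul_left hN (by omega)
    rw [a, b]
  have hcard : T.card ≤ Nat.card {I : Ideal (𝓞 K) // (Ideal.absNorm I : ℝ) ≤ s} := by
    rw [← Nat.card_eq_finsetCard T]
    exact Nat.card_le_card_of_injective (fun x => ⟨F x.1, hFT x.1 x.2⟩)
      fun x y hxy => Subtype.ext (hinj x.2 y.2 (congrArg Subtype.val hxy))
  have hT : ∑ i ∈ Finset.range M, ((s / (1 + N * i) - 1) / N) ≤ (T.card : ℝ) := by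
    simp only [T, Finset.card_sigma, Finset.card_range, Nat.cast_sum]
    refine Finset.sum_le_sum fun i _ => ?_
    have := Nat.lt_floor_add_one ((s / (1 + N * i) - 1) / N + 1)
    simp only [L]
    linarith
  have h3 : ∑ i ∈ Finset.range M, ((s / (1 + N * i) - 1) / N) =
      (s * (∑ i ∈ Finset.range M, (1:ℝ) / (1 + N * i)) - M) / N := by
    rw [← Finset.sum_div, Finset.sum_sub_distrib, Finset.mul_sum]
    simp [div_eq_mul_inv]
  have h4 : (s * (∑ i ∈ Finset.range M, (1:ℝ) / (1 + N * i)) - M) / N ≤ C * s := by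
    rw [← h3]
    exact hT.trans ((by exact_mod_cast hcard : (T.card : ℝ) ≤ _).trans hs1)
  rw [div_le_iff₀ hNR] at h4
  have h5 := mul_lt_mul_of_pos_left hM hs0
  nlinarith

/-! ### Number fields in which x^p ≡ x modulo almost all p -/

section

open NumberField

theorem exists_pow_pow_sub_eq_mul {R : Type*} [CommRing R] {p : ℕ}
    (h : ∀ x : R, ∃ w, x ^ p - x = p * w) (x : R) (j : ℕ) : ∃ w, x ^ p ^ j - x = p * w := by
  induction j with
  | zero => exact ⟨0, by simp⟩
  | succ j ih =>
    obtain ⟨w, hw⟩ := ih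
    obtain ⟨v, hv⟩ := h (x ^ p ^ j)
    exact ⟨v + w, by rw [pow_succ, pow_mul, mul_add, ← hw, ← hv]; ring⟩

/-- Every element is a root of X^p − X, which has at most p roots in a domain. -/
theorem Nat.card_le_of_forall_pow_eq_self {F : Type*} [CommRing F] [IsDomain F] [Finite F] {p : ℕ}
    (hp : 1 < p) (h : ∀ z : F, z ^ p = z) : Nat.card F ≤ p := by
  classical
  have := Fintype.ofFinite F
  have hdeg : (Polynomial.X ^ p - Polynomial.X : Polynomial F).natDegree = p := by
    rw [Polynomial.natDegree_sub_eq_left_of_natDegree_lt] <;> simp [hp]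
  have hne : (Polynomial.X ^ p - Polynomial.X : Polynomial F) ≠ 0 :=
    Polynomial.ne_zero_of_natDegree_gt (n := 0) (by omega)
  have hroots := Polynomial.card_roots' (Polynomial.X ^ p - Polynomial.X : Polynomial F)
  rw [hdeg] at hroots
  refine le_trans ?_ hroots
  rw [Nat.card_eq_fintype_card, ← Finset.card_univ]
  refine le_trans (Finset.card_le_card ?_) (Multiset.toFinset_card_le _)
  intro z _
  rw [Multiset.mem_toFinset, Polynomial.mem_roots hne]
  simp [h z]

/-- Every residue field above p satisfies z^p = z, so every prime above p has norm p. The quotient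
by p is reduced, since z ≡ z^(p^k) modulo p. If only one prime P lay above p, then P = (p) would
have norm p^[K:ℚ] rather than p. -/
theorem NumberField.exists_pair_absNorm_eq (K : Type*) [Field K] [NumberField K] {p : ℕ}
    (hp : p.Prime) (hK : 1 < Module.finrank ℚ K) (h : ∀ x : 𝓞 K, ∃ w, x ^ p - x = p * w) :
    ∃ P Q : Ideal (𝓞 K), P ≠ Q ∧ P.IsPrime ∧ Q.IsPrime ∧
      Ideal.absNorm P = p ∧ Ideal.absNorm Q = p := by
  classical
  have hnorm : Ideal.absNorm (Ideal.span {(p : 𝓞 K)}) = p ^ Module.finrank ℚ K := by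
    rw [Ideal.absNorm_span_natCast, RingOfIntegers.rank]
  have hP : ∀ P : Ideal (𝓞 K), P.IsPrime → (p : 𝓞 K) ∈ P → Ideal.absNorm P = p := by
    intro P hP hpP
    have hdvd : Ideal.absNorm P ∣ p ^ Module.finrank ℚ K := by
      rw [← hnorm]
      exact Ideal.absNorm_dvd_absNorm_of_le ((Ideal.span_singleton_le_iff_mem _).2 hpP)
    obtain ⟨j, -, hj⟩ := (Nat.dvd_prime_pow hp).1 hdvd
    have hne1 : Ideal.absNorm P ≠ 1 := by
      rw [Ne, Ideal.absNorm_eq_one_iff]; exact hP.ne_top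
    have hj0 : j ≠ 0 := by rintro rfl; simp [hj] at hne1
    have hpos : Ideal.absNorm P ≠ 0 := by rw [hj]; exact pow_ne_zero _ hp.ne_zero
    have hle : Ideal.absNorm P ≤ p := by
      rw [Ideal.absNorm_apply, Submodule.cardQuot_apply] at hpos ⊢
      have : Finite (𝓞 K ⧸ P) := Nat.finite_of_card_ne_zero hpos
      refine Nat.card_le_of_forall_pow_eq_self hp.one_lt fun z => ?_
      obtain ⟨x, rfl⟩ := Ideal.Quotient.mk_surjective z
      obtain ⟨w, hw⟩ := h x
      rw [← sub_eq_zero, ← map_pow, ← map_sub, hw, Ideal.Quotient.eq_zero_iff_mem]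
      exact P.mul_mem_right _ hpP
    refine le_antisymm hle ?_
    rw [hj]
    exact Nat.le_self_pow hj0 p
  have hne : Ideal.span {(p : 𝓞 K)} ≠ ⊤ := by
    rw [Ne, ← Ideal.absNorm_eq_one_iff, hnorm]
    exact (Nat.one_lt_pow (by omega) hp.one_lt).ne'
  obtain ⟨P, hPm, hPle⟩ := Ideal.exists_le_maximal _ hne
  have hpP : (p : 𝓞 K) ∈ P := hPle (Ideal.mem_span_singleton_self _)
  by_contra hcon
  push Not at hcon
  have huniq : ∀ Q : Ideal (𝓞 K), Q.IsPrime → (p : 𝓞 K) ∈ Q → P = Q := by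
    intro Q hQ hpQ
    by_contra hPQ
    exact hcon P Q hPQ hPm.isPrime hQ (hP P hPm.isPrime hpP) (hP Q hQ hpQ)
  have hPeq : P ≤ Ideal.span {(p : 𝓞 K)} := by
    intro z hz
    have hrad : z ∈ (Ideal.span {(p : 𝓞 K)}).radical := by
      rw [Ideal.radical_eq_sInf, Submodule.mem_sInf]
      rintro Q ⟨hQ1, hQ2⟩
      rw [← huniq Q hQ2 (hQ1 (Ideal.mem_span_singleton_self _))]
      exact hz
    obtain ⟨k, hk⟩ := hrad
    obtain ⟨w, hw⟩ := exists_pow_pow_sub_eq_mul h z k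
    have hk2 : z ^ p ^ k ∈ Ideal.span {(p : 𝓞 K)} :=
      Ideal.mem_of_dvd _ (pow_dvd_pow _ (Nat.lt_pow_self hp.one_lt).le) hk
    have : z = z ^ p ^ k - p * w := by rw [← hw]; ring
    rw [this]
    exact Ideal.sub_mem _ hk2 (Ideal.mul_mem_right _ _ (Ideal.mem_span_singleton_self _))
  have h1 := hP P hPm.isPrime hpP
  rw [le_antisymm hPeq hPle, hnorm] at h1
  exact (Nat.pow_lt_pow_right hp.one_lt hK).ne' (h1.trans (pow_one p).symm)

/-- A number field spanned by the image of a finitely generated ring in which `x ^ p ≡ x` modulo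
almost every prime number `p` is the field of rational numbers. -/
theorem NumberField.finrank_eq_one_of_pow_sub_self {R K : Type*} [CommRing R] [Field K]
    [NumberField K] [Algebra.FiniteType ℤ R] {m : ℕ} (hm : 0 < m)
    (h : ∀ p : ℕ, p.Prime → ¬ p ∣ m → ∀ x : R, ∃ w, x ^ p - x = p * w) (ψ : R →+* K)
    (hψ : ∀ z : K, ∃ n : ℕ, n ≠ 0 ∧ ∃ r, ψ r = n * z) : Module.finrank ℚ K = 1 := by
  classical
  have hpos : 0 < Module.finrank ℚ K := Module.finrank_pos
  by_contra hne
  have hK : 1 < Module.finrank ℚ K := by omega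
  -- a common denominator for `R`
  obtain ⟨N₁, hN₁, hR⟩ : ∃ N : ℕ, N ≠ 0 ∧ ∀ r : R, ∃ (k : ℕ) (a : 𝓞 K), (N : K) ^ k * ψ r = algebraMap (𝓞 K) K a := by
    obtain ⟨s, hs⟩ := (Algebra.FiniteType.out : (⊤ : Subalgebra ℤ R).FG)
    have hden : ∀ r : R, ∃ n : ℕ, n ≠ 0 ∧ ∃ a : 𝓞 K, (n : K) * ψ r = algebraMap (𝓞 K) K a := by
      intro r
      obtain ⟨n, hn, hint⟩ := ((IsFractionRing.isAlgebraic_iff ℤ ℚ K).2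
        (Algebra.IsAlgebraic.isAlgebraic (R := ℚ) (ψ r))).exists_integral_multiple
      refine ⟨n.natAbs, by simpa using hn, ?_⟩
      have : IsIntegral ℤ ((n.natAbs : K) * ψ r) := by
        rcases Int.natAbs_eq n with e | e
        · rw [e] at hint; simpa [zsmul_eq_mul] using hint
        · rw [e] at hint; simpa [zsmul_eq_mul] using hint.neg
      exact ⟨⟨_, this⟩, rfl⟩
    choose n hn a ha using hden
    refine ⟨∏ r ∈ s, n r, Finset.prod_ne_zero_iff.2 fun r _ => hn r, fun r => ?_⟩
    have hr : r ∈ Algebra.adjoin ℤ (s : Set R) := hs ▸ trivial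
    induction hr using Algebra.adjoin_induction with
    | mem x hx =>
      refine ⟨1, (∏ r ∈ s.erase x, n r : ℕ) * a x, ?_⟩
      rw [← Finset.mul_prod_erase s n hx]
      rw [map_mul, ← ha x, map_natCast]
      push_cast
      ring
    | algebraMap z => exact ⟨0, z, by simp⟩
    | add x y _ _ hx hy =>
      obtain ⟨k, b, hb⟩ := hx
      obtain ⟨l, c, hc⟩ := hy
      refine ⟨k + l, ((∏ r ∈ s, n r : ℕ) : 𝓞 K) ^ l * b + ((∏ r ∈ s, n r : ℕ) : 𝓞 K) ^ k * c, ?_⟩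
      rw [ψ.map_add, map_add, map_mul, map_mul, ← hb, ← hc]
      simp only [map_pow, map_natCast]
      ring
    | mul x y _ _ hx hy =>
      obtain ⟨k, b, hb⟩ := hx
      obtain ⟨l, c, hc⟩ := hy
      refine ⟨k + l, b * c, ?_⟩
      rw [ψ.map_mul, map_mul, ← hb, ← hc]
      ring
  -- a common denominator for the ring of integers
  obtain ⟨N₂, hN₂, hO⟩ : ∃ N : ℕ, N ≠ 0 ∧ ∀ a : 𝓞 K, ∃ r, ψ r = N * algebraMap (𝓞 K) K a := by
    obtain ⟨s, hs⟩ := (Module.Finite.fg_top : (⊤ : Submodule ℤ (𝓞 K)).FG)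
    choose n hn r hr using hψ
    refine ⟨∏ a ∈ s, n (algebraMap (𝓞 K) K a), Finset.prod_ne_zero_iff.2 fun a _ => hn _, fun a => ?_⟩
    have ha : a ∈ Submodule.span ℤ (s : Set (𝓞 K)) := hs ▸ trivial
    induction ha using Submodule.span_induction with
    | mem x hx =>
      refine ⟨(∏ a ∈ s.erase x, n (algebraMap (𝓞 K) K a) : ℕ) * r (algebraMap (𝓞 K) K x), ?_⟩
      rw [← Finset.mul_prod_erase s _ hx, map_mul, hr, map_natCast]
      push_cast
      ring
    | zero => exact ⟨0, by simp⟩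
    | add x y _ _ hx hy =>
      obtain ⟨b, hb⟩ := hx
      obtain ⟨c, hc⟩ := hy
      exact ⟨b + c, by rw [map_add, hb, hc, (algebraMap (𝓞 K) K).map_add]; ring⟩
    | smul z x _ hx =>
      obtain ⟨b, hb⟩ := hx
      refine ⟨z * b, ?_⟩
      rw [map_mul, hb, map_intCast, zsmul_eq_mul, (algebraMap (𝓞 K) K).map_mul, map_intCast]
      ring
  -- For p prime to both denominators, the congruence in R carries over to the ring of integers.
  refine NumberField.not_forall_exists_pair_absNorm_eq K (N := m * (N₁ * N₂)) (by positivity) ?_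
  intro p hp hpN
  refine NumberField.exists_pair_absNorm_eq K hp hK fun x => ?_
  have hpm : ¬ p ∣ m := fun hd => hpN (hd.mul_right _)
  have hp1 : ¬ p ∣ N₁ := fun hd => hpN ((hd.mul_right _).mul_left _)
  have hp2 : ¬ p ∣ N₂ := fun hd => hpN ((hd.mul_left _).mul_left _)
  obtain ⟨r, hr⟩ := hO x
  obtain ⟨w, hw⟩ := h p hp hpm r
  obtain ⟨k, b, hb⟩ := hR w
  have : Fact p.Prime := ⟨hp⟩
  -- The element r lies over N₂ x and not over x; Fermat's congruence for N₂ absorbs the factor N₂ ^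
  -- p.
  obtain ⟨c, hc⟩ : (p : ℤ) ∣ (N₂ : ℤ) ^ p - N₂ := by
    rw [← ZMod.intCast_zmod_eq_zero_iff_dvd]
    push_cast
    rw [ZMod.pow_card, sub_self]
  -- `N₁ ^ k * N₂ * (x ^ p - x)` is divisible by `p`
  have key : (N₁ : 𝓞 K) ^ k * N₂ * (x ^ p - x) = p * (b - N₁ ^ k * c * x ^ p) := by
    apply RingOfIntegers.coe_injective
    have hw' := congrArg ψ hw
    rw [map_sub, map_pow, hr, map_mul, map_natCast] at hw'
    have hc' : ((N₂ : K)) ^ p - N₂ = p * c := by exact_mod_cast congrArg (Int.cast : ℤ → K) hc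
    simp only [map_mul, map_sub, map_pow, map_natCast, map_intCast]
    rw [← hb]
    linear_combination (N₁ : K) ^ k * hw' - (N₁ : K) ^ k * (algebraMap (𝓞 K) K x) ^ p * hc'
  have hcop : IsCoprime ((N₁ ^ k * N₂ : ℕ) : ℤ) (p : ℤ) := by
    rw [Nat.isCoprime_iff_coprime]
    refine Nat.Coprime.mul_left (Nat.Coprime.pow_left _ ?_) ?_
    · exact ((Nat.Prime.coprime_iff_not_dvd hp).2 hp1).symm
    · exact ((Nat.Prime.coprime_iff_not_dvd hp).2 hp2).symm
  obtain ⟨u, v, huv⟩ := hcop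
  refine ⟨u * (b - N₁ ^ k * c * x ^ p) + v * (x ^ p - x), ?_⟩
  have huv' : (u : 𝓞 K) * (N₁ ^ k * N₂) + v * p = 1 := by exact_mod_cast congrArg (Int.cast : ℤ → 𝓞 K) huv
  linear_combination (u : 𝓞 K) * key - (x ^ p - x) * huv'

end

/-! ### Finitely generated rings with x^p ≡ x: unramifiedness and rational characters -/

section

open TensorProduct

instance Int.isJacobsonRing : IsJacobsonRing ℤ := by
  rw [isJacobsonRing_iff_prime_eq]
  intro P hP
  by_cases h0 : P = ⊥
  · subst h0
    refine le_antisymm (fun x hx => ?_) Ideal.le_jacobson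
    -- Membership of x in the Jacobson radical makes x² + 1 a unit, that is ±1.
    have := Ideal.mem_jacobson_bot.1 hx x
    rw [Int.isUnit_iff] at this
    rw [Ideal.mem_bot]
    rcases this with h | h <;> nlinarith [mul_self_nonneg x]
  · have := hP.isMaximal h0
    exact Ideal.jacobson_eq_self_of_isMaximal

/-- A finitely generated ring has no nonzero field quotient of characteristic zero; more precisely
every maximal ideal contains a prime number. -/
theorem Ideal.IsMaximal.exists_prime_natCast_mem {R : Type*} [CommRing R] [Algebra.FiniteType ℤ R]
    (M : Ideal R) [hM : M.IsMaximal] : ∃ p : ℕ, p.Prime ∧ (p : R) ∈ M := by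
  let _ : Field (R ⧸ M) := Ideal.Quotient.field M
  have hft : Algebra.FiniteType ℤ (R ⧸ M) :=
    Algebra.FiniteType.of_surjective (Ideal.Quotient.mkₐ ℤ M) Ideal.Quotient.mk_surjective
  have hfin : Module.Finite ℤ (R ⧸ M) := finite_of_finite_type_of_isJacobsonRing ℤ (R ⧸ M)
  obtain ⟨p, hp⟩ := CharP.exists (R ⧸ M)
  rcases CharP.char_is_prime_or_zero (R ⧸ M) p with h | rfl
  · refine ⟨p, h, ?_⟩
    rw [← Ideal.Quotient.eq_zero_iff_mem, map_natCast]
    exact CharP.cast_eq_zero _ _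
  · exfalso
    have : CharZero (R ⧸ M) := CharP.charP_to_charZero _
    have hinj : Function.Injective (algebraMap ℤ (R ⧸ M)) := by
      intro a b hab
      simpa using hab
    have := isField_of_isIntegral_of_isField hinj (Field.toIsField (R ⧸ M))
    exact Int.not_isField this

/-- Differentiating x = x^p − p w gives dx ∈ p Ω, so Ω = p Ω for every prime p not dividing m. A
maximal ideal containing the annihilator of Ω would contain such a p, because m is a unit;
Nakayama's lemma then contradicts the finite generation of Ω. -/
theorem Algebra.formallyUnramified_of_pow_sub_self {R : Type*} [CommRing R]
    [Algebra.FiniteType ℤ R] {m : ℕ} (hm : IsUnit (m : R))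
    (h : ∀ p : ℕ, p.Prime → ¬ p ∣ m → ∀ x : R, ∃ w, x ^ p - x = p * w) :
    Algebra.FormallyUnramified ℤ R := by
  rw [Algebra.formallyUnramified_iff]
  have hfg : (⊤ : Submodule R (Ω[R⁄ℤ])).FG := Module.Finite.fg_top
  have hann : Module.annihilator R (Ω[R⁄ℤ]) = ⊤ := by
    by_contra hne
    obtain ⟨M, hM, hle⟩ := Ideal.exists_le_maximal _ hne
    obtain ⟨p, hp, hpM⟩ := Ideal.IsMaximal.exists_prime_natCast_mem M
    have hpm : ¬ p ∣ m := by
      rintro ⟨k, rfl⟩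
      refine hM.ne_top (M.eq_top_of_isUnit_mem ?_ hm)
      rw [Nat.cast_mul]
      exact M.mul_mem_right _ hpM
    have hsmul : (⊤ : Submodule R (Ω[R⁄ℤ])) ≤ Ideal.span {(p : R)} • ⊤ := by
      rw [← KaehlerDifferential.span_range_derivation, Submodule.span_le]
      rintro _ ⟨x, rfl⟩
      obtain ⟨w, hw⟩ := h p hp hpm x
      have hx : x = x ^ p - p * w := by rw [← hw]; ring
      have hD : KaehlerDifferential.D ℤ R x =
          (p : R) • (x ^ (p - 1) • KaehlerDifferential.D ℤ R x - KaehlerDifferential.D ℤ R w) := by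
        conv_lhs => rw [hx]
        rw [map_sub, Derivation.leibniz, Derivation.leibniz_pow, Derivation.map_natCast, smul_zero,
          add_zero, smul_sub, Nat.cast_smul_eq_nsmul, Nat.cast_smul_eq_nsmul]
      rw [hD]
      refine Submodule.smul_mem_smul (Ideal.mem_span_singleton_self _) ?_
      rw [KaehlerDifferential.span_range_derivation]
      trivial
    obtain ⟨r, hr, hr0⟩ := Submodule.exists_sub_one_mem_and_smul_eq_zero_of_fg_of_le_smul
      _ _ hfg hsmul
    have hrM : r ∈ M := hle (Module.mem_annihilator.2 fun z => hr0 z trivial)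
    have h1 : r - 1 ∈ M := (Ideal.span_singleton_le_iff_mem M).2 hpM hr
    refine hM.ne_top ((Ideal.eq_top_iff_one M).2 ?_)
    have := M.sub_mem hrM h1
    simpa using this
  refine ⟨fun a b => ?_⟩
  have h1 : (1 : R) ∈ Module.annihilator R (Ω[R⁄ℤ]) := hann ▸ trivial
  rw [Module.mem_annihilator] at h1
  rw [← one_smul R a, ← one_smul R b, h1, h1]

theorem TensorProduct.exists_natCast_mul_eq_one_tmul {R : Type*} [CommRing R] (z : ℚ ⊗[ℤ] R) :
    ∃ n : ℕ, n ≠ 0 ∧ ∃ r : R, (n : ℚ ⊗[ℤ] R) * z = 1 ⊗ₜ r := by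
  induction z using TensorProduct.induction_on with
  | zero => exact ⟨1, one_ne_zero, 0, by simp⟩
  | tmul q r =>
    refine ⟨q.den, q.den_nz, q.num • r, ?_⟩
    rw [TensorProduct.tmul_smul, TensorProduct.smul_tmul', ← nsmul_eq_mul,
      TensorProduct.smul_tmul']
    congr 1
    rw [nsmul_eq_mul, zsmul_eq_mul, mul_one, mul_comm, Rat.mul_den_eq_num]
  | add x y hx hy =>
    obtain ⟨n, hn, r, hr⟩ := hx
    obtain ⟨k, hk, s, hs⟩ := hy
    refine ⟨n * k, mul_ne_zero hn hk, k • r + n • s, ?_⟩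
    rw [TensorProduct.tmul_add, TensorProduct.tmul_smul,
      TensorProduct.tmul_smul, ← hr, ← hs, nsmul_eq_mul, nsmul_eq_mul]
    push_cast
    ring

theorem TensorProduct.exists_natCast_mul_eq_zero {R : Type*} [CommRing R] {r : R}
    (hr : (1 : ℚ) ⊗ₜ[ℤ] r = 0) : ∃ n : ℕ, n ≠ 0 ∧ (n : R) * r = 0 := by
  have := (IsLocalizedModule.eq_zero_iff (nonZeroDivisors ℤ) (TensorProduct.mk ℤ ℚ R 1)).1 hr
  obtain ⟨c, hc⟩ := this
  refine ⟨(c : ℤ).natAbs, by simp, ?_⟩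
  rcases Int.natAbs_eq (c : ℤ) with e | e
  · rw [Submonoid.smul_def, e] at hc; simpa using hc
  · rw [Submonoid.smul_def, e] at hc; simpa using hc

theorem NumberField.exists_ratCast_eq_of_finrank_eq_one {K : Type*} [Field K] [NumberField K]
    (h : Module.finrank ℚ K = 1) (z : K) : ∃ c : ℚ, (c : K) = z := by
  obtain ⟨c, hc⟩ := (finrank_eq_one_iff_of_nonzero' _ one_ne_zero).1 h z
  exact ⟨c, by rw [← hc, Rat.smul_def, mul_one]⟩

/-- A finitely generated ring in which `x ^ p ≡ x` modulo every prime number `p` that is not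
invertible has finitely many homomorphisms to `ℚ`, and these detect elements up to torsion. -/
theorem finite_ringHom_rat_and_exists_mul_eq_zero {R : Type*} [CommRing R]
    [Algebra.FiniteType ℤ R] {m : ℕ} (hm : 0 < m) (hu : IsUnit (m : R))
    (h : ∀ p : ℕ, p.Prime → ¬ p ∣ m → ∀ x : R, ∃ w, x ^ p - x = p * w) :
    Finite (R →+* ℚ) ∧
      ∀ x : R, (∀ χ : R →+* ℚ, χ x = 0) → ∃ n : ℕ, n ≠ 0 ∧ (n : R) * x = 0 := by
  have := Algebra.formallyUnramified_of_pow_sub_self hu h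
  have hA : Algebra.FormallyUnramified ℚ (ℚ ⊗[ℤ] R) := inferInstance
  have hfin : Module.Finite ℚ (ℚ ⊗[ℤ] R) := Algebra.FormallyUnramified.finite_of_free ℚ _
  have hred : IsReduced (ℚ ⊗[ℤ] R) := Algebra.FormallyUnramified.isReduced_of_field ℚ _
  have hart : IsArtinianRing (ℚ ⊗[ℤ] R) := IsArtinianRing.of_finite ℚ _
  constructor
  · refine Finite.of_injective (β := (ℚ ⊗[ℤ] R) →ₐ[ℚ] ℚ)
      (fun χ => Algebra.TensorProduct.lift (AlgHom.id ℚ ℚ) χ.toIntAlgHom fun _ _ => Commute.all _ _)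
      fun χ ψ hχ => ?_
    ext r
    simpa using DFunLike.congr_fun hχ (1 ⊗ₜ r)
  · intro x hx
    apply TensorProduct.exists_natCast_mul_eq_zero
    -- The algebra is reduced and Artinian, so an element vanishing in all residue fields is zero.
    -- These residue fields are number fields, and each turns out to be ℚ.
    have hjac : (⊥ : Ideal (ℚ ⊗[ℤ] R)).jacobson = ⊥ := by
      rw [← Ideal.radical_eq_jacobson]
      exact nilradical_eq_zero _
    rw [← Ideal.mem_bot, ← hjac, Ideal.jacobson, Submodule.mem_sInf]
    rintro M ⟨-, hM⟩
    let _ : Field ((ℚ ⊗[ℤ] R) ⧸ M) := Ideal.Quotient.field M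
    have hc : CharZero ((ℚ ⊗[ℤ] R) ⧸ M) := algebraRat.charZero _
    have hnf : NumberField ((ℚ ⊗[ℤ] R) ⧸ M) := by
      refine @NumberField.mk _ _ hc ?_
      convert! (inferInstance : Module.Finite ℚ ((ℚ ⊗[ℤ] R) ⧸ M))
      exact Subsingleton.elim _ _
    let ψ : R →+* (ℚ ⊗[ℤ] R) ⧸ M :=
      (Ideal.Quotient.mk M).comp (Algebra.TensorProduct.includeRight : R →ₐ[ℤ] ℚ ⊗[ℤ] R).toRingHom
    have hone := NumberField.finrank_eq_one_of_pow_sub_self hm h ψ (by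
      intro z
      obtain ⟨y, rfl⟩ := Ideal.Quotient.mk_surjective z
      obtain ⟨n, hn, r, hr⟩ := TensorProduct.exists_natCast_mul_eq_one_tmul y
      refine ⟨n, hn, r, ?_⟩
      rw [← map_natCast (Ideal.Quotient.mk M), ← map_mul, hr]
      rfl)
    have hbij : Function.Bijective (Rat.castHom ((ℚ ⊗[ℤ] R) ⧸ M)) := by
      refine ⟨RingHom.injective _, fun z => ?_⟩
      exact NumberField.exists_ratCast_eq_of_finrank_eq_one hone z
    have hz := hx ((RingEquiv.ofBijective _ hbij).symm.toRingHom.comp ψ)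
    have : ψ x = 0 := by
      simpa using hz
    exact Ideal.Quotient.eq_zero_iff_mem.1 this

end

/-! ### Arithmetic of ℤ[1/m] -/

section Away

variable {m : ℕ}

theorem Localization.Away.isUnit_natCast : IsUnit (m : Localization.Away (m : ℤ)) := by
  have := IsLocalization.Away.algebraMap_isUnit (S := Localization.Away (m : ℤ)) (m : ℤ)
  simpa using this

theorem Localization.Away.powers_le_nonZeroDivisors (hm : 0 < m) :
    Submonoid.powers (m : ℤ) ≤ nonZeroDivisors ℤ :=
  powers_le_nonZeroDivisors_of_noZeroDivisors (by exact_mod_cast hm.ne')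

theorem Localization.Away.intCast_injective (hm : 0 < m) :
    Function.Injective (Int.cast : ℤ → Localization.Away (m : ℤ)) := by
  have := IsLocalization.injective (Localization.Away (m : ℤ))
    (Localization.Away.powers_le_nonZeroDivisors hm)
  intro a b h
  exact this (by simpa using h)

theorem Localization.Away.isDomain_int (hm : 0 < m) : IsDomain (Localization.Away (m : ℤ)) :=
  IsLocalization.isDomain_localization (Localization.Away.powers_le_nonZeroDivisors hm)

theorem Localization.Away.exists_natCast_pow_mul_eq (x : Localization.Away (m : ℤ)) :
    ∃ (k : ℕ) (z : ℤ), (m : Localization.Away (m : ℤ)) ^ k * x = z := by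
  obtain ⟨⟨z, ⟨_, k, rfl⟩⟩, h⟩ := IsLocalization.surj (Submonoid.powers (m : ℤ)) x
  refine ⟨k, z, ?_⟩
  simpa [mul_comm] using h

theorem Localization.Away.finiteType_int :
    @Algebra.FiniteType ℤ (Localization.Away (m : ℤ)) _ _ (Ring.toIntAlgebra _) := by
  have h := IsLocalization.finiteType_of_monoid_fg (Submonoid.powers (m : ℤ))
    (Localization.Away (m : ℤ))
  convert! h
  exact Subsingleton.elim _ _

theorem Localization.Away.not_isUnit_natCast (hm : 0 < m) {p : ℕ} (hp : p.Prime) (hpm : ¬ p ∣ m) :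
    ¬ IsUnit (p : Localization.Away (m : ℤ)) := by
  intro h
  obtain ⟨y, hy⟩ := h.exists_right_inv
  obtain ⟨k, z, hz⟩ := Localization.Away.exists_natCast_pow_mul_eq y
  have h1 : ((m ^ k : ℤ) : Localization.Away (m : ℤ)) = ((p * z : ℤ) : _) := by
    push_cast
    rw [← hz]
    linear_combination - (m : Localization.Away (m : ℤ)) ^ k * hy
  have h2 := Localization.Away.intCast_injective hm h1
  have h3 : (p : ℤ) ∣ ((m ^ k : ℕ) : ℤ) := ⟨z, by push_cast; exact h2⟩
  exact hpm (hp.dvd_of_dvd_pow (Int.natCast_dvd_natCast.1 h3))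

theorem Localization.Away.exists_intCast_sub_dvd {p : ℕ} (hp : p.Prime) (hpm : ¬ p ∣ m)
    (x : Localization.Away (m : ℤ)) : ∃ z : ℤ, (p : Localization.Away (m : ℤ)) ∣ x - z := by
  obtain ⟨k, z, hz⟩ := Localization.Away.exists_natCast_pow_mul_eq x
  have hcop : IsCoprime ((m ^ k : ℕ) : ℤ) (p : ℤ) := by
    rw [Nat.isCoprime_iff_coprime]
    exact Nat.Coprime.pow_left _ ((Nat.Prime.coprime_iff_not_dvd hp).2 hpm).symm
  obtain ⟨u, v, huv⟩ := hcop
  refine ⟨u * z, v * x, ?_⟩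
  have huv' : (u : Localization.Away (m : ℤ)) * (m ^ k) + v * p = 1 := by
    exact_mod_cast congrArg (Int.cast : ℤ → Localization.Away (m : ℤ)) huv
  push_cast
  rw [← hz]
  linear_combination - x * huv'

end Away

/-! ### Characters to ℤ[1/m]: separation modulo p and the Chinese remainder theorem -/

/-- In a^p − b^p = (Σ a^i b^(p−1−i)) (a − b), the first factor is congruent to p b^(p−1), hence to
0, modulo p. -/
theorem pow_dvd_pow_sub_pow_of_dvd {A : Type*} [CommRing A] {p n : ℕ} (hn : n ≠ 0) {a b : A}
    (h : (p : A) ^ n ∣ a - b) : (p : A) ^ (n + 1) ∣ a ^ p - b ^ p := by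
  rw [← Commute.geom_sum₂_mul (Commute.all a b), pow_succ', ]
  refine mul_dvd_mul ?_ h
  have h1 : (p : A) ∣ a - b := (dvd_pow_self _ hn).trans h
  rw [← Ideal.mem_span_singleton, ← Ideal.Quotient.eq_zero_iff_mem] at h1 ⊢
  have hab : Ideal.Quotient.mk (Ideal.span {(p : A)}) a = Ideal.Quotient.mk (Ideal.span {(p : A)}) b := by
    rw [← sub_eq_zero, ← map_sub, h1]
  have hp0 : (p : A ⧸ Ideal.span {(p : A)}) = 0 := by
    rw [← map_natCast (Ideal.Quotient.mk (Ideal.span {(p : A)})), Ideal.Quotient.eq_zero_iff_mem]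
    exact Ideal.mem_span_singleton_self _
  simp only [map_sum, map_mul, map_pow, hab, ← pow_add]
  rw [Finset.sum_congr rfl (g := fun _ => Ideal.Quotient.mk (Ideal.span {(p : A)}) b ^ (p - 1))]
  · simp [hp0]
  · intro i hi
    rw [Finset.mem_range] at hi
    congr 1
    omega

/-- Two distinct homomorphisms to `ℤ[1/m]` remain distinct modulo every prime not dividing `m`. -/
theorem RingHom.eq_of_forall_dvd_sub {S : Type*} [CommRing S] {m p : ℕ} (hm : 0 < m)
    (hp : p.Prime) (hpm : ¬ p ∣ m) (h : ∀ x : S, ∃ w, x ^ p - x = p * w)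
    (χ ψ : S →+* Localization.Away (m : ℤ))
    (hχ : ∀ s, (p : Localization.Away (m : ℤ)) ∣ χ s - ψ s) : χ = ψ := by
  have := Localization.Away.isDomain_int hm
  have : IsNoetherianRing (Localization.Away (m : ℤ)) :=
    IsLocalization.isNoetherianRing (Submonoid.powers (m : ℤ)) _ inferInstance
  -- From s = s^p − p w: the p-th powers gain one factor p, and the induction hypothesis applies to
  -- w because it is stated for all elements at once.
  have key : ∀ n : ℕ, ∀ s, (p : Localization.Away (m : ℤ)) ^ (n + 1) ∣ χ s - ψ s := by
    intro n
    induction n with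
    | zero => simpa using hχ
    | succ n ih =>
      intro s
      obtain ⟨w, hw⟩ := h s
      have h1 : χ s - ψ s = (χ s ^ p - ψ s ^ p) - p * (χ w - ψ w) := by
        have e1 := congrArg χ hw
        have e2 := congrArg ψ hw
        simp only [map_sub, map_pow, map_mul, map_natCast] at e1 e2
        linear_combination e2 - e1
      rw [h1]
      refine dvd_sub (pow_dvd_pow_sub_pow_of_dvd (Nat.succ_ne_zero n) (ih s)) ?_
      rw [pow_succ']
      exact mul_dvd_mul_left _ (ih w)
  ext s
  rw [← sub_eq_zero]
  by_contra hne
  obtain ⟨n, hn⟩ := FiniteMultiplicity.of_not_isUnit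
    (Localization.Away.not_isUnit_natCast hm hp hpm) hne
  exact hn (key n s)

/-- If finitely many homomorphisms to `ℤ[1/m]` detect the elements of a `ℤ[1/m]`-algebra `S` in
which `x ^ p ≡ x` modulo every prime `p` not dividing `m`, then `S` is the product of copies of
`ℤ[1/m]`. -/
theorem bijective_ringHom_pi_of_pow_sub_self {S : Type*} [CommRing S] {m : ℕ} (hm : 0 < m)
    (hu : IsUnit (m : S))
    (h : ∀ p : ℕ, p.Prime → ¬ p ∣ m → ∀ x : S, ∃ w, x ^ p - x = p * w)
    {ι : Type*} [Finite ι] (χ : ι → S →+* Localization.Away (m : ℤ)) (hχ : Function.Injective χ)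
    (hinj : ∀ s, (∀ i, χ i s = 0) → s = 0) : Function.Bijective (RingHom.pi χ) := by
  have := Fintype.ofFinite ι
  obtain ⟨u, hu⟩ := hu.exists_right_inv
  have hsurj : ∀ i, Function.Surjective (χ i) := by
    intro i x
    obtain ⟨k, z, hz⟩ := Localization.Away.exists_natCast_pow_mul_eq x
    refine ⟨u ^ k * z, ?_⟩
    have hu' := congrArg (χ i) hu
    rw [map_mul, map_natCast, map_one] at hu'
    rw [map_mul, map_pow, map_intCast, ← hz, ← mul_assoc, ← mul_pow, mul_comm _ (m : Localization.Away (m : ℤ)),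
      hu', one_pow, one_mul]
  have hft := Localization.Away.finiteType_int (m := m)
  have hcop : Pairwise (Function.onFun IsCoprime fun i => RingHom.ker (χ i)) := by
    intro i j hij
    rw [Function.onFun, Ideal.isCoprime_iff_sup_eq]
    by_contra hne
    obtain ⟨M, hM, hle⟩ := Ideal.exists_le_maximal _ hne
    have hi : RingHom.ker (χ i) ≤ M := le_sup_left.trans hle
    have hj : RingHom.ker (χ j) ≤ M := le_sup_right.trans hle
    -- As the kernel of `χ i` lies in M, the image of M is maximal in ℤ[1/m] and so contains a prime
    -- number p, which lies in M as well.
    have hM' : (M.map (χ i)).IsMaximal := by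
      refine (Ideal.map_eq_top_or_isMaximal_of_surjective _ (hsurj i) hM).resolve_left fun htop => ?_
      have := Ideal.comap_map_of_surjective' _ (hsurj i) M
      rw [htop, Ideal.comap_top, sup_eq_left.2 hi] at this
      exact hM.ne_top this.symm
    obtain ⟨p, hp, hpM⟩ := Ideal.IsMaximal.exists_prime_natCast_mem (M.map (χ i))
    have hpm : ¬ p ∣ m := by
      intro hd
      have hd' := Nat.cast_dvd_cast (α := Localization.Away (m : ℤ)) hd
      exact hM'.ne_top (Ideal.eq_top_of_isUnit_mem _ (Ideal.mem_of_dvd _ hd' hpM)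
        Localization.Away.isUnit_natCast)
    have hpM' : (p : S) ∈ M := by
      have := Ideal.comap_map_of_surjective' _ (hsurj i) M
      rw [sup_eq_left.2 hi] at this
      rw [← this, Ideal.mem_comap, map_natCast]
      exact hpM
    -- The residue field of M is 𝔽_p, through which `χ l` modulo p factors: one integer represents s
    -- modulo M and `χ l s` modulo p.
    have approx : ∀ l, RingHom.ker (χ l) ≤ M → ∀ s, ∃ z : ℤ,
        (p : Localization.Away (m : ℤ)) ∣ χ l s - z ∧ s - z ∈ M := by
      intro l hl s
      obtain ⟨z, y, hy⟩ := Localization.Away.exists_intCast_sub_dvd hp hpm (χ l s)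
      obtain ⟨t, rfl⟩ := hsurj l y
      refine ⟨z, ⟨_, hy⟩, ?_⟩
      have : s - z - p * t ∈ M := hl (by
        rw [RingHom.mem_ker]
        simp only [map_sub, map_mul, map_intCast, map_natCast, hy, sub_self])
      simpa using M.add_mem this (M.mul_mem_right t hpM')
    refine hij (hχ (RingHom.eq_of_forall_dvd_sub hm hp hpm (h p hp hpm) _ _ fun s => ?_))
    obtain ⟨z, hz, hzM⟩ := approx i hi s
    obtain ⟨z', hz', hzM'⟩ := approx j hj s
    -- Both integers represent s modulo M, and M contains no integer prime to p.
    have hd : (p : ℤ) ∣ z - z' := by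
      by_contra hnd
      have hc : IsCoprime (p : ℤ) (z - z') :=
        (Prime.coprime_iff_not_dvd (Nat.prime_iff_prime_int.1 hp)).2 hnd
      obtain ⟨a, b, hab⟩ := hc
      refine hM.ne_top ((Ideal.eq_top_iff_one M).2 ?_)
      have hab' : (a : S) * p + b * (z - z') = 1 := by
        exact_mod_cast congrArg (Int.cast : ℤ → S) hab
      rw [← hab']
      refine M.add_mem (M.mul_mem_left _ hpM') (M.mul_mem_left _ ?_)
      have := M.sub_mem hzM' hzM
      simpa using this
    obtain ⟨c, hc⟩ := hd
    have hc' : (z : Localization.Away (m : ℤ)) - z' = p * c := by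
      exact_mod_cast congrArg (Int.cast : ℤ → Localization.Away (m : ℤ)) hc
    have : χ i s - χ j s = (χ i s - z) - (χ j s - z') + p * c := by rw [← hc']; ring
    rw [this]
    exact dvd_add (dvd_sub hz hz') (dvd_mul_right _ _)
  constructor
  · rw [injective_iff_map_eq_zero]
    intro s hs
    exact hinj s fun i => congrFun hs i
  · intro y
    choose t ht using fun i => hsurj i (y i)
    obtain ⟨r, hr⟩ := Ideal.exists_forall_sub_mem_ideal hcop t
    refine ⟨r, funext fun i => ?_⟩
    have := hr i
    rw [RingHom.mem_ker, map_sub, sub_eq_zero] at this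
    rw [← ht i, ← this]
    rfl

/-! ### Words of prime length up to rotation -/

section Necklaces

variable {p : ℕ} {Y Z : Type*}

/-- Rotation of a cyclic word of length `p`. -/
def cyclicShift (c : ZMod p) (y : ZMod p → Y) : ZMod p → Y := fun i => y (i + c)

theorem cyclicShift_apply (c : ZMod p) (y : ZMod p → Y) (i : ZMod p) :
    cyclicShift c y i = y (i + c) := rfl

theorem cyclicShift_zero (y : ZMod p → Y) : cyclicShift 0 y = y := by
  funext i; simp [cyclicShift]

theorem cyclicShift_cyclicShift (c d : ZMod p) (y : ZMod p → Y) :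
    cyclicShift c (cyclicShift d y) = cyclicShift (c + d) y := by
  funext i; simp [cyclicShift, add_assoc]

theorem comp_cyclicShift (f : Y → Z) (c : ZMod p) (y : ZMod p → Y) :
    f ∘ cyclicShift c y = cyclicShift c (f ∘ y) := rfl

/-- A word all of whose letters are equal. -/
def IsConstWord (y : ZMod p → Y) : Prop := ∀ i, y i = y 0

theorem isConstWord_cyclicShift {c : ZMod p} {y : ZMod p → Y} :
    IsConstWord (cyclicShift c y) ↔ IsConstWord y := by
  constructor
  · intro h i
    have h1 := h (i - c)
    have h2 := h (-c)
    simp only [cyclicShift_apply, sub_add_cancel, neg_add_cancel, zero_add] at h1 h2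
    rw [h1, h2]
  · intro h i
    rw [cyclicShift_apply, cyclicShift_apply, h, h (0 + c)]

/-- Since p is prime, a nonzero c generates ℤ/p, so invariance under one such shift is invariance
under all. -/
theorem isConstWord_of_cyclicShift_eq [Fact p.Prime] {c : ZMod p} (hc : c ≠ 0) {y : ZMod p → Y}
    (h : cyclicShift c y = y) : IsConstWord y := by
  have key : ∀ n : ℕ, y (n * c) = y 0 := by
    intro n
    induction n with
    | zero => simp
    | succ n ih =>
      have := congrFun h (n * c)
      rw [cyclicShift_apply] at this
      rw [← ih, ← this]
      congr 1
      push_cast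
      ring
  intro i
  have := key (i / c).val
  rwa [ZMod.natCast_val, ZMod.cast_id, div_mul_cancel₀ _ hc] at this

theorem cyclicShift_injective_of_not_isConstWord [Fact p.Prime] {y : ZMod p → Y}
    (hy : ¬ IsConstWord y) : Function.Injective fun c => cyclicShift c y := by
  intro c d h
  by_contra hne
  refine hy (isConstWord_of_cyclicShift_eq (c := -d + c) ?_ ?_)
  · intro h0
    exact hne (by linear_combination h0)
  · have := congrArg (cyclicShift (-d)) h
    simpa [cyclicShift_cyclicShift, cyclicShift_zero] using this

variable (p Y) in
/-- Words of length `p` up to rotation. -/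
def necklaceSetoid : Setoid (ZMod p → Y) where
  r y z := ∃ c, z = cyclicShift c y
  iseqv :=
    { refl := fun y => ⟨0, (cyclicShift_zero y).symm⟩
      symm := by
        rintro y _ ⟨c, rfl⟩
        exact ⟨-c, by rw [cyclicShift_cyclicShift, neg_add_cancel, cyclicShift_zero]⟩
      trans := by
        rintro y _ _ ⟨c, rfl⟩ ⟨d, rfl⟩
        exact ⟨d + c, by rw [cyclicShift_cyclicShift]⟩ }

variable (p Y) in
/-- Words of length `p` up to rotation. -/
def Necklace : Type _ := Quotient (necklaceSetoid p Y)

/-- The necklace of a word. -/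
def Necklace.mk (y : ZMod p → Y) : Necklace p Y := Quotient.mk (necklaceSetoid p Y) y

theorem Necklace.mk_surjective : Function.Surjective (Necklace.mk : (ZMod p → Y) → Necklace p Y) :=
  Quotient.mk_surjective

theorem Necklace.mk_eq_mk {y z : ZMod p → Y} :
    Necklace.mk y = Necklace.mk z ↔ ∃ c, z = cyclicShift c y := Quotient.eq

theorem Necklace.mk_cyclicShift (c : ZMod p) (y : ZMod p → Y) :
    Necklace.mk (cyclicShift c y) = Necklace.mk y :=
  (Necklace.mk_eq_mk.2 ⟨c, rfl⟩).symm

/-- A representative of a necklace. -/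
noncomputable def Necklace.out (t : Necklace p Y) : ZMod p → Y := Quotient.out t

theorem Necklace.mk_out (t : Necklace p Y) : Necklace.mk t.out = t := Quotient.out_eq _

/-- The map on necklaces induced by a map of letters. -/
def Necklace.map (f : Y → Z) : Necklace p Y → Necklace p Z :=
  Quotient.map (f ∘ ·) (by rintro y _ ⟨c, rfl⟩; exact ⟨c, rfl⟩)

theorem Necklace.map_mk (f : Y → Z) (y : ZMod p → Y) :
    Necklace.map f (Necklace.mk y) = Necklace.mk (f ∘ y) := rfl

instance [NeZero p] [Finite Y] : Finite (Necklace p Y) :=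
  inferInstanceAs (Finite (Quotient (necklaceSetoid p Y)))

variable {A B : Type*} [CommRing A] [CommRing B]

open Classical in
/-- The sum of `a ^ i * b ^ (p - i)` over all two-coloured necklaces of prime length `p` that are
not monochromatic; this is `((a + b) ^ p - a ^ p - b ^ p) / p`. -/
noncomputable def necklaceSum (p : ℕ) [NeZero p] (a b : A) : A :=
  ∑ᶠ t : Necklace p Bool, if IsConstWord t.out then 0 else ∏ i, bif t.out i then a else b

theorem map_necklaceSum [NeZero p] (f : A →+* B) (a b : A) :
    f (necklaceSum p a b) = necklaceSum p (f a) (f b) := by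
  have := Fintype.ofFinite (Necklace p Bool)
  rw [necklaceSum, necklaceSum, finsum_eq_sum_of_fintype, finsum_eq_sum_of_fintype, map_sum]
  refine Finset.sum_congr rfl fun t _ => ?_
  split_ifs
  · exact map_zero f
  · rw [map_prod]
    exact Finset.prod_congr rfl fun i _ => by cases t.out i <;> rfl

/-- Every nonconstant word contains the first letter. Applied in a quotient ring, this shows that an
ideal containing a contains `necklaceSum p a b`. -/
theorem necklaceSum_zero_left [NeZero p] (b : A) : necklaceSum p 0 b = 0 := by
  rw [necklaceSum]
  refine (finsum_congr fun t => ?_).trans finsum_zero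
  split_ifs with h
  · rfl
  · have : ∃ i, t.out i = true := by
      by_contra hcon
      push Not at hcon
      exact h fun i => by rw [Bool.eq_false_of_not_eq_true (hcon i), Bool.eq_false_of_not_eq_true (hcon 0)]
    obtain ⟨i, hi⟩ := this
    exact Finset.prod_eq_zero (Finset.mem_univ i) (by simp [hi])

/-- Expand (a + b)^p over two-letter words. The two constant words give a^p and b^p; every other
word has exactly p rotations, all contributing the same monomial. -/
theorem natCast_mul_necklaceSum [hp : Fact p.Prime] (a b : A) :
    (p : A) * necklaceSum p a b = (a + b) ^ p - a ^ p - b ^ p := by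
  classical
  have := Fintype.ofFinite (Necklace p Bool)
  have hcard : Fintype.card (ZMod p) = p := ZMod.card p
  let M : (ZMod p → Bool) → A := fun τ => ∏ i, bif τ i then a else b
  have hM : ∀ c τ, M (cyclicShift c τ) = M τ := fun c τ =>
    Fintype.prod_equiv (Equiv.addRight c) _ _ fun i => rfl
  have h1 : (a + b) ^ p = ∑ τ, M τ := by
    have := Finset.prod_univ_sum (fun _ : ZMod p => (Finset.univ : Finset Bool))
      (fun _ x => bif x then a else b)
    simp only [Fintype.sum_bool, cond_true, cond_false, Finset.prod_const, Finset.card_univ, hcard,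
      Fintype.piFinset_univ] at this
    exact this
  have h2 : ∑ τ ∈ Finset.univ.filter (fun τ : ZMod p → Bool => IsConstWord τ), M τ = a ^ p + b ^ p := by
    have : Finset.univ.filter (fun τ : ZMod p → Bool => IsConstWord τ) =
        {fun _ => true, fun _ => false} := by
      ext τ
      simp only [Finset.mem_filter, Finset.mem_univ, true_and, Finset.mem_insert,
        Finset.mem_singleton, funext_iff]
      constructor
      · intro h
        cases h0 : τ 0
        · right; intro i; rw [h i, h0]
        · left; intro i; rw [h i, h0]
      · rintro (h | h) i <;> rw [h, h]
    rw [this, Finset.sum_pair (fun h => by simpa using congrFun h 0)]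
    simp [M, hcard]
  have h3 : ∑ τ ∈ Finset.univ.filter (fun τ : ZMod p → Bool => ¬ IsConstWord τ), M τ =
      p * necklaceSum p a b := by
    rw [necklaceSum, finsum_eq_sum_of_fintype, Finset.mul_sum,
      ← Finset.sum_fiberwise _ (fun τ => Necklace.mk τ)]
    refine Finset.sum_congr rfl fun t _ => ?_
    have hmem : ∀ τ, Necklace.mk τ = t ↔ ∃ c, cyclicShift c t.out = τ := by
      intro τ
      conv_lhs => rw [← Necklace.mk_out t, eq_comm, Necklace.mk_eq_mk]
      exact exists_congr fun c => eq_comm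
    split_ifs with h
    · rw [mul_zero]
      refine Finset.sum_eq_zero fun τ hτ => ?_
      simp only [Finset.mem_filter, Finset.mem_univ, true_and] at hτ
      obtain ⟨c, rfl⟩ := (hmem τ).1 hτ.2
      exact absurd (isConstWord_cyclicShift.2 h) hτ.1
    · have : (Finset.univ.filter fun τ : ZMod p → Bool => ¬ IsConstWord τ).filter
          (fun τ => Necklace.mk τ = t) = Finset.univ.image fun c => cyclicShift c t.out := by
        ext τ
        simp only [Finset.mem_filter, Finset.mem_univ, true_and, Finset.mem_image, hmem]
        constructor
        · exact fun h => h.2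
        · rintro ⟨c, rfl⟩
          exact ⟨fun hc => h (isConstWord_cyclicShift.1 hc), c, rfl⟩
      rw [this, Finset.sum_image (cyclicShift_injective_of_not_isConstWord h).injOn,
        Finset.sum_congr rfl fun c _ => hM c t.out, Finset.sum_const, Finset.card_univ, hcard,
        nsmul_eq_mul]
  have h4 := Finset.sum_filter_add_sum_filter_not Finset.univ (fun τ : ZMod p → Bool => IsConstWord τ) M
  rw [h2, h3, ← h1] at h4
  rw [← h4]
  ring

end Necklaces

/-! ### Frobenius lifts on polynomial rings and their quotients -/

section FrobeniusLift

variable {σ : Type*} {p : ℕ}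

/-- The lift of the Frobenius on a polynomial ring with prescribed `δ` on the variables. -/
noncomputable def MvPolynomial.frobeniusLift (p : ℕ) (d : σ → MvPolynomial σ ℤ) :
    MvPolynomial σ ℤ →+* MvPolynomial σ ℤ :=
  MvPolynomial.eval₂Hom MvPolynomial.C fun s => MvPolynomial.X s ^ p + (p : MvPolynomial σ ℤ) * d s

theorem MvPolynomial.frobeniusLift_X (d : σ → MvPolynomial σ ℤ) (s : σ) :
    MvPolynomial.frobeniusLift p d (MvPolynomial.X s) = MvPolynomial.X s ^ p + (p : MvPolynomial σ ℤ) * d s := by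
  simp [MvPolynomial.frobeniusLift]

variable [hp : Fact p.Prime]

/-- Let `P` be a polynomial ring over `ℤ` with a lift `φ` of the Frobenius. If an ideal `I` is
generated by elements `a` with `φ a = a ^ p + p * z`, `z ∈ I`, then all its elements are of this
form. -/
theorem exists_mem_of_mem_span_of_frobeniusLift {P : Type*} [CommRing P] (φ : P →+* P)
    (hφ : ∀ x, ∃ z, φ x = x ^ p + p * z) {s : Set P}
    (hs : ∀ a ∈ s, ∃ z ∈ Ideal.span s, φ a = a ^ p + p * z) {a : P} (ha : a ∈ Ideal.span s) :
    ∃ z ∈ Ideal.span s, φ a = a ^ p + p * z := by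
  induction ha using Submodule.span_induction with
  | mem a ha => exact hs a ha
  | zero => exact ⟨0, zero_mem _, by simp [hp.out.ne_zero]⟩
  | add a b ha hb iha ihb =>
    obtain ⟨z, hz, ez⟩ := iha
    obtain ⟨w, hw, ew⟩ := ihb
    refine ⟨z + w - necklaceSum p a b, sub_mem (add_mem hz hw) ?_, ?_⟩
    · rw [← Ideal.Quotient.eq_zero_iff_mem, map_necklaceSum, Ideal.Quotient.eq_zero_iff_mem.2 ha,
        necklaceSum_zero_left]
    · rw [map_add, ez, ew]
      linear_combination natCast_mul_necklaceSum (p := p) a b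
  | smul r a ha iha =>
    obtain ⟨z, hz, ez⟩ := iha
    obtain ⟨w, ew⟩ := hφ r
    have haz : a ^ p + p * z ∈ Ideal.span s :=
      add_mem (Ideal.pow_mem_of_mem _ ha _ hp.out.pos) (Ideal.mul_mem_left _ _ hz)
    refine ⟨r ^ p * z + w * (a ^ p + p * z), add_mem (Ideal.mul_mem_left _ _ hz)
      (Ideal.mul_mem_left _ _ haz), ?_⟩
    rw [smul_eq_mul, map_mul, ez, ew]
    ring

/-- Constants are handled by Fermat's little theorem, sums by the necklace polynomial, and the
variables by construction. -/
theorem MvPolynomial.exists_frobeniusLift_eq (d : σ → MvPolynomial σ ℤ) (x : MvPolynomial σ ℤ) :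
    ∃ z, MvPolynomial.frobeniusLift p d x = x ^ p + (p : MvPolynomial σ ℤ) * z := by
  induction x using MvPolynomial.induction_on with
  | C a =>
    obtain ⟨c, hc⟩ : (p : ℤ) ∣ a - a ^ p := by
      rw [← ZMod.intCast_zmod_eq_zero_iff_dvd]
      push_cast
      rw [ZMod.pow_card, sub_self]
    refine ⟨MvPolynomial.C c, ?_⟩
    have : (MvPolynomial.C a : MvPolynomial σ ℤ) - MvPolynomial.C a ^ p =
        (p : MvPolynomial σ ℤ) * MvPolynomial.C c := by
      rw [← map_pow, ← map_sub, hc, map_mul, map_natCast]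
    rw [← this]
    simp [MvPolynomial.frobeniusLift]
  | add a b iha ihb =>
    obtain ⟨z, ez⟩ := iha
    obtain ⟨w, ew⟩ := ihb
    refine ⟨z + w - necklaceSum p a b, ?_⟩
    rw [map_add, ez, ew]
    linear_combination natCast_mul_necklaceSum (p := p) a b
  | mul_X a s iha =>
    obtain ⟨z, ez⟩ := iha
    refine ⟨a ^ p * d s + z * (X s ^ p + (p : MvPolynomial σ ℤ) * d s), ?_⟩
    rw [map_mul, ez, frobeniusLift_X]
    ring

/-- The `δ` of a difference of two congruent elements. -/
theorem exists_mem_sub_of_frobeniusLift {P : Type*} [CommRing P] (φ : P →+* P) {I : Ideal P}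
    {a b za zb : P} (hab : a - b ∈ I) (ha : φ a = a ^ p + p * za) (hb : φ b = b ^ p + p * zb)
    (hz : za - zb ∈ I) : ∃ z ∈ I, φ (a - b) = (a - b) ^ p + p * z := by
  refine ⟨za - zb + necklaceSum p (a - b) b, add_mem hz ?_, ?_⟩
  · rw [← Ideal.Quotient.eq_zero_iff_mem, map_necklaceSum, Ideal.Quotient.eq_zero_iff_mem.2 hab,
      necklaceSum_zero_left]
  · rw [map_sub, ha, hb, mul_add, natCast_mul_necklaceSum, sub_add_cancel]
    ring

/-- A quotient of a polynomial ring by an ideal stable under `δ`, such that the lift of the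
Frobenius induces the identity, has no `p`-torsion and satisfies `x ^ p ≡ x` modulo `p`. -/
theorem MvPolynomial.torsionFree_and_pow_sub_self (d : σ → MvPolynomial σ ℤ)
    {s : Set (MvPolynomial σ ℤ)} {A : Type*} [CommRing A] (π : MvPolynomial σ ℤ →+* A)
    (hπ : Function.Surjective π) (hker : ∀ x, π x = 0 ↔ x ∈ Ideal.span s)
    (hs : ∀ a ∈ s, ∃ z ∈ Ideal.span s,
      MvPolynomial.frobeniusLift p d a = a ^ p + (p : MvPolynomial σ ℤ) * z)
    (hd : ∀ i, π (MvPolynomial.X i) ^ p + p * π (d i) = π (MvPolynomial.X i)) :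
    (∀ x : A, p * x = 0 → x = 0) ∧ ∀ x : A, ∃ w, x ^ p - x = p * w := by
  have hid : ∀ x, π (frobeniusLift p d x) = π x := by
    intro x
    have : (π.comp (frobeniusLift p d)) = π := by
      refine MvPolynomial.ringHom_ext (fun r => ?_) fun i => ?_
      · simp [frobeniusLift]
      · rw [RingHom.comp_apply, frobeniusLift_X, map_add, map_mul, map_pow, map_natCast, hd i]
    exact DFunLike.congr_fun this x
  constructor
  · intro x hx
    obtain ⟨x, rfl⟩ := hπ x
    rw [← map_natCast π, ← map_mul, hker] at hx
    -- Cancelling p in φ(p x) = (p x)^p + p z gives z = φ(x) − p^(p−1) x^p, possible because the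
    -- polynomial ring has no torsion. With p x in the ideal, φ(x) is in it too, and φ induces the
    -- identity on the quotient.
    obtain ⟨z, hz, ez⟩ := exists_mem_of_mem_span_of_frobeniusLift (p := p) (frobeniusLift p d)
      (exists_frobeniusLift_eq d) hs hx
    have hp1 : p = (p - 1) + 1 := (Nat.succ_pred_prime hp.out).symm
    have hz' : z = frobeniusLift p d x - p ^ (p - 1) * x ^ p := by
      have hp0 : (p : MvPolynomial σ ℤ) ≠ 0 := by exact_mod_cast hp.out.ne_zero
      apply mul_left_cancel₀ hp0
      rw [map_mul, map_natCast] at ez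
      have : (p : MvPolynomial σ ℤ) ^ p = p * p ^ (p - 1) := by
        rw [← pow_succ', ← hp1]
      linear_combination -ez - x ^ p * this
    rw [← hid, hker]
    have : frobeniusLift p d x = z + (p * x) * (p ^ (p - 2) * x ^ (p - 1)) := by
      have h2 : p - 1 = (p - 2) + 1 := by have := hp.out.two_le; omega
      have e1 : (p : MvPolynomial σ ℤ) ^ (p - 1) = p * p ^ (p - 2) := by
        rw [← pow_succ', ← h2]
      have e2 : x ^ p = x * x ^ (p - 1) := by
        rw [← pow_succ', ← hp1]
      rw [hz', e1, e2]
      ring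
    rw [this]
    exact add_mem hz (Ideal.mul_mem_right _ _ hx)
  · intro x
    obtain ⟨x, rfl⟩ := hπ x
    obtain ⟨z, ez⟩ := exists_frobeniusLift_eq (p := p) d x
    refine ⟨- π z, ?_⟩
    have := hid x
    rw [ez, map_add, map_mul, map_pow, map_natCast] at this
    linear_combination this

end FrobeniusLift

/-! ### Delta operations on the ring Θ -/

section ThetaOperation

variable {G : Type u} [Group G] {E : Set (Subgroup G)}

/-- The class of a symbol. -/
noncomputable def ThetaSymbol.cls (s : ThetaSymbol G E) : Theta G E :=
  thetaClass s.map s.transitive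

variable (G E) in
/-- The presentation of the ring `Theta G E`. -/
noncomputable def Theta.mk : MvPolynomial (ThetaSymbol G E) ℤ →+* Theta G E :=
  Ideal.Quotient.mk (Ideal.span {q | ThetaRel G E q})

theorem Theta.mk_surjective : Function.Surjective (Theta.mk G E) := Ideal.Quotient.mk_surjective

theorem Theta.mk_eq_zero_iff {x : MvPolynomial (ThetaSymbol G E) ℤ} :
    Theta.mk G E x = 0 ↔ x ∈ Ideal.span {q | ThetaRel G E q} := Ideal.Quotient.eq_zero_iff_mem

theorem Theta.mk_X (s : ThetaSymbol G E) : Theta.mk G E (MvPolynomial.X s) = s.cls := rfl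

theorem thetaClass_eq_of_rel {P : MvPolynomial (ThetaSymbol G E) ℤ} (h : ThetaRel G E P) :
    Theta.mk G E P = 0 :=
  Theta.mk_eq_zero_iff.2 (Ideal.subset_span h)

theorem thetaClass_iso {Y X : SmoothSet G E} (hX : X.IsTransitive) (f : Y →[G] X)
    (hf : Function.Bijective f) : thetaClass f hX = 1 := by
  have := thetaClass_eq_of_rel (ThetaRel.iso hX f hf)
  rw [map_sub, map_one, sub_eq_zero] at this
  exact this

theorem thetaClass_add {Y Y₁ Y₂ X : SmoothSet G E} (hX : X.IsTransitive) (f : Y →[G] X)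
    (i₁ : Y₁ →[G] Y) (i₂ : Y₂ →[G] Y) (h₁ : Function.Injective i₁)
    (h₂ : Function.Injective i₂) (h : IsCompl (Set.range i₁) (Set.range i₂)) :
    thetaClass f hX = thetaClass (f.comp i₁) hX + thetaClass (f.comp i₂) hX := by
  have := thetaClass_eq_of_rel (ThetaRel.add hX f i₁ i₂ h₁ h₂ h)
  rw [map_sub, map_add, sub_eq_zero] at this
  exact this

theorem thetaClass_comp {Z Y X : SmoothSet G E} (hZ : Z.IsTransitive) (hY : Y.IsTransitive)
    (hX : X.IsTransitive) (g : Z →[G] Y) (f : Y →[G] X) :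
    thetaClass (f.comp g) hX = thetaClass f hX * thetaClass g hY := by
  have := thetaClass_eq_of_rel (ThetaRel.comp hZ hY hX g f)
  rw [map_sub, map_mul, sub_eq_zero] at this
  exact this

theorem thetaClass_baseChange {Y' Y X' X : SmoothSet G E} (hX : X.IsTransitive)
    (hX' : X'.IsTransitive) (g' : Y' →[G] Y) (f' : Y' →[G] X') (f : Y →[G] X) (g : X' →[G] X)
    (h : SmoothSet.IsCartesian g' f' f g) : thetaClass f hX = thetaClass f' hX' := by
  have := thetaClass_eq_of_rel (ThetaRel.baseChange hX hX' g' f' f g h)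
  rw [map_sub, sub_eq_zero] at this
  exact this

/-- An operation on symbols that is compatible with the relations in the way in which
`x ↦ (x ^ p - x) / p` is. -/
structure IsDeltaOperation (p : ℕ) [NeZero p] (ν : ThetaSymbol G E → Theta G E) : Prop where
  pow : ∀ s, s.cls ^ p = s.cls + p * ν s
  iso {Y X : SmoothSet G E} (hX : X.IsTransitive) (f : Y →[G] X) (hf : Function.Bijective f) :
    ν ⟨f, hX⟩ = 0
  add {Y Y₁ Y₂ X : SmoothSet G E} (hX : X.IsTransitive) (f : Y →[G] X)
    (i₁ : Y₁ →[G] Y) (i₂ : Y₂ →[G] Y) (h₁ : Function.Injective i₁)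
    (h₂ : Function.Injective i₂) (h : IsCompl (Set.range i₁) (Set.range i₂)) :
    ν ⟨f, hX⟩ = ν ⟨f.comp i₁, hX⟩ + ν ⟨f.comp i₂, hX⟩ +
      necklaceSum p (thetaClass (f.comp i₁) hX) (thetaClass (f.comp i₂) hX)
  comp {Z Y X : SmoothSet G E} (hZ : Z.IsTransitive) (hY : Y.IsTransitive)
    (hX : X.IsTransitive) (g : Z →[G] Y) (f : Y →[G] X) :
    ν ⟨f.comp g, hX⟩ = thetaClass f hX * ν ⟨g, hY⟩ + thetaClass g hY ^ p * ν ⟨f, hX⟩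
  baseChange {Y' Y X' X : SmoothSet G E} (hX : X.IsTransitive) (hX' : X'.IsTransitive)
    (g' : Y' →[G] Y) (f' : Y' →[G] X') (f : Y →[G] X) (g : X' →[G] X)
    (h : SmoothSet.IsCartesian g' f' f g) : ν ⟨f, hX⟩ = ν ⟨f', hX'⟩

/-- The Frobenius lift is built with δ = −ν, so the image of X^p + p δ in Θ is [f]^p − p ν(f) = [f]
and the lift induces the identity. The compatibilities of ν with the relations say that δ preserves
the ideal of relations. -/
theorem IsDeltaOperation.torsionFree_and_pow_sub_self {p : ℕ} [hp : Fact p.Prime]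
    {ν : ThetaSymbol G E → Theta G E} (hν : IsDeltaOperation p ν) :
    (∀ x : Theta G E, p * x = 0 → x = 0) ∧ ∀ x : Theta G E, ∃ w, x ^ p - x = p * w := by
  choose d hd using fun s => Theta.mk_surjective (- ν s)
  have hX := MvPolynomial.frobeniusLift_X (p := p) d
  refine MvPolynomial.torsionFree_and_pow_sub_self d (Theta.mk G E) Theta.mk_surjective
    (fun _ => Theta.mk_eq_zero_iff) ?_ ?_
  · intro a ha
    have ha' := Ideal.subset_span ha
    have mem : ∀ x : MvPolynomial (ThetaSymbol G E) ℤ, Theta.mk G E x = 0 →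
      x ∈ Ideal.span {q | ThetaRel G E q} := fun x hx => Theta.mk_eq_zero_iff.1 hx
    cases ha with
    | iso hX' f hf =>
      refine exists_mem_sub_of_frobeniusLift _ ha' (hX _) (zb := 0) (by simp) (mem _ ?_)
      rw [map_sub, hd, hν.iso hX' f hf]
      simp
    | add hX' f i₁ i₂ h₁ h₂ h =>
      refine exists_mem_sub_of_frobeniusLift _ ha' (hX _)
        (zb := d ⟨f.comp i₁, hX'⟩ + d ⟨f.comp i₂, hX'⟩ -
          necklaceSum p (MvPolynomial.X ⟨f.comp i₁, hX'⟩) (MvPolynomial.X ⟨f.comp i₂, hX'⟩))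
        ?_ (mem _ ?_)
      · rw [map_add, hX, hX]
        linear_combination natCast_mul_necklaceSum (p := p)
          (MvPolynomial.X ⟨f.comp i₁, hX'⟩ : MvPolynomial (ThetaSymbol G E) ℤ)
          (MvPolynomial.X ⟨f.comp i₂, hX'⟩)
      · have := hν.add hX' f i₁ i₂ h₁ h₂ h
        simp only [map_sub, map_add, hd, map_necklaceSum, Theta.mk_X]
        rw [this]
        simp only [ThetaSymbol.cls]
        ring
    | comp hZ hY hX' g f =>
      refine exists_mem_sub_of_frobeniusLift _ ha' (hX _)
        -- This is the product rule δ(xy) = x^p δ(y) + δ(x) y^p + p δ(x) δ(y).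
        (zb := MvPolynomial.X ⟨f, hX'⟩ ^ p * d ⟨g, hY⟩ + d ⟨f, hX'⟩ * MvPolynomial.X ⟨g, hY⟩ ^ p +
          (p : MvPolynomial (ThetaSymbol G E) ℤ) * d ⟨f, hX'⟩ * d ⟨g, hY⟩) ?_ (mem _ ?_)
      · rw [map_mul, hX, hX]
        ring
      · have h1 := hν.comp hZ hY hX' g f
        have h2 := hν.pow ⟨f, hX'⟩
        simp only [map_sub, map_add, map_mul, map_pow, map_natCast, hd, Theta.mk_X]
        rw [h1]
        simp only [ThetaSymbol.cls] at h2 ⊢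
        linear_combination (ν ⟨g, hY⟩) * h2
    | baseChange hX' hX'' g' f' f g h =>
      refine exists_mem_sub_of_frobeniusLift _ ha' (hX _) (hX _) (mem _ ?_)
      rw [map_sub, hd, hd, hν.baseChange hX' hX'' g' f' f g h, sub_self]
  · intro i
    rw [hd, Theta.mk_X, hν.pow]
    ring

end ThetaOperation

/-! ### Sums over the orbits of a subgroup -/

section OrbitSum

variable {G : Type*} [Group G] {Y : Type*} [MulAction G Y] {Z : Type*} [MulAction G Z]

/-- Two points are equivalent if they are in the same orbit of the subgroup `U`. -/
def orbSetoid (U : Subgroup G) (Y : Type*) [MulAction G Y] : Setoid Y where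
  r y z := ∃ u ∈ U, u • y = z
  iseqv :=
    { refl := fun y => ⟨1, U.one_mem, one_smul _ _⟩
      symm := by
        rintro y _ ⟨u, hu, rfl⟩
        exact ⟨u⁻¹, U.inv_mem hu, inv_smul_smul _ _⟩
      trans := by
        rintro y _ _ ⟨u, hu, rfl⟩ ⟨v, hv, rfl⟩
        exact ⟨v * u, U.mul_mem hv hu, mul_smul _ _ _⟩ }

/-- The set of orbits of a subgroup `U` of `G` on a `G`-set. -/
def Orb (U : Subgroup G) (Y : Type*) [MulAction G Y] : Type _ := Quotient (orbSetoid U Y)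

/-- The orbit of a point. -/
def Orb.mk (U : Subgroup G) (y : Y) : Orb U Y := Quotient.mk (orbSetoid U Y) y

/-- A point in an orbit. -/
noncomputable def Orb.out {U : Subgroup G} (o : Orb U Y) : Y := Quotient.out o

theorem Orb.mk_out {U : Subgroup G} (o : Orb U Y) : Orb.mk U o.out = o := Quotient.out_eq _

theorem Orb.mk_eq_mk {U : Subgroup G} {y z : Y} :
    Orb.mk U y = Orb.mk U z ↔ ∃ u ∈ U, u • y = z := Quotient.eq

theorem Orb.mk_smul {U : Subgroup G} {u : G} (hu : u ∈ U) (y : Y) :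
    Orb.mk U (u • y) = Orb.mk U y := (Orb.mk_eq_mk.2 ⟨u, hu, rfl⟩).symm

theorem Orb.mk_surjective (U : Subgroup G) : Function.Surjective (Orb.mk U : Y → Orb U Y) :=
  Quotient.mk_surjective

theorem Orb.exists_smul_out (U : Subgroup G) (y : Y) : ∃ u ∈ U, u • (Orb.mk U y).out = y :=
  Orb.mk_eq_mk.1 (Orb.mk_out _)

/-- A set stable under the subgroup `U`. -/
def IsStable (U : Subgroup G) (F : Set Y) : Prop := ∀ u ∈ U, ∀ y ∈ F, u • y ∈ F

theorem IsStable.mono {U V : Subgroup G} (h : V ≤ U) {F : Set Y} (hF : IsStable U F) :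
    IsStable V F := fun u hu => hF u (h hu)

theorem IsStable.smul_mem_iff {U : Subgroup G} {F : Set Y} (hF : IsStable U F) {u : G} (hu : u ∈ U)
    {y : Y} : u • y ∈ F ↔ y ∈ F :=
  ⟨fun h => by simpa using hF u⁻¹ (U.inv_mem hu) _ h, hF u hu y⟩

theorem IsStable.out_mem_iff {U : Subgroup G} {F : Set Y} (hF : IsStable U F) {y : Y} :
    (Orb.mk U y).out ∈ F ↔ y ∈ F := by
  obtain ⟨u, hu, h⟩ := Orb.exists_smul_out U y
  rw [← hF.smul_mem_iff hu, h]

variable {A : Type*} [AddCommMonoid A]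

/-- The sum over the orbits in `F` of a function that is constant on orbits. -/
noncomputable def orbSum (U : Subgroup G) (F : Set Y) (w : Y → A) : A :=
  ∑ᶠ o ∈ {o : Orb U Y | o.out ∈ F}, w o.out

/-- The function `w` is constant on the `U`-orbits in `F`. -/
def IsInvariantOn (U : Subgroup G) (F : Set Y) {A : Type*} (w : Y → A) : Prop :=
  ∀ u ∈ U, ∀ y ∈ F, w (u • y) = w y

theorem IsInvariantOn.out_eq {U : Subgroup G} {F : Set Y} {B : Type*} {w : Y → B}
    (hF : IsStable U F) (hw : IsInvariantOn U F w) {y : Y} (hy : y ∈ F) :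
    w (Orb.mk U y).out = w y := by
  obtain ⟨u, hu, h⟩ := Orb.exists_smul_out U y
  conv_rhs => rw [← h]
  exact (hw u hu _ (hF.out_mem_iff.2 hy)).symm

theorem orbSum_congr {U : Subgroup G} {F : Set Y} {w w' : Y → A} (h : ∀ y ∈ F, w y = w' y) :
    orbSum U F w = orbSum U F w' :=
  finsum_mem_congr rfl fun _ ho => h _ ho

theorem orbSum_empty (U : Subgroup G) (w : Y → A) : orbSum U (∅ : Set Y) w = 0 := by
  simp [orbSum]

theorem orbSum_eq_of_forall_exists {U : Subgroup G} {F : Set Y} (hF : IsStable U F) {w : Y → A}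
    (hw : IsInvariantOn U F w) {y : Y} (hy : y ∈ F) (h : ∀ z ∈ F, ∃ u ∈ U, u • y = z) :
    orbSum U F w = w y := by
  have : {o : Orb U Y | o.out ∈ F} = {Orb.mk U y} := by
    ext o
    simp only [Set.mem_ofPred_eq, Set.mem_singleton_iff]
    constructor
    · intro ho
      rw [← Orb.mk_out o, eq_comm, Orb.mk_eq_mk]
      exact h _ ho
    · rintro rfl
      exact hF.out_mem_iff.2 hy
  rw [orbSum, this, finsum_mem_singleton, hw.out_eq hF hy]

/-- A bijection between the orbits of two subgroups gives an equality of orbit sums. -/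
theorem orbSum_eq_of_bijOn {U V : Subgroup G} {F : Set Y} {F' : Set Z} (hF : IsStable U F)
    (hF' : IsStable V F') {w : Y → A} {w' : Z → A} (hw' : IsInvariantOn V F' w') (e : Y → Z)
    (hmaps : ∀ y ∈ F, e y ∈ F') (heq : ∀ y ∈ F, w y = w' (e y))
    (hinj : ∀ y ∈ F, ∀ z ∈ F, Orb.mk V (e y) = Orb.mk V (e z) → Orb.mk U y = Orb.mk U z)
    (hsurj : ∀ z ∈ F', ∃ y ∈ F, Orb.mk V (e y) = Orb.mk V z)
    (hcomp : ∀ u ∈ U, ∀ y ∈ F, Orb.mk V (e (u • y)) = Orb.mk V (e y)) :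
    orbSum U F w = orbSum V F' w' := by
  refine finsum_mem_eq_of_bijOn (fun o => Orb.mk V (e o.out)) ⟨?_, ?_, ?_⟩ ?_
  · intro o ho
    exact hF'.out_mem_iff.2 (hmaps _ ho)
  · intro o ho o' ho' h
    have := hinj _ ho _ ho' h
    rwa [Orb.mk_out, Orb.mk_out] at this
  · intro o ho
    obtain ⟨y, hy, h⟩ := hsurj _ ho
    refine ⟨Orb.mk U y, hF.out_mem_iff.2 hy, ?_⟩
    rw [Orb.mk_out] at h
    obtain ⟨u, hu, h'⟩ := Orb.exists_smul_out U y
    rw [← h]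
    conv_rhs => rw [← h']
    exact (hcomp u hu _ (hF.out_mem_iff.2 hy)).symm
  · intro o ho
    rw [heq _ ho]
    exact (hw'.out_eq hF' (hmaps _ ho)).symm

/-- Decomposition of an orbit sum along the values of an invariant function. -/
theorem orbSum_fiberwise {U : Subgroup G} [Finite (Orb U Y)] {I : Type*} [Finite I] {F : Set Y}
    (κ : Y → I) (w : Y → A) :
    orbSum U F w = ∑ᶠ i, orbSum U (F ∩ κ ⁻¹' {i}) w := by
  classical
  have : {o : Orb U Y | o.out ∈ F} = ⋃ i, {o : Orb U Y | o.out ∈ F ∩ κ ⁻¹' {i}} := by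
    ext o
    simp
  rw [orbSum, this, finsum_mem_iUnion]
  · rfl
  · intro i j hij
    rw [Function.onFun, Set.disjoint_left]
    rintro o ⟨-, h1⟩ ⟨-, h2⟩
    exact hij (h1.symm.trans h2)
  · exact fun i => Set.toFinite _

theorem orbSum_union {U : Subgroup G} [Finite (Orb U Y)] {F F' : Set Y} (h : Disjoint F F')
    (w : Y → A) : orbSum U (F ∪ F') w = orbSum U F w + orbSum U F' w := by
  have : {o : Orb U Y | o.out ∈ F ∪ F'} = {o | o.out ∈ F} ∪ {o | o.out ∈ F'} := rfl
  rw [orbSum, this, finsum_mem_union _ (Set.toFinite _) (Set.toFinite _)]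
  · rfl
  · rw [Set.disjoint_left]
    exact fun o h1 h2 => Set.disjoint_left.1 h h1 h2

/-- Decomposition of an orbit sum along an equivariant map. -/
theorem orbSum_eq_finsum_stabilizer {U : Subgroup G} [Finite (Orb U Y)] [Finite (Orb U Z)]
    {F : Set Y} (hF : IsStable U F) {w : Y → A} (hw : IsInvariantOn U F w) (φ : Y → Z)
    (hφ : ∀ u ∈ U, ∀ y ∈ F, φ (u • y) = u • φ y) :
    orbSum U F w = ∑ᶠ o : Orb U Z,
      orbSum (U ⊓ MulAction.stabilizer G o.out) (F ∩ φ ⁻¹' {o.out}) w := by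
  rw [orbSum_fiberwise (fun y => Orb.mk U (φ y)) w]
  refine finsum_congr fun o => ?_
  have st : IsStable U (F ∩ (fun y => Orb.mk U (φ y)) ⁻¹' {o}) := by
    rintro u hu y ⟨hy, h⟩
    refine ⟨hF u hu y hy, ?_⟩
    simp only [Set.mem_preimage, Set.mem_singleton_iff] at h ⊢
    rw [hφ u hu y hy, Orb.mk_smul hu, h]
  refine (orbSum_eq_of_bijOn ?_ st ?_ id ?_ (fun _ _ => rfl) ?_ ?_ ?_).symm
  · rintro u ⟨hu, hu'⟩ y ⟨hy, h⟩
    refine ⟨hF u hu y hy, ?_⟩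
    simp only [Set.mem_preimage, Set.mem_singleton_iff] at h ⊢
    rw [hφ u hu y hy, h]
    exact hu'
  · exact fun u hu y hy => hw u hu y hy.1
  · rintro y ⟨hy, h⟩
    refine ⟨hy, ?_⟩
    simp only [Set.mem_preimage, Set.mem_singleton_iff] at h ⊢
    rw [id, h, Orb.mk_out]
  · rintro y ⟨hy, h⟩ z ⟨hz, h'⟩ he
    obtain ⟨u, hu, rfl⟩ := Orb.mk_eq_mk.1 he
    refine Orb.mk_eq_mk.2 ⟨u, ⟨hu, ?_⟩, rfl⟩
    simp only [Set.mem_preimage, Set.mem_singleton_iff, id] at h h'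
    rw [hφ u hu y hy, h] at h'
    exact h'
  · rintro z ⟨hz, h⟩
    simp only [Set.mem_preimage, Set.mem_singleton_iff] at h
    rw [← Orb.mk_out o, Orb.mk_eq_mk] at h
    obtain ⟨u, hu, h⟩ := h
    refine ⟨u • z, ⟨hF u hu z hz, ?_⟩, Orb.mk_smul hu z⟩
    simp only [Set.mem_preimage, Set.mem_singleton_iff]
    rw [hφ u hu z hz, h]
  · exact fun u hu y _ => Orb.mk_smul hu.1 y

end OrbitSum

/-! ### Classes of stabilizers and smooth actions -/

section StabilizerClass

variable {G : Type u} [Group G]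

/-- The conjugate of a subgroup. -/
def Subgroup.conjBy (g : G) (U : Subgroup G) : Subgroup G := U.map (MulAut.conj g).toMonoidHom

theorem Subgroup.mem_conjBy {g h : G} {U : Subgroup G} : h ∈ U.conjBy g ↔ g⁻¹ * h * g ∈ U := by
  rw [Subgroup.conjBy, Subgroup.mem_map]
  constructor
  · rintro ⟨u, hu, rfl⟩
    simpa [mul_assoc] using hu
  · intro h'
    exact ⟨_, h', by simp [mul_assoc]⟩

theorem Subgroup.stabilizer_smul {Y : Type*} [MulAction G Y] (g : G) (y : Y) :
    MulAction.stabilizer G (g • y) = (MulAction.stabilizer G y).conjBy g :=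
  MulAction.stabilizer_smul_eq_stabilizer_map_conj g y

theorem Subgroup.conjBy_inf (g : G) (U V : Subgroup G) :
    (U ⊓ V).conjBy g = U.conjBy g ⊓ V.conjBy g := by
  ext h
  simp only [Subgroup.mem_inf, Subgroup.mem_conjBy]

theorem Subgroup.conjBy_of_mem {g : G} {U : Subgroup G} (hg : g ∈ U) : U.conjBy g = U := by
  ext h
  rw [Subgroup.mem_conjBy, Subgroup.mul_mem_cancel_right _ hg,
    Subgroup.mul_mem_cancel_left _ (U.inv_mem hg)]

/-- A class of subgroups that is closed under finite intersections and conjugation, and any two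
members of which have finitely many double cosets. -/
class IsStabilizerClass (E : Set (Subgroup G)) : Prop where
  top_mem : ⊤ ∈ E
  inf_mem {U V : Subgroup G} : U ∈ E → V ∈ E → U ⊓ V ∈ E
  conjBy_mem {U : Subgroup G} (g : G) : U ∈ E → U.conjBy g ∈ E
  finite_orb {U V : Subgroup G} : U ∈ E → V ∈ E → Finite (Orb U (G ⧸ V))

/-- An action with finitely many orbits and with stabilizers in `E`. -/
class IsSmoothAction (E : Set (Subgroup G)) (Y : Type*) [MulAction G Y] : Prop where
  finite_orb_top : Finite (Orb (⊤ : Subgroup G) Y)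
  stabilizer_mem (y : Y) : MulAction.stabilizer G y ∈ E

open IsStabilizerClass IsSmoothAction

variable {E : Set (Subgroup G)} {Y : Type*} [MulAction G Y] {Z : Type*} [MulAction G Z]

theorem finite_orb_top_iff :
    Finite (Orb (⊤ : Subgroup G) Y) ↔ Finite (MulAction.orbitRel.Quotient G Y) := by
  refine (Quotient.congr (Equiv.refl Y) fun y z => ?_).finite_iff
  change (∃ u ∈ (⊤ : Subgroup G), u • y = z) ↔ y ∈ MulAction.orbit G z
  simp only [Subgroup.mem_top, true_and, MulAction.mem_orbit_iff]
  constructor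
  · rintro ⟨g, rfl⟩; exact ⟨g⁻¹, by simp⟩
  · rintro ⟨g, rfl⟩; exact ⟨g⁻¹, by simp⟩

instance (X : SmoothSet G E) : IsSmoothAction E X :=
  ⟨finite_orb_top_iff.2 X.finitary, X.smooth⟩

theorem inf_stabilizer_mem [IsStabilizerClass E] [IsSmoothAction E Y] {U : Subgroup G} (hU : U ∈ E)
    (y : Y) : U ⊓ MulAction.stabilizer G y ∈ E := inf_mem hU (stabilizer_mem y)

/-- A smooth set is a finite union of homogeneous spaces G/V, and the U-orbits on G/V are double
cosets, finite in number by hypothesis on the class. -/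
theorem IsSmoothAction.finite_orb [IsStabilizerClass E] [IsSmoothAction E Y] {U : Subgroup G}
    (hU : U ∈ E) : Finite (Orb U Y) := by
  have := finite_orb_top (E := E) (Y := Y)
  have (o : Orb (⊤ : Subgroup G) Y) : Finite (Orb U (G ⧸ MulAction.stabilizer G o.out)) :=
    IsStabilizerClass.finite_orb hU (stabilizer_mem _)
  refine Finite.of_surjective
    (fun x : Σ o : Orb (⊤ : Subgroup G) Y, Orb U (G ⧸ MulAction.stabilizer G o.out) =>
      Orb.mk U (MulAction.ofQuotientStabilizer G x.1.out x.2.out)) fun o => ?_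
  obtain ⟨y, rfl⟩ := Orb.mk_surjective U o
  obtain ⟨g, -, hg⟩ := Orb.exists_smul_out (⊤ : Subgroup G) y
  refine ⟨⟨Orb.mk ⊤ y, Orb.mk U (g : G ⧸ MulAction.stabilizer G (Orb.mk ⊤ y).out)⟩, ?_⟩
  obtain ⟨u, hu, h⟩ :=
    Orb.exists_smul_out U (g : G ⧸ MulAction.stabilizer G (Orb.mk (⊤ : Subgroup G) y).out)
  refine Orb.mk_eq_mk.2 ⟨u, hu, ?_⟩
  rw [← MulAction.ofQuotientStabilizer_smul, h, MulAction.ofQuotientStabilizer_mk, hg]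

instance [IsStabilizerClass E] [IsSmoothAction E Y] [IsSmoothAction E Z] :
    IsSmoothAction E (Y × Z) where
  finite_orb_top := by
    have := finite_orb_top (E := E) (Y := Y)
    have (o : Orb (⊤ : Subgroup G) Y) : Finite (Orb (MulAction.stabilizer G o.out) Z) :=
      IsSmoothAction.finite_orb (E := E) (stabilizer_mem _)
    refine Finite.of_surjective
      -- Every orbit on the product meets the fibre over a chosen representative y of an orbit on Y,
      -- where it comes from an orbit of the stabilizer of y on Z.
      (fun x : Σ o : Orb (⊤ : Subgroup G) Y, Orb (MulAction.stabilizer G o.out) Z =>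
        Orb.mk ⊤ (x.1.out, x.2.out)) fun o => ?_
    obtain ⟨⟨y, z⟩, rfl⟩ := Orb.mk_surjective _ o
    obtain ⟨g, -, hg⟩ := Orb.exists_smul_out (⊤ : Subgroup G) y
    refine ⟨⟨Orb.mk ⊤ y, Orb.mk _ (g⁻¹ • z)⟩, ?_⟩
    obtain ⟨u, hu, h⟩ :=
      Orb.exists_smul_out (MulAction.stabilizer G (Orb.mk (⊤ : Subgroup G) y).out) (g⁻¹ • z)
    refine Orb.mk_eq_mk.2 ⟨g * u, trivial, ?_⟩
    rw [Prod.smul_mk, mul_smul, mul_smul, h, smul_inv_smul]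
    rw [MulAction.mem_stabilizer_iff] at hu
    rw [hu, hg]
  stabilizer_mem := by
    rintro ⟨y, z⟩
    have : MulAction.stabilizer G (y, z) = MulAction.stabilizer G y ⊓ MulAction.stabilizer G z := by
      ext g
      simp [MulAction.mem_stabilizer_iff]
    rw [this]
    exact inf_mem (stabilizer_mem y) (stabilizer_mem z)

theorem IsSmoothAction.of_injective [IsSmoothAction E Z] (f : Y → Z)
    (hf : Function.Injective f) (hsmul : ∀ (g : G) y, f (g • y) = g • f y) : IsSmoothAction E Y where
  finite_orb_top := by
    have := finite_orb_top (E := E) (Y := Z)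
    refine Finite.of_injective (fun o : Orb (⊤ : Subgroup G) Y => Orb.mk (⊤ : Subgroup G) (f o.out)) fun o o' h => ?_
    obtain ⟨g, -, hg⟩ := Orb.mk_eq_mk.1 h
    rw [← hsmul] at hg
    rw [← Orb.mk_out o, ← Orb.mk_out o', Orb.mk_eq_mk]
    exact ⟨g, trivial, hf hg⟩
  stabilizer_mem y := by
    have : MulAction.stabilizer G y = MulAction.stabilizer G (f y) := by
      ext g
      rw [MulAction.mem_stabilizer_iff, MulAction.mem_stabilizer_iff, ← hsmul, hf.eq_iff]
    rw [this]
    exact stabilizer_mem _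

instance IsSmoothAction.pi [IsStabilizerClass E] [IsSmoothAction E Y] {ι : Type*} [Finite ι] :
    IsSmoothAction E (ι → Y) := by
  induction ι using Finite.induction_empty_option with
  | @of_equiv α β e h =>
    exact IsSmoothAction.of_injective (Z := α → Y) (fun y => y ∘ e)
      (fun y z h => e.surjective.injective_comp_right h) fun _ _ => rfl
  | h_empty =>
    refine ⟨inferInstanceAs (Finite (Quotient _)), fun y => ?_⟩
    have : MulAction.stabilizer G y = ⊤ := by
      ext g; simp [MulAction.mem_stabilizer_iff, eq_iff_true_of_subsingleton]
    rw [this]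
    exact top_mem
  | @h_option α _ h =>
    refine IsSmoothAction.of_injective (Z := Y × (α → Y)) (fun y => (y none, fun a => y (some a)))
      (fun y z h => ?_) fun _ _ => rfl
    rw [Prod.mk.injEq] at h
    funext a
    cases a with
    | none => exact h.1
    | some a => exact congrFun h.2 a

theorem isSmoothAction_quotient [IsStabilizerClass E] {V : Subgroup G} (hV : V ∈ E) :
    IsSmoothAction E (G ⧸ V) where
  finite_orb_top := IsStabilizerClass.finite_orb (E := E) top_mem hV
  stabilizer_mem := by
    intro q
    obtain ⟨g, rfl⟩ := QuotientGroup.mk_surjective q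
    have : (g : G ⧸ V) = g • ((1 : G) : G ⧸ V) := by
      rw [MulAction.Quotient.smul_coe, smul_eq_mul, mul_one]
    rw [this, Subgroup.stabilizer_smul, MulAction.stabilizer_quotient]
    exact conjBy_mem g hV

instance (N : SubMulAction G Y) [IsSmoothAction E Y] : IsSmoothAction E N :=
  IsSmoothAction.of_injective (Z := Y) Subtype.val Subtype.val_injective fun _ _ => rfl

/-- The bundled smooth set of a smooth action. -/
def SmoothSet.of (E : Set (Subgroup G)) (Y : Type u) [MulAction G Y] [IsSmoothAction E Y] :
    SmoothSet G E where
  carrier := Y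
  finitary := finite_orb_top_iff.1 (finite_orb_top (E := E))
  smooth := stabilizer_mem

theorem SmoothSet.of_isTransitive {Y : Type u} [MulAction G Y] [IsSmoothAction E Y] (y : Y)
    (h : ∀ z : Y, ∃ g : G, g • y = z) : (SmoothSet.of E Y).IsTransitive :=
  ⟨⟨y⟩, ⟨fun a b => by
    obtain ⟨g, rfl⟩ := h a
    obtain ⟨k, rfl⟩ := h b
    exact ⟨k * g⁻¹, by change (k * g⁻¹) • g • y = k • y; rw [mul_smul, inv_smul_smul]⟩⟩⟩

theorem SmoothSet.IsTransitive.exists_smul_eq {X : SmoothSet G E} (hX : X.IsTransitive) (x y : X) :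
    ∃ g : G, g • x = y := hX.2.exists_smul_eq x y

end StabilizerClass

/-! ### Classes of maps between homogeneous spaces -/

section RelClass

variable {G : Type u} [Group G] {E : Set (Subgroup G)} [IsStabilizerClass E]

open IsStabilizerClass IsSmoothAction

/-- The homogeneous space `G ⧸ V`. -/
def cosetSet {V : Subgroup G} (hV : V ∈ E) : SmoothSet G E :=
  have := isSmoothAction_quotient hV
  SmoothSet.of E (G ⧸ V)

theorem cosetSet_isTransitive {V : Subgroup G} (hV : V ∈ E) : (cosetSet hV).IsTransitive :=
  have := isSmoothAction_quotient hV
  SmoothSet.of_isTransitive ((1 : G) : G ⧸ V) fun z => by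
    obtain ⟨g, rfl⟩ := QuotientGroup.mk_surjective z
    exact ⟨g, by rw [MulAction.Quotient.smul_coe, smul_eq_mul, mul_one]⟩

/-- The projection `G ⧸ V → G ⧸ U`. -/
def cosetMap {U V : Subgroup G} (hU : U ∈ E) (hV : V ∈ E) (h : V ≤ U) :
    cosetSet hV →[G] cosetSet hU where
  toFun := Subgroup.quotientMapOfLE h
  map_smul' g q := by
    obtain ⟨x, rfl⟩ := QuotientGroup.mk_surjective q
    rfl

variable (E) in
open Classical in
/-- The class of `G ⧸ V → G ⧸ U` for `V ≤ U` in `E`. -/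
noncomputable def relClass (U V : Subgroup G) : Theta G E :=
  if h : U ∈ E ∧ V ∈ E ∧ V ≤ U then
    thetaClass (cosetMap h.1 h.2.1 h.2.2) (cosetSet_isTransitive h.1)
  else 0

theorem relClass_of_le {U V : Subgroup G} (hU : U ∈ E) (hV : V ∈ E) (h : V ≤ U) :
    relClass E U V = thetaClass (cosetMap hU hV h) (cosetSet_isTransitive hU) :=
  dif_pos ⟨hU, hV, h⟩

/-- The orbit map from a homogeneous space to a transitive set. -/
def cosetSetHom {X : SmoothSet G E} (x : X) :
    cosetSet (X.smooth x) →[G] X where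
  toFun := MulAction.ofQuotientStabilizer G x
  map_smul' g q := MulAction.ofQuotientStabilizer_smul G x g q

theorem cosetSetHom_bijective {X : SmoothSet G E} (hX : X.IsTransitive) (x : X) :
    Function.Bijective (cosetSetHom x) := by
  refine ⟨MulAction.injective_ofQuotientStabilizer G x, fun y => ?_⟩
  obtain ⟨g, rfl⟩ := hX.exists_smul_eq x y
  exact ⟨(g : G ⧸ MulAction.stabilizer G x), MulAction.ofQuotientStabilizer_mk G x g⟩

theorem MulActionHom.stabilizer_le {Y Z : Type*} [MulAction G Y] [MulAction G Z] (f : Y →[G] Z)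
    (y : Y) : MulAction.stabilizer G y ≤ MulAction.stabilizer G (f y) := by
  intro g hg
  rw [MulAction.mem_stabilizer_iff] at hg ⊢
  rw [← map_smul, hg]

/-- The class of a map of transitive sets depends only on the stabilizers of a point and its
image. -/
theorem thetaClass_eq_relClass {Y X : SmoothSet G E} (hY : Y.IsTransitive) (hX : X.IsTransitive)
    (f : Y →[G] X) (y : Y) :
    thetaClass f hX = relClass E (MulAction.stabilizer G (f y)) (MulAction.stabilizer G y) := by
  have hle := f.stabilizer_le y
  rw [relClass_of_le (X.smooth (f y)) (Y.smooth y) hle]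
  have h1 := thetaClass_comp (cosetSet_isTransitive (Y.smooth y)) hY hX (cosetSetHom y) f
  have h2 := thetaClass_comp (cosetSet_isTransitive (Y.smooth y))
    (cosetSet_isTransitive (X.smooth (f y))) hX (cosetMap (X.smooth (f y)) (Y.smooth y) hle)
    (cosetSetHom (f y))
  rw [thetaClass_iso _ _ (cosetSetHom_bijective hY y), mul_one] at h1
  rw [thetaClass_iso _ _ (cosetSetHom_bijective hX (f y)), one_mul] at h2
  rw [← h1, ← h2]
  congr 1
  ext q
  obtain ⟨g, rfl⟩ := QuotientGroup.mk_surjective q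
  exact map_smul f g y

theorem relClass_self {U : Subgroup G} (hU : U ∈ E) : relClass E U U = 1 := by
  rw [relClass_of_le hU hU le_rfl]
  refine thetaClass_iso _ _ ?_
  have : (cosetMap hU hU le_rfl : cosetSet hU → cosetSet hU) = id := by
    funext q
    obtain ⟨x, rfl⟩ := QuotientGroup.mk_surjective q
    rfl
  rw [this]
  exact Function.bijective_id

theorem relClass_mul {U V W : Subgroup G} (hU : U ∈ E) (hV : V ∈ E) (hW : W ∈ E) (h : V ≤ U)
    (h' : W ≤ V) : relClass E U V * relClass E V W = relClass E U W := by
  rw [relClass_of_le hU hV h, relClass_of_le hV hW h', relClass_of_le hU hW (h'.trans h),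
    ← thetaClass_comp (cosetSet_isTransitive hW)]
  congr 1
  ext q
  obtain ⟨x, rfl⟩ := QuotientGroup.mk_surjective q
  rfl

/-- The base point of a homogeneous space. -/
def cosetPoint {V : Subgroup G} (hV : V ∈ E) : cosetSet hV := ((1 : G) : G ⧸ V)

theorem stabilizer_cosetPoint {V : Subgroup G} (hV : V ∈ E) :
    MulAction.stabilizer G (cosetPoint hV) = V := MulAction.stabilizer_quotient V

/-- Both sides are the class of the same map G/V → G/U, read off at two different points of G/V. -/
theorem relClass_conjBy {U V : Subgroup G} (hU : U ∈ E) (hV : V ∈ E) (h : V ≤ U) (g : G) :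
    relClass E (U.conjBy g) (V.conjBy g) = relClass E U V := by
  have hpt : cosetMap hU hV h (cosetPoint hV) = cosetPoint hU := rfl
  rw [relClass_of_le hU hV h, thetaClass_eq_relClass (cosetSet_isTransitive hV)
    (cosetSet_isTransitive hU) _ (g • cosetPoint hV), map_smul,
    Subgroup.stabilizer_smul, Subgroup.stabilizer_smul, hpt, stabilizer_cosetPoint,
    stabilizer_cosetPoint]

end RelClass

/-! ### Classes of maps as sums over orbits in a fibre -/

section Decomposition

variable {G : Type u} [Group G] {E : Set (Subgroup G)}

open IsStabilizerClass IsSmoothAction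

/-- The restriction of a map of smooth sets to a stable subset. -/
def restrictHom {Y X : SmoothSet G E} (f : Y →[G] X) (N : SubMulAction G Y) :
    SmoothSet.of E N →[G] X where
  toFun y := f y.1
  map_smul' g y := map_smul f g y.1

theorem thetaClass_restrict_add {Y X : SmoothSet G E} (hX : X.IsTransitive) (f : Y →[G] X)
    {N N₁ N₂ : SubMulAction G Y} (hd : Disjoint (N₁ : Set Y) N₂)
    (hN : (N : Set Y) = (N₁ : Set Y) ∪ N₂) :
    thetaClass (restrictHom f N) hX =
      thetaClass (restrictHom f N₁) hX + thetaClass (restrictHom f N₂) hX := by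
  have h1 : ∀ y ∈ N₁, y ∈ N := fun y hy => by
    have : y ∈ (N : Set Y) := hN ▸ Or.inl hy
    exact this
  have h2 : ∀ y ∈ N₂, y ∈ N := fun y hy => by
    have : y ∈ (N : Set Y) := hN ▸ Or.inr hy
    exact this
  let i₁ : SmoothSet.of E N₁ →[G] SmoothSet.of E N :=
    ⟨fun y => (⟨y.1, h1 _ y.2⟩ : N), fun _ _ => rfl⟩
  let i₂ : SmoothSet.of E N₂ →[G] SmoothSet.of E N :=
    ⟨fun y => (⟨y.1, h2 _ y.2⟩ : N), fun _ _ => rfl⟩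
  refine thetaClass_add hX (restrictHom f N) i₁ i₂ ?_ ?_ ?_
  · intro y z h
    exact Subtype.ext (congrArg (fun x : N => x.1) h)
  · intro y z h
    exact Subtype.ext (congrArg (fun x : N => x.1) h)
  · constructor
    · rw [Set.disjoint_left]
      rintro _ ⟨y, rfl⟩ ⟨z, h⟩
      have h' : z.1 = y.1 := congrArg (fun x : N => x.1) h
      exact Set.disjoint_left.1 hd y.2 (h' ▸ z.2)
    · rw [codisjoint_iff]
      refine Set.eq_univ_of_forall fun y => ?_
      have : y.1 ∈ (N₁ : Set Y) ∪ N₂ := hN ▸ y.2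
      rcases this with h | h
      · exact Or.inl ⟨⟨y.1, h⟩, rfl⟩
      · exact Or.inr ⟨⟨y.1, h⟩, rfl⟩

theorem thetaClass_eq_add_restrict {Y X : SmoothSet G E} (hX : X.IsTransitive) (f : Y →[G] X)
    {N₁ N₂ : SubMulAction G Y} (h : IsCompl (N₁ : Set Y) N₂) :
    thetaClass f hX = thetaClass (restrictHom f N₁) hX + thetaClass (restrictHom f N₂) hX := by
  let i₁ : SmoothSet.of E N₁ →[G] Y := ⟨fun y => y.1, fun _ _ => rfl⟩
  let i₂ : SmoothSet.of E N₂ →[G] Y := ⟨fun y => y.1, fun _ _ => rfl⟩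
  refine thetaClass_add hX f i₁ i₂ (fun y z h => Subtype.ext h) (fun y z h => Subtype.ext h) ?_
  have e₁ : Set.range i₁ = (N₁ : Set Y) := Subtype.range_coe
  have e₂ : Set.range i₂ = (N₂ : Set Y) := Subtype.range_coe
  rwa [e₁, e₂]

variable [IsStabilizerClass E]

/-- A union of orbits. -/
def orbitUnion {Y : Type*} [MulAction G Y] (S : Set (Orb (⊤ : Subgroup G) Y)) :
    SubMulAction G Y where
  carrier := {y | Orb.mk ⊤ y ∈ S}
  smul_mem' g y hy := by
    change Orb.mk _ (g • y) ∈ S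
    rwa [Orb.mk_smul (Subgroup.mem_top g)]

/-- A class is the sum of the classes of the orbits. -/
theorem thetaClass_eq_orbSum_top {Y X : SmoothSet G E} (hX : X.IsTransitive) (f : Y →[G] X) :
    thetaClass f hX = orbSum (⊤ : Subgroup G) Set.univ
      (fun y => relClass E (MulAction.stabilizer G (f y)) (MulAction.stabilizer G y)) := by
  classical
  -- The empty set is the disjoint union of two copies of itself, so its class c satisfies c = c +
  -- c.
  have hempty : thetaClass (restrictHom f (orbitUnion ∅)) hX = 0 := by
    have := thetaClass_restrict_add hX f (N := orbitUnion ∅) (N₁ := orbitUnion ∅)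
      (N₂ := orbitUnion ∅) (by rw [Set.disjoint_left]; exact fun _ h => h.elim)
      (Set.union_self _).symm
    exact left_eq_add.1 this
  have hfin := finite_orb_top (E := E) (Y := Y)
  have := Fintype.ofFinite (Orb (⊤ : Subgroup G) Y)
  have key : ∀ s : Finset (Orb (⊤ : Subgroup G) Y),
      thetaClass (restrictHom f (orbitUnion s)) hX = ∑ o ∈ s,
        relClass E (MulAction.stabilizer G (f o.out)) (MulAction.stabilizer G o.out) := by
    intro s
    induction s using Finset.induction_on with
    | empty => rw [Finset.sum_empty, Finset.coe_empty, hempty]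
    | insert o s ho ih =>
      rw [Finset.sum_insert ho, ← ih, thetaClass_restrict_add hX f (N := orbitUnion ↑(insert o s))
        (N₁ := orbitUnion {o}) (N₂ := orbitUnion s)]
      · congr 1
        have ht : (SmoothSet.of E (orbitUnion {o})).IsTransitive := by
          refine SmoothSet.of_isTransitive (⟨o.out, Orb.mk_out o⟩ : orbitUnion {o}) fun z => ?_
          have hz : Orb.mk ⊤ z.1 = o := z.2
          obtain ⟨g, -, hg⟩ := Orb.mk_eq_mk.1 ((Orb.mk_out o).trans hz.symm)
          exact ⟨g, Subtype.ext hg⟩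
        rw [thetaClass_eq_relClass ht hX _ (⟨o.out, Orb.mk_out o⟩ : orbitUnion {o})]
        congr 1
        ext g
        exact Subtype.ext_iff
      · rw [Set.disjoint_left]
        rintro y h1 h2
        have h1' : Orb.mk ⊤ y = o := h1
        exact ho (h1' ▸ h2)
      · ext y
        change Orb.mk ⊤ y ∈ (↑(insert o s) : Set (Orb (⊤ : Subgroup G) Y)) ↔ _
        rw [Finset.coe_insert, Set.mem_insert_iff]
        rfl
  have hcompl : IsCompl (orbitUnion (G := G) (Y := Y) (Finset.univ : Finset (Orb (⊤ : Subgroup G) Y)) : Set Y)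
      (orbitUnion (G := G) (Y := Y) ∅) := by
    constructor
    · rw [Set.disjoint_left]
      exact fun _ _ h => h.elim
    · rw [codisjoint_iff]
      exact Set.eq_univ_of_forall fun y => Or.inl (Finset.mem_coe.2 (Finset.mem_univ _))
  rw [thetaClass_eq_add_restrict hX f hcompl, hempty, add_zero, key, orbSum]
  simp only [Set.mem_univ, Set.ofPred_true, finsum_true]
  rw [finsum_eq_sum_of_fintype]

variable {Y : Type*} [MulAction G Y] {Z : Type*} [MulAction G Z]

variable (E) in
/-- The measure of a `U`-stable subset of a smooth `G`-set. -/
noncomputable def mu (U : Subgroup G) (F : Set Y) : Theta G E :=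
  orbSum U F fun y => relClass E U (U ⊓ MulAction.stabilizer G y)

theorem isInvariantOn_relClass [IsSmoothAction E Y] {U : Subgroup G} (hU : U ∈ E) (F : Set Y) :
    IsInvariantOn U F fun y => relClass E U (U ⊓ MulAction.stabilizer G y) := by
  intro u hu y _
  have := relClass_conjBy hU (inf_stabilizer_mem hU y) inf_le_left u
  rw [Subgroup.conjBy_inf, Subgroup.conjBy_of_mem hu, ← Subgroup.stabilizer_smul] at this
  exact this

theorem isStable_univ (U : Subgroup G) : IsStable U (Set.univ : Set Y) := fun _ _ _ _ => trivial

theorem isStable_stabilizer_preimage (f : Y →[G] Z) (z : Z) :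
    IsStable (MulAction.stabilizer G z) (f ⁻¹' {z}) := by
  rintro u hu y hy
  rw [Set.mem_preimage, Set.mem_singleton_iff] at hy ⊢
  rw [map_smul, hy]
  exact hu

/-- Conjugation invariance of the measure. -/
theorem mu_conjBy [IsSmoothAction E Y] [IsSmoothAction E Z] {U : Subgroup G} (hU : U ∈ E) {F : Set Y}
    {F' : Set Z} (hF : IsStable U F) (g : G) (e : Y → Z) (he : Set.BijOn e F F')
    (hF' : IsStable (U.conjBy g) F')
    (hsmul : ∀ u ∈ U, ∀ y ∈ F, e (u • y) = (g * u * g⁻¹) • e y)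
    (hstab : ∀ y ∈ F, U.conjBy g ⊓ MulAction.stabilizer G (e y) =
      (U ⊓ MulAction.stabilizer G y).conjBy g) :
    mu E (U.conjBy g) F' = mu E U F := by
  have mem : ∀ {u}, u ∈ U → g * u * g⁻¹ ∈ U.conjBy g := fun {u} hu => by
    rw [Subgroup.mem_conjBy]; simpa [mul_assoc] using hu
  refine (orbSum_eq_of_bijOn hF hF' (isInvariantOn_relClass (conjBy_mem g hU) F') e he.mapsTo ?_ ?_
    ?_ ?_).symm
  · intro y hy
    rw [hstab y hy, relClass_conjBy hU (inf_stabilizer_mem hU y) inf_le_left]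
  · intro y hy z hz h
    obtain ⟨u, hu, h⟩ := Orb.mk_eq_mk.1 h
    rw [Subgroup.mem_conjBy] at hu
    refine Orb.mk_eq_mk.2 ⟨_, hu, he.injOn (hF _ hu y hy) hz ?_⟩
    rw [hsmul _ hu y hy, ← h]
    congr 1
    group
  · intro z hz
    obtain ⟨y, hy, rfl⟩ := he.surjOn hz
    exact ⟨y, hy, rfl⟩
  · intro u hu y hy
    rw [hsmul u hu y hy, Orb.mk_smul (mem hu)]

theorem mu_stabilizer_smul [IsSmoothAction E Y] {X : SmoothSet G E} (f : Y →[G] X) (g : G) (x : X) :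
    mu E (MulAction.stabilizer G (g • x)) (f ⁻¹' {g • x}) =
      mu E (MulAction.stabilizer G x) (f ⁻¹' {x}) := by
  have := isStable_stabilizer_preimage f (g • x)
  rw [Subgroup.stabilizer_smul] at this ⊢
  refine mu_conjBy (X.smooth x) (isStable_stabilizer_preimage f x) g (g • ·) ?_ this ?_ ?_
  · refine ⟨fun y hy => ?_, (MulAction.injective g).injOn, fun y hy => ⟨g⁻¹ • y, ?_, by simp⟩⟩
    · rw [Set.mem_preimage, Set.mem_singleton_iff] at hy ⊢
      rw [map_smul, hy]
    · rw [Set.mem_preimage, Set.mem_singleton_iff] at hy ⊢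
      rw [map_smul, hy, inv_smul_smul]
  · intro u _ y _
    simp [mul_smul]
  · intro y _
    rw [Subgroup.stabilizer_smul, Subgroup.conjBy_inf]

/-- The class of a map is the measure of a fibre. -/
theorem thetaClass_eq_mu {Y X : SmoothSet G E} (hX : X.IsTransitive) (f : Y →[G] X) (x : X) :
    thetaClass f hX = mu E (MulAction.stabilizer G x) (f ⁻¹' {x}) := by
  have h1 := finite_orb_top (E := E) (Y := Y)
  have h2 := finite_orb_top (E := E) (Y := X)
  rw [thetaClass_eq_orbSum_top, orbSum_eq_finsum_stabilizer (isStable_univ _) ?_ f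
    (fun u _ y _ => map_smul f u y)]
  · have huniq : ∀ o : Orb (⊤ : Subgroup G) X, o = Orb.mk ⊤ x := by
      intro o
      rw [← Orb.mk_out o, Orb.mk_eq_mk]
      obtain ⟨g, hg⟩ := hX.exists_smul_eq o.out x
      exact ⟨g, trivial, hg⟩
    rw [finsum_eq_single _ (Orb.mk ⊤ x) fun o ho => absurd (huniq o) ho]
    obtain ⟨g, -, hg⟩ := Orb.exists_smul_out (⊤ : Subgroup G) x
    rw [top_inf_eq, Set.univ_inter]
    conv_rhs => rw [← hg]
    rw [mu_stabilizer_smul f, mu]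
    refine orbSum_congr fun y hy => ?_
    rw [Set.mem_preimage, Set.mem_singleton_iff] at hy
    have hle := f.stabilizer_le y
    rw [hy] at hle ⊢
    rw [inf_eq_right.2 hle]
  · intro g _ y _
    simp only [map_smul, Subgroup.stabilizer_smul]
    exact relClass_conjBy (X.smooth _) (Y.smooth _) (f.stabilizer_le y) g

end Decomposition

/-! ### The measure: fibrations, restriction to subgroups, products -/

section Measure

variable {G : Type u} [Group G] {E : Set (Subgroup G)} [IsStabilizerClass E]
  {Y : Type*} [MulAction G Y] [IsSmoothAction E Y] {Z : Type*} [MulAction G Z] [IsSmoothAction E Z]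
  {U : Subgroup G}

open IsStabilizerClass IsSmoothAction

omit [IsSmoothAction E Y] in
theorem mu_empty : mu E U (∅ : Set Y) = 0 := orbSum_empty _ _

theorem mu_union (hU : U ∈ E) {F F' : Set Y} (h : Disjoint F F') :
    mu E U (F ∪ F') = mu E U F + mu E U F' :=
  have := finite_orb (Y := Y) hU
  orbSum_union h _

theorem mu_fiberwise (hU : U ∈ E) {I : Type*} [Finite I] (F : Set Y) (κ : Y → I) :
    mu E U F = ∑ᶠ i, mu E U (F ∩ κ ⁻¹' {i}) :=
  have := finite_orb (Y := Y) hU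
  orbSum_fiberwise κ _

/-- The measure of a single orbit. -/
theorem mu_eq_relClass (hU : U ∈ E) {F : Set Y} (hF : IsStable U F) {y : Y} (hy : y ∈ F)
    (h : ∀ z ∈ F, ∃ u ∈ U, u • y = z) : mu E U F = relClass E U (U ⊓ MulAction.stabilizer G y) :=
  orbSum_eq_of_forall_exists hF (isInvariantOn_relClass hU F) hy h

theorem mu_singleton (hU : U ∈ E) {y : Y} (h : U ≤ MulAction.stabilizer G y) :
    mu E U {y} = 1 := by
  rw [mu_eq_relClass hU ?_ (Set.mem_singleton y), inf_eq_left.2 h, relClass_self hU]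
  · rintro _ rfl
    exact ⟨1, U.one_mem, one_smul _ _⟩
  · rintro u hu _ rfl
    exact h hu

/-- The measure of the total space of a fibration in terms of the base and the fibres. -/
theorem mu_eq_finsum_fibration (hU : U ∈ E) {F : Set Y} (hF : IsStable U F) (φ : Y → Z)
    (hφ : ∀ u ∈ U, ∀ y ∈ F, φ (u • y) = u • φ y) :
    mu E U F = ∑ᶠ o : Orb U Z, relClass E U (U ⊓ MulAction.stabilizer G o.out) *
      mu E (U ⊓ MulAction.stabilizer G o.out) (F ∩ φ ⁻¹' {o.out}) := by
  have := finite_orb (Y := Y) hU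
  have := finite_orb (Y := Z) hU
  rw [mu, orbSum_eq_finsum_stabilizer hF (isInvariantOn_relClass hU F) φ hφ]
  refine finsum_congr fun o => ?_
  have hV := inf_stabilizer_mem hU o.out
  have hfin := finite_orb (Y := Y) hV
  rw [mu, orbSum, orbSum, mul_finsum_mem' _ _ (Set.toFinite _)]
  refine finsum_mem_congr rfl fun o' ho' => ?_
  obtain ⟨hy, h⟩ := ho'
  rw [Set.mem_preimage, Set.mem_singleton_iff] at h
  have hst : U ⊓ MulAction.stabilizer G o.out ⊓ MulAction.stabilizer G o'.out =
      U ⊓ MulAction.stabilizer G o'.out := by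
    refine le_antisymm (inf_le_inf_right _ inf_le_left) fun g hg => ⟨⟨hg.1, ?_⟩, hg.2⟩
    have h1 := hφ g hg.1 _ hy
    have h2 : g • o'.out = o'.out := hg.2
    rw [h2, h] at h1
    exact h1.symm
  rw [← relClass_mul hU hV (inf_stabilizer_mem hU _) inf_le_left (hst ▸ inf_le_left), hst]

/-- Over the orbit of z the class factors as (class of the orbit) times (measure of the fibre at z)
by multiplicativity of relative classes. With all fibres of measure c, the sum over the base is c
times its measure. -/
theorem mu_fibration (hU : U ∈ E) {F : Set Y} (hF : IsStable U F) {F' : Set Z}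
    (φ : Y → Z) (hmaps : Set.MapsTo φ F F')
    (hφ : ∀ u ∈ U, ∀ y ∈ F, φ (u • y) = u • φ y) (c : Theta G E)
    (hc : ∀ z ∈ F', mu E (U ⊓ MulAction.stabilizer G z) (F ∩ φ ⁻¹' {z}) = c) :
    mu E U F = c * mu E U F' := by
  have := finite_orb (Y := Z) hU
  rw [mu_eq_finsum_fibration hU hF φ hφ, mu, orbSum, mul_finsum_mem' _ _ (Set.toFinite _),
    ← finsum_mem_univ, ← Set.union_compl_self {o : Orb U Z | o.out ∈ F'},
    finsum_mem_union disjoint_compl_right (Set.toFinite _) (Set.toFinite _)]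
  have h0 : ∀ o ∈ {o : Orb U Z | o.out ∈ F'}ᶜ, relClass E U (U ⊓ MulAction.stabilizer G o.out) *
      mu E (U ⊓ MulAction.stabilizer G o.out) (F ∩ φ ⁻¹' {o.out}) = 0 := by
    intro o ho
    have : F ∩ φ ⁻¹' {o.out} = ∅ := by
      rw [Set.eq_empty_iff_forall_notMem]
      rintro y ⟨hy, h⟩
      rw [Set.mem_preimage, Set.mem_singleton_iff] at h
      have := hmaps hy
      rw [h] at this
      exact ho this
    rw [this, mu_empty, mul_zero]
  rw [finsum_mem_congr rfl h0, finsum_mem_zero, add_zero]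
  refine finsum_mem_congr rfl fun o ho => ?_
  rw [hc _ ho, mul_comm]

/-- A bijection is a fibration whose fibres are fixed points, of measure 1. -/
theorem mu_eq_of_bijOn (hU : U ∈ E) {F : Set Y} (hF : IsStable U F) {F' : Set Z}
    (φ : Y → Z) (hbij : Set.BijOn φ F F')
    (hφ : ∀ u ∈ U, ∀ y ∈ F, φ (u • y) = u • φ y) : mu E U F = mu E U F' := by
  rw [mu_fibration hU hF φ hbij.mapsTo hφ 1, one_mul]
  intro z hz
  obtain ⟨y, hy, rfl⟩ := hbij.surjOn hz
  have : F ∩ φ ⁻¹' {φ y} = {y} := by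
    ext y'
    simp only [Set.mem_inter_iff, Set.mem_preimage, Set.mem_singleton_iff]
    constructor
    · rintro ⟨h1, h2⟩
      exact hbij.injOn h1 hy h2
    · rintro rfl
      exact ⟨hy, rfl⟩
  rw [this]
  refine mu_singleton (inf_stabilizer_mem hU _) fun g hg => ?_
  refine hbij.injOn (hF g hg.1 y hy) hy ?_
  rw [hφ g hg.1 y hy]
  exact hg.2

/-- The orbit of a point under a subgroup. -/
def orbitOf (U : Subgroup G) (y : Y) : Set Y := {z | ∃ u ∈ U, u • y = z}

omit [IsStabilizerClass E] [IsSmoothAction E Y] in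
theorem isStable_orbitOf (U : Subgroup G) (y : Y) : IsStable U (orbitOf U y) := by
  rintro u hu _ ⟨v, hv, rfl⟩
  exact ⟨u * v, U.mul_mem hu hv, mul_smul _ _ _⟩

/-- Base change of a relative class to a smaller subgroup. -/
theorem relClass_eq_mu {U' V : Subgroup G} (hU : U ∈ E) (hU' : U' ∈ E) (hV : V ∈ E) (h : V ≤ U)
    (h' : U' ≤ U) : relClass E U V = mu E U' (orbitOf U ((1 : G) : G ⧸ V)) := by
  have s1 := isSmoothAction_quotient hV
  have s2 := isSmoothAction_quotient hU'
  -- The fibre product of G/V and G/U' over G/U; base change identifies the class with that of the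
  -- projection to G/U', whose fibre at the base point is the U-orbit of the base point in G/V.
  let N : SubMulAction G ((G ⧸ V) × (G ⧸ U')) :=
    { carrier := {x | Subgroup.quotientMapOfLE h x.1 = Subgroup.quotientMapOfLE h' x.2}
      smul_mem' := by
        rintro g ⟨a, b⟩ hab
        have e1 : Subgroup.quotientMapOfLE h (g • a) = g • Subgroup.quotientMapOfLE h a :=
          map_smul (cosetMap hU hV h) g a
        have e2 : Subgroup.quotientMapOfLE h' (g • b) = g • Subgroup.quotientMapOfLE h' b :=
          map_smul (cosetMap hU hU' h') g b
        change Subgroup.quotientMapOfLE h (g • a) = Subgroup.quotientMapOfLE h' (g • b)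
        rw [e1, e2]
        exact congrArg _ hab }
  let g' : SmoothSet.of E N →[G] cosetSet hV := ⟨fun x => x.1.1, fun _ _ => rfl⟩
  let f' : SmoothSet.of E N →[G] cosetSet hU' := ⟨fun x => x.1.2, fun _ _ => rfl⟩
  rw [relClass_of_le hU hV h, thetaClass_baseChange (cosetSet_isTransitive hU)
    (cosetSet_isTransitive hU') g' f' (cosetMap hU hV h) (cosetMap hU hU' h') ?_,
    thetaClass_eq_mu _ f' (cosetPoint hU')]
  · have hst := isStable_stabilizer_preimage f' (cosetPoint hU')
    rw [stabilizer_cosetPoint] at hst ⊢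
    refine mu_eq_of_bijOn hU' hst (fun x : N => x.1.1)
      ⟨?_, ?_, ?_⟩ fun _ _ _ _ => rfl
    · rintro ⟨⟨a, b⟩, hab⟩ hb
      have hb' : b = ((1 : G) : G ⧸ U') := hb
      subst hb'
      obtain ⟨x, rfl⟩ := QuotientGroup.mk_surjective a
      have : ((x : G) : G ⧸ U) = ((1 : G) : G ⧸ U) := hab
      rw [eq_comm, QuotientGroup.eq, inv_one, one_mul] at this
      exact ⟨x, this, by rw [MulAction.Quotient.smul_coe, smul_eq_mul, mul_one]⟩
    · rintro ⟨⟨a, b⟩, hab⟩ hb ⟨⟨a', b'⟩, hab'⟩ hb' h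
      have e1 : b = ((1 : G) : G ⧸ U') := hb
      have e2 : b' = ((1 : G) : G ⧸ U') := hb'
      have e3 : a = a' := h
      subst e1 e2 e3
      rfl
    · rintro _ ⟨u, hu, rfl⟩
      refine ⟨⟨(u • ((1 : G) : G ⧸ V), ((1 : G) : G ⧸ U')), ?_⟩, rfl, rfl⟩
      change ((u * 1 : G) : G ⧸ U) = ((1 : G) : G ⧸ U)
      rw [mul_one, eq_comm, QuotientGroup.eq, inv_one, one_mul]
      exact hu
  · refine ⟨fun y => y.2, fun y x' hyx => ⟨(⟨(y, x'), hyx⟩ : N), ⟨rfl, rfl⟩, ?_⟩⟩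
    rintro ⟨⟨a, b⟩, hab⟩ ⟨rfl, rfl⟩
    rfl

/-- The base change formula for relative classes, transported along the U-equivariant bijection
between the U-orbit of y and the U-orbit of the base point of the coset space. -/
theorem mu_orbitOf {U' : Subgroup G} (hU : U ∈ E) (hU' : U' ∈ E) (h' : U' ≤ U) (y : Y) :
    mu E U' (orbitOf U y) = relClass E U (U ⊓ MulAction.stabilizer G y) := by
  have hV := inf_stabilizer_mem hU y
  have s1 := isSmoothAction_quotient hV
  rw [relClass_eq_mu hU hU' hV inf_le_left h']
  let e : G ⧸ (U ⊓ MulAction.stabilizer G y) → Y := fun q =>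
    MulAction.ofQuotientStabilizer G y (Subgroup.quotientMapOfLE inf_le_right q)
  have he : ∀ g : G, e ((g : G) : G ⧸ (U ⊓ MulAction.stabilizer G y)) = g • y := fun g => rfl
  have he' : ∀ g : G, e (g • ((1 : G) : G ⧸ (U ⊓ MulAction.stabilizer G y))) = g • y := fun g => by
    rw [MulAction.Quotient.smul_coe, smul_eq_mul, mul_one, he]
  refine (mu_eq_of_bijOn hU' ((isStable_orbitOf U _).mono h') e
    ⟨?_, ?_, ?_⟩ ?_).symm
  · rintro _ ⟨u, hu, rfl⟩
    exact ⟨u, hu, (he' u).symm⟩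
  · rintro _ ⟨u, hu, rfl⟩ _ ⟨v, hv, rfl⟩ huv
    rw [he', he'] at huv
    rw [MulAction.Quotient.smul_coe, smul_eq_mul, mul_one, MulAction.Quotient.smul_coe, smul_eq_mul,
      mul_one, QuotientGroup.eq]
    refine Subgroup.mem_inf.2 ⟨U.mul_mem (U.inv_mem hu) hv, ?_⟩
    rw [MulAction.mem_stabilizer_iff, mul_smul, ← huv, inv_smul_smul]
  · rintro _ ⟨u, hu, rfl⟩
    exact ⟨_, ⟨u, hu, rfl⟩, he' u⟩
  · intro u _ q _
    obtain ⟨g, rfl⟩ := QuotientGroup.mk_surjective q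
    rw [MulAction.Quotient.smul_coe, smul_eq_mul, he, he, mul_smul]

/-- The measure of a stable set does not change under passage to a smaller subgroup. -/
theorem mu_of_le {U' : Subgroup G} (hU : U ∈ E) (hU' : U' ∈ E) (h' : U' ≤ U) {F : Set Y}
    (hF : IsStable U F) : mu E U' F = mu E U F := by
  have := finite_orb (Y := Y) hU
  -- F is cut into U-orbits, and `mu_orbitOf` evaluates the U'-measure of each of them.
  rw [mu_fiberwise hU' F (Orb.mk U), mu, orbSum, ← finsum_mem_univ,
    ← Set.union_compl_self {o : Orb U Y | o.out ∈ F},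
    finsum_mem_union disjoint_compl_right (Set.toFinite _) (Set.toFinite _)]
  have h0 : ∀ o ∈ {o : Orb U Y | o.out ∈ F}ᶜ, mu E U' (F ∩ Orb.mk U ⁻¹' {o}) = 0 := by
    intro o ho
    have : F ∩ Orb.mk U ⁻¹' {o} = ∅ := by
      rw [Set.eq_empty_iff_forall_notMem]
      rintro y ⟨hy, h⟩
      rw [Set.mem_preimage, Set.mem_singleton_iff] at h
      exact ho (h ▸ hF.out_mem_iff.2 hy)
    rw [this, mu_empty]
  rw [finsum_mem_congr rfl h0, finsum_mem_zero, add_zero]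
  refine finsum_mem_congr rfl fun o ho => ?_
  rw [← mu_orbitOf hU hU' h' o.out]
  congr 1
  ext y
  simp only [Set.mem_inter_iff, Set.mem_preimage, Set.mem_singleton_iff, orbitOf, Set.mem_ofPred_eq]
  constructor
  · rintro ⟨-, h⟩
    exact Orb.mk_eq_mk.1 ((Orb.mk_out o).trans h.symm)
  · rintro ⟨u, hu, rfl⟩
    exact ⟨hF u hu _ ho, by rw [Orb.mk_smul hu, Orb.mk_out]⟩

/-- The measure of a product. -/
theorem mu_pi (hU : U ∈ E) {ι : Type*} [Fintype ι] : ∀ F : ι → Set Y, (∀ i, IsStable U (F i)) →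
    mu E U {y : ι → Y | ∀ i, y i ∈ F i} = ∏ i, mu E U (F i) := by
  have st : ∀ {α : Type _} (F : α → Set Y), (∀ i, IsStable U (F i)) →
      IsStable U {y : α → Y | ∀ i, y i ∈ F i} := fun F hF u hu y hy i => hF i u hu _ (hy i)
  refine Fintype.induction_empty_option (P := fun ι _ => ∀ F : ι → Set Y, (∀ i, IsStable U (F i)) →
    mu E U {y : ι → Y | ∀ i, y i ∈ F i} = ∏ i, mu E U (F i)) ?_ ?_ ?_ ι
  · intro α β _ e h F hF
    let _ := Fintype.ofEquiv β e.symm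
    rw [← Fintype.prod_equiv e (fun i => mu E U (F (e i))) _ fun _ => rfl,
      ← h _ fun i => hF (e i)]
    refine mu_eq_of_bijOn hU (st _ hF) (fun y => y ∘ e) ⟨?_, ?_, ?_⟩
      fun _ _ _ _ => rfl
    · exact fun y hy i => hy (e i)
    · exact (e.surjective.injective_comp_right).injOn
    · exact fun y hy => ⟨y ∘ e.symm, fun i => by simpa using hy (e.symm i), by ext i; simp⟩
  · intro F hF
    rw [Finset.univ_eq_empty, Finset.prod_empty]
    have : {y : PEmpty → Y | ∀ i, y i ∈ F i} = {PEmpty.elim} := by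
      ext y
      simp [eq_iff_true_of_subsingleton]
    rw [this]
    exact mu_singleton hU fun g _ => Subsingleton.elim _ _
  · intro α _ h F hF
    rw [Fintype.prod_option, ← h _ fun i => hF (some i)]
    refine mu_fibration hU (st _ hF) (F' := {y : α → Y | ∀ i, y i ∈ F (some i)}) (fun y i => y (some i))
      (fun y hy i => hy (some i)) (fun _ _ _ _ => rfl) _ fun z hz => ?_
    have hV := inf_stabilizer_mem hU z
    -- The fibre over z is a copy of the remaining factor, whose measure is unchanged when U shrinks
    -- to the stabilizer of z in U.
    rw [← mu_of_le hU hV inf_le_left (hF none)]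
    refine mu_eq_of_bijOn hV ?_ (fun y => y none) ⟨?_, ?_, ?_⟩
      fun _ _ _ _ => rfl
    · rintro u ⟨hu, hu'⟩ y ⟨hy, h⟩
      refine ⟨st _ hF u hu y hy, ?_⟩
      rw [Set.mem_preimage, Set.mem_singleton_iff] at h ⊢
      conv_rhs => rw [← (hu' : u • z = z), ← h]
      rfl
    · exact fun y hy => hy.1 none
    · rintro y ⟨hy, h⟩ y' ⟨hy', h'⟩ he
      funext i
      cases i with
      | none => exact he
      | some i => exact congrFun (Eq.trans h (Eq.symm h')) i
    · intro a ha
      refine ⟨fun i => i.elim a z, ⟨fun i => ?_, rfl⟩, rfl⟩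
      cases i with
      | none => exact ha
      | some i => exact hz i

end Measure

/-! ### Smoothness of the set of necklaces -/

section NecklaceAction

variable {G : Type u} [Group G] {p : ℕ} {Y : Type*} [MulAction G Y] {Z : Type*} [MulAction G Z]

instance : MulAction G (Necklace p Y) where
  smul g := Necklace.map (g • ·)
  one_smul t := by
    obtain ⟨y, rfl⟩ := Necklace.mk_surjective t
    exact congrArg Necklace.mk (one_smul G y)
  mul_smul g h t := by
    obtain ⟨y, rfl⟩ := Necklace.mk_surjective t
    exact congrArg Necklace.mk (mul_smul g h y)

theorem Necklace.smul_mk (g : G) (y : ZMod p → Y) : g • Necklace.mk y = Necklace.mk (g • y) := rfl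

/-- Members of `E` contain every element normalizing them whose `p`-th power they contain. -/
class IsPrimeToIndex (E : Set (Subgroup G)) (p : ℕ) : Prop where
  mem_of_pow_mem {V : Subgroup G} (hV : V ∈ E) {g : G} (hg : V.conjBy g = V) (h : g ^ p ∈ V) : g ∈ V

variable {E : Set (Subgroup G)} [IsStabilizerClass E]

open IsStabilizerClass IsSmoothAction

theorem stabilizer_cyclicShift (c : ZMod p) (y : ZMod p → Y) :
    MulAction.stabilizer G (cyclicShift c y) = MulAction.stabilizer G y := by
  ext g
  rw [MulAction.mem_stabilizer_iff, MulAction.mem_stabilizer_iff]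
  constructor
  · intro h
    funext i
    have := congrFun h (i - c)
    simpa [cyclicShift] using this
  · intro h
    funext i
    exact congrFun h (i + c)

theorem pow_smul_eq_cyclicShift {g : G} {c : ZMod p} {y : ZMod p → Y} (h : g • y = cyclicShift c y)
    (n : ℕ) : g ^ n • y = cyclicShift ((n : ZMod p) * c) y := by
  induction n with
  | zero => simp [cyclicShift_zero]
  | succ n ih =>
    have : g • cyclicShift ((n : ZMod p) * c) y = cyclicShift ((n : ZMod p) * c) (g • y) := rfl
    rw [pow_succ', mul_smul, ih, this, h, cyclicShift_cyclicShift]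
    congr 1
    push_cast
    ring

variable [hp : Fact p.Prime] [IsPrimeToIndex E p]

/-- A rotated word has the same stabilizer, so g normalizes it; and g^p rotates by p c = 0, so g^p
lies in it. -/
theorem mem_stabilizer_of_smul_eq_cyclicShift [IsSmoothAction E Y] {g : G} {c : ZMod p}
    {y : ZMod p → Y} (h : g • y = cyclicShift c y) : g ∈ MulAction.stabilizer G y := by
  refine IsPrimeToIndex.mem_of_pow_mem (E := E) (p := p) (stabilizer_mem y) ?_ ?_
  · rw [← Subgroup.stabilizer_smul, h, stabilizer_cyclicShift]
  · rw [MulAction.mem_stabilizer_iff, pow_smul_eq_cyclicShift h, CharP.cast_eq_zero, zero_mul,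
      cyclicShift_zero]

variable (E) in
-- Passing to rotation classes creates no new stabilizers, so necklaces stay within the smooth sets.
-- This is the point at which the index condition is needed.
theorem stabilizer_necklace [IsSmoothAction E Y] (y : ZMod p → Y) :
    MulAction.stabilizer G (Necklace.mk y) = MulAction.stabilizer G y := by
  ext g
  constructor
  · intro h
    rw [MulAction.mem_stabilizer_iff, Necklace.smul_mk, eq_comm, Necklace.mk_eq_mk] at h
    obtain ⟨c, hc⟩ := h
    exact mem_stabilizer_of_smul_eq_cyclicShift (E := E) hc
  · intro h
    rw [MulAction.mem_stabilizer_iff] at h ⊢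
    rw [Necklace.smul_mk, h]

instance [IsSmoothAction E Y] : IsSmoothAction E (Necklace p Y) where
  finite_orb_top := by
    have := finite_orb_top (E := E) (Y := ZMod p → Y)
    refine Finite.of_surjective (fun o : Orb (⊤ : Subgroup G) (ZMod p → Y) =>
      Orb.mk (⊤ : Subgroup G) (Necklace.mk o.out)) fun o => ?_
    obtain ⟨t, rfl⟩ := Orb.mk_surjective _ o
    obtain ⟨y, rfl⟩ := Necklace.mk_surjective t
    obtain ⟨u, hu, h⟩ := Orb.exists_smul_out (⊤ : Subgroup G) y
    refine ⟨Orb.mk ⊤ y, Orb.mk_eq_mk.2 ⟨u, hu, ?_⟩⟩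
    rw [Necklace.smul_mk, h]
  stabilizer_mem t := by
    obtain ⟨y, rfl⟩ := Necklace.mk_surjective t
    rw [stabilizer_necklace E]
    exact stabilizer_mem y

end NecklaceAction

/-! ### The measure of nonconstant necklaces -/

section Nu

variable {G : Type u} [Group G] {p : ℕ} {Y : Type*} [MulAction G Y] {Z : Type*} [MulAction G Z]
  {U : Subgroup G}

/-- The necklaces with beads in `F` that are not constant. -/
def necklaces (p : ℕ) (F : Set Y) : Set (Necklace p Y) :=
  Necklace.mk '' {y | (∀ i, y i ∈ F) ∧ ¬ IsConstWord y}

theorem mk_mem_necklaces {F : Set Y} {y : ZMod p → Y} :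
    Necklace.mk y ∈ necklaces p F ↔ (∀ i, y i ∈ F) ∧ ¬ IsConstWord y := by
  constructor
  · rintro ⟨z, ⟨h1, h2⟩, h⟩
    obtain ⟨c, rfl⟩ := Necklace.mk_eq_mk.1 h
    exact ⟨fun i => h1 _, fun h => h2 (isConstWord_cyclicShift.1 h)⟩
  · exact fun h => ⟨y, h, rfl⟩

theorem isConstWord_smul {g : G} {y : ZMod p → Y} : IsConstWord (g • y) ↔ IsConstWord y :=
  forall_congr' fun _ => smul_left_cancel_iff g

theorem isStable_necklaces {F : Set Y} (hF : IsStable U F) : IsStable U (necklaces p F) := by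
  rintro u hu _ ⟨y, ⟨h1, h2⟩, rfl⟩
  exact ⟨u • y, ⟨fun i => hF u hu _ (h1 i), fun h => h2 (isConstWord_smul.1 h)⟩, rfl⟩

theorem isStable_words {ι : Type*} {F : ι → Set Y} (hF : ∀ i, IsStable U (F i)) :
    IsStable U {y : ι → Y | ∀ i, y i ∈ F i} := fun u hu _ hy i => hF i u hu _ (hy i)

variable {E : Set (Subgroup G)} [IsStabilizerClass E]

open IsStabilizerClass IsSmoothAction

variable (E) in
/-- The measure of the set of nonconstant necklaces with beads in `F`. -/
noncomputable def nu (p : ℕ) (U : Subgroup G) (F : Set Y) : Theta G E := mu E U (necklaces p F)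

theorem mu_eq_ncard [IsSmoothAction E Y] (hU : U ∈ E) {F : Set Y} (hfin : F.Finite)
    (h : ∀ y ∈ F, U ≤ MulAction.stabilizer G y) : mu E U F = F.ncard := by
  induction F, hfin using Set.Finite.induction_on with
  | empty => simp [mu_empty]
  | @insert y F hy hfin ih =>
    rw [Set.ncard_insert_of_notMem hy hfin, Set.insert_eq, mu_union hU (by simpa using hy),
      mu_singleton hU (h y (Set.mem_insert _ _)), ih fun z hz => h z (Set.mem_insert_of_mem _ hz)]
    push_cast
    ring

theorem nu_singleton [hp : Fact p.Prime] (y : Y) : nu E p U {y} = 0 := by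
  have : necklaces p ({y} : Set Y) = ∅ := by
    rw [Set.eq_empty_iff_forall_notMem]
    rintro _ ⟨z, ⟨h1, h2⟩, rfl⟩
    exact h2 fun i => (h1 i).trans (h1 0).symm
  rw [nu, this, mu_empty]

variable [hp : Fact p.Prime] [IsPrimeToIndex E p] [IsSmoothAction E Y] [IsSmoothAction E Z]

theorem mu_mk_image (hU : U ∈ E) {T : Set (ZMod p → Y)} (hT : IsStable U T)
    (hinj : Set.InjOn Necklace.mk T) : mu E U (Necklace.mk '' T) = mu E U T :=
  (mu_eq_of_bijOn hU hT Necklace.mk hinj.bijOn_image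
    fun u _ y _ => (Necklace.smul_mk u y).symm).symm

/-- The p-th power is the measure of all words in F. The constant words are a copy of F. The others
fibre over the necklaces, each fibre consisting of p rotations that are fixed by the stabilizer of
the necklace, hence of measure p. -/
theorem mu_pow_eq (hU : U ∈ E) {F : Set Y} (hF : IsStable U F) :
    mu E U F ^ p = mu E U F + p * nu E p U F := by
  have h1 := mu_pi hU (fun _ : ZMod p => F) fun _ => hF
  rw [Finset.prod_const, Finset.card_univ, ZMod.card] at h1
  have h2 : {y : ZMod p → Y | ∀ i, y i ∈ F} = {y | (∀ i, y i ∈ F) ∧ IsConstWord y} ∪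
      {y | (∀ i, y i ∈ F) ∧ ¬ IsConstWord y} := by
    ext y
    simp only [Set.mem_ofPred_eq, Set.mem_union]
    tauto
  have hst := isStable_words (U := U) (fun _ : ZMod p => hF)
  rw [← h1, h2, mu_union hU]
  · congr 1
    · refine mu_eq_of_bijOn hU ?_ (fun y => y 0) ⟨?_, ?_, ?_⟩ fun _ _ _ _ => rfl
      · exact fun u hu y hy => ⟨hst u hu y hy.1, isConstWord_smul.2 hy.2⟩
      · exact fun y hy => hy.1 0
      · intro y hy z hz h
        funext i
        rw [hy.2 i, hz.2 i]
        exact h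
      · exact fun a ha => ⟨fun _ => a, ⟨fun _ => ha, fun _ => rfl⟩, rfl⟩
    · refine mu_fibration hU ?_ Necklace.mk (Set.mapsTo_image _ _)
        (fun u _ y _ => (Necklace.smul_mk u y).symm) p ?_
      · exact fun u hu y hy => ⟨hst u hu y hy.1, fun h => hy.2 (isConstWord_smul.1 h)⟩
      · rintro _ ⟨y, ⟨hy, hy'⟩, rfl⟩
        have hfib : {y | (∀ i, y i ∈ F) ∧ ¬ IsConstWord y} ∩ Necklace.mk ⁻¹' {Necklace.mk y} =
            Set.range fun c : ZMod p => cyclicShift c y := by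
          ext z
          simp only [Set.mem_inter_iff, Set.mem_ofPred_eq, Set.mem_preimage,
            Set.mem_singleton_iff, Set.mem_range]
          constructor
          · rintro ⟨-, h⟩
            obtain ⟨c, hc⟩ := Necklace.mk_eq_mk.1 h.symm
            exact ⟨c, hc.symm⟩
          · rintro ⟨c, rfl⟩
            exact ⟨⟨fun i => hy _, fun h => hy' (isConstWord_cyclicShift.1 h)⟩,
              Necklace.mk_cyclicShift _ _⟩
        rw [hfib, mu_eq_ncard (inf_stabilizer_mem hU _) (Set.finite_range _)]
        · rw [← Set.image_univ, Set.ncard_image_of_injective _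
            (cyclicShift_injective_of_not_isConstWord hy'), Set.ncard_univ, Nat.card_zmod]
        · rintro _ ⟨c, rfl⟩
          rw [stabilizer_cyclicShift, stabilizer_necklace E]
          exact inf_le_right
  · rw [Set.disjoint_left]
    exact fun y h h' => h'.2 h.2

theorem nu_of_le {U' : Subgroup G} (hU : U ∈ E) (hU' : U' ∈ E) (h' : U' ≤ U) {F : Set Y}
    (hF : IsStable U F) : nu E p U' F = nu E p U F :=
  mu_of_le hU hU' h' (isStable_necklaces hF)

theorem nu_eq_of_bijOn (hU : U ∈ E) {F : Set Y} (hF : IsStable U F) {F' : Set Z}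
    (φ : Y → Z) (hbij : Set.BijOn φ F F')
    (hφ : ∀ u ∈ U, ∀ y ∈ F, φ (u • y) = u • φ y) : nu E p U F = nu E p U F' := by
  refine mu_eq_of_bijOn hU (isStable_necklaces hF) (Necklace.map φ) ⟨?_, ?_, ?_⟩ ?_
  · rintro _ ⟨y, ⟨h1, h2⟩, rfl⟩
    exact ⟨φ ∘ y, ⟨fun i => hbij.mapsTo (h1 i), fun h => h2 fun i =>
      hbij.injOn (h1 i) (h1 0) (h i)⟩, rfl⟩
  · rintro _ ⟨y, ⟨h1, h2⟩, rfl⟩ _ ⟨z, ⟨h3, h4⟩, rfl⟩ h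
    rw [Necklace.map_mk, Necklace.map_mk, Necklace.mk_eq_mk] at h
    obtain ⟨c, hc⟩ := h
    exact Necklace.mk_eq_mk.2 ⟨c, funext fun i => hbij.injOn (h3 i) (h1 _) (congrFun hc i)⟩
  · rintro _ ⟨z, ⟨h1, h2⟩, rfl⟩
    choose y hy hyz using fun i => hbij.surjOn (h1 i)
    refine ⟨Necklace.mk y, ⟨y, ⟨hy, fun h => h2 fun i => ?_⟩, rfl⟩, congrArg _ (funext hyz)⟩
    rw [← hyz i, ← hyz 0, h i]
  · rintro u hu _ ⟨y, ⟨h1, h2⟩, rfl⟩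
    exact congrArg Necklace.mk (funext fun i => hφ u hu _ (h1 i))

theorem nu_stabilizer_smul {X : SmoothSet G E} (f : Y →[G] X) (g : G) (x : X) :
    nu E p (MulAction.stabilizer G (g • x)) (f ⁻¹' {g • x}) =
      nu E p (MulAction.stabilizer G x) (f ⁻¹' {x}) := by
  have hst := isStable_necklaces (p := p) (isStable_stabilizer_preimage f (g • x))
  have hmem : ∀ (g : G) (x : X), ∀ t ∈ necklaces p (f ⁻¹' {x}), g • t ∈ necklaces p (f ⁻¹' {g • x}) := by
    rintro g x _ ⟨y, ⟨h1, h2⟩, rfl⟩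
    refine ⟨g • y, ⟨fun i => ?_, fun h => h2 (isConstWord_smul.1 h)⟩, rfl⟩
    have := h1 i
    rw [Set.mem_preimage, Set.mem_singleton_iff] at this ⊢
    rw [Pi.smul_apply, map_smul, this]
  rw [nu, nu]
  rw [Subgroup.stabilizer_smul] at hst ⊢
  refine mu_conjBy (X.smooth x) (isStable_necklaces (isStable_stabilizer_preimage f x)) g (g • ·)
    ⟨hmem g x, (MulAction.injective g).injOn, fun t ht => ⟨g⁻¹ • t, ?_, smul_inv_smul g t⟩⟩ hst ?_ ?_
  · have := hmem g⁻¹ _ t ht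
    rwa [inv_smul_smul] at this
  · intro u _ y _
    simp [mul_smul]
  · intro y _
    rw [Subgroup.stabilizer_smul, Subgroup.conjBy_inf]

/-- Colour each letter by the part containing it and sort necklaces by their colour pattern. The two
constant patterns give the necklaces in F₁ and in F₂. Over a nonconstant pattern a necklace has a
unique representative with the prescribed colouring, so these necklaces form a product of copies of
F₁ and F₂. -/
theorem nu_union (hU : U ∈ E) {F₁ F₂ : Set Y} (h₁ : IsStable U F₁) (h₂ : IsStable U F₂)
    (hd : Disjoint F₁ F₂) :
    nu E p U (F₁ ∪ F₂) = nu E p U F₁ + nu E p U F₂ + necklaceSum p (mu E U F₁) (mu E U F₂) := by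
  classical
  have := Fintype.ofFinite (Necklace p Bool)
  let χ : Y → Bool := fun y => decide (y ∈ F₁)
  let F : Bool → Set Y := fun b => bif b then F₁ else F₂
  have hFst : ∀ b, IsStable U (F b) := fun b => by cases b <;> assumption
  have hFχ : ∀ y b, y ∈ F₁ ∪ F₂ ∧ χ y = b ↔ y ∈ F b := by
    intro y b
    have : y ∈ F₁ → y ∉ F₂ := fun h => Set.disjoint_left.1 hd h
    cases b <;> simp [F, χ] <;> tauto
  have hfib : ∀ τ : ZMod p → Bool, ¬ IsConstWord τ →
      mu E U (necklaces p (F₁ ∪ F₂) ∩ Necklace.map χ ⁻¹' {Necklace.mk τ}) =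
        ∏ i, bif τ i then mu E U F₁ else mu E U F₂ := by
    intro τ hτ
    have e1 : necklaces p (F₁ ∪ F₂) ∩ Necklace.map χ ⁻¹' {Necklace.mk τ} =
        Necklace.mk '' {y : ZMod p → Y | ∀ i, y i ∈ F (τ i)} := by
      ext t
      constructor
      · rintro ⟨⟨y, ⟨h1, h2⟩, rfl⟩, h⟩
        rw [Set.mem_preimage, Set.mem_singleton_iff, Necklace.map_mk, Necklace.mk_eq_mk] at h
        obtain ⟨c, rfl⟩ := h
        refine ⟨cyclicShift c y, fun i => ?_, Necklace.mk_cyclicShift _ _⟩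
        exact (hFχ _ _).1 ⟨h1 _, rfl⟩
      · rintro ⟨y, hy, rfl⟩
        have hχ : χ ∘ y = τ := funext fun i => ((hFχ _ _).2 (hy i)).2
        refine ⟨⟨y, ⟨fun i => ((hFχ _ _).2 (hy i)).1, fun h => hτ fun i => ?_⟩, rfl⟩, ?_⟩
        · rw [← hχ, Function.comp_apply, Function.comp_apply, h i]
        · rw [Set.mem_preimage, Set.mem_singleton_iff, Necklace.map_mk, hχ]
    have e2 : Set.InjOn Necklace.mk {y : ZMod p → Y | ∀ i, y i ∈ F (τ i)} := by
      intro y hy z hz h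
      obtain ⟨c, rfl⟩ := Necklace.mk_eq_mk.1 h
      have hχy : χ ∘ y = τ := funext fun i => ((hFχ _ _).2 (hy i)).2
      have hχz : χ ∘ cyclicShift c y = τ := funext fun i => ((hFχ _ _).2 (hz i)).2
      rw [comp_cyclicShift, hχy] at hχz
      have hc : c = 0 := by
        by_contra hc
        exact hτ (isConstWord_of_cyclicShift_eq hc hχz)
      rw [hc, cyclicShift_zero]
    rw [e1, mu_mk_image hU (isStable_words fun i => hFst _) e2, mu_pi hU _ fun i => hFst _]
    exact Finset.prod_congr rfl fun i _ => by cases τ i <;> rfl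
  have hconst : ∀ b : Bool, necklaces p (F₁ ∪ F₂) ∩
      Necklace.map χ ⁻¹' {Necklace.mk fun _ : ZMod p => b} = necklaces p (F b) := by
    intro b
    ext t
    obtain ⟨y, rfl⟩ := Necklace.mk_surjective t
    rw [Set.mem_inter_iff, mk_mem_necklaces, mk_mem_necklaces, Set.mem_preimage,
      Set.mem_singleton_iff, Necklace.map_mk, eq_comm, Necklace.mk_eq_mk]
    constructor
    · rintro ⟨⟨h1, h2⟩, c, h⟩
      exact ⟨fun i => (hFχ _ _).1 ⟨h1 i, congrFun h i⟩, h2⟩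
    · rintro ⟨h1, h2⟩
      exact ⟨⟨fun i => ((hFχ _ _).2 (h1 i)).1, h2⟩, 0, funext fun i => ((hFχ _ _).2 (h1 i)).2⟩
  have hne : (Necklace.mk fun _ : ZMod p => true) ≠ Necklace.mk fun _ : ZMod p => false := by
    rw [Ne, Necklace.mk_eq_mk]
    rintro ⟨c, h⟩
    simpa [cyclicShift] using congrFun h 0
  have hterm : ∀ t : Necklace p Bool,
      mu E U (necklaces p (F₁ ∪ F₂) ∩ Necklace.map χ ⁻¹' {t}) =
      (if t = Necklace.mk fun _ : ZMod p => true then nu E p U F₁ else 0) +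
      (if t = Necklace.mk fun _ : ZMod p => false then nu E p U F₂ else 0) +
      (if IsConstWord t.out then 0 else
        ∏ i, bif t.out i then mu E U F₁ else mu E U F₂) := by
    intro t
    have hc : ∀ b : Bool, IsConstWord (Necklace.mk fun _ : ZMod p => b).out := by
      intro b
      obtain ⟨c, hc⟩ := Necklace.mk_eq_mk.1 (Necklace.mk_out (Necklace.mk fun _ : ZMod p => b)).symm
      rw [hc, isConstWord_cyclicShift]
      exact fun _ => rfl
    by_cases h : IsConstWord t.out
    · have ht : t = Necklace.mk fun _ => t.out 0 := by
        conv_lhs => rw [← Necklace.mk_out t]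
        exact congrArg _ (funext h)
      rw [if_pos h, add_zero]
      cases hb : t.out 0
      · rw [hb] at ht
        rw [ht, hconst, if_neg hne.symm, if_pos rfl, zero_add]
        rfl
      · rw [hb] at ht
        rw [ht, hconst, if_neg hne, if_pos rfl, add_zero]
        rfl
    · rw [if_neg h, if_neg, if_neg, ← hfib _ h, Necklace.mk_out]
      · simp
      · rintro rfl; exact h (hc _)
      · rintro rfl; exact h (hc _)
  rw [nu, mu_fiberwise hU _ (Necklace.map χ), finsum_congr hterm, finsum_eq_sum_of_fintype,
    Finset.sum_add_distrib, Finset.sum_add_distrib, Finset.sum_ite_eq' Finset.univ,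
    Finset.sum_ite_eq' Finset.univ, if_pos (Finset.mem_univ _), if_pos (Finset.mem_univ _),
    necklaceSum, finsum_eq_sum_of_fintype]

/-- Nonconstant necklaces whose image word is constant fibre over F', with fibres the necklaces in a
single fibre of φ. The others fibre over the nonconstant necklaces of F'; fixing a representative of
the image removes the rotations, and the fibre becomes a product of p fibres of φ, of measure c^p.
-/
theorem nu_fibration (hU : U ∈ E) {F : Set Y} (hF : IsStable U F) {F' : Set Z}
    (φ : Y → Z) (hmaps : Set.MapsTo φ F F')
    (hφ : ∀ u ∈ U, ∀ y ∈ F, φ (u • y) = u • φ y) (c d : Theta G E)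
    (hc : ∀ z ∈ F', mu E (U ⊓ MulAction.stabilizer G z) (F ∩ φ ⁻¹' {z}) = c)
    (hd : ∀ z ∈ F', nu E p (U ⊓ MulAction.stabilizer G z) (F ∩ φ ⁻¹' {z}) = d) :
    nu E p U F = d * mu E U F' + c ^ p * nu E p U F' := by
  have hst := isStable_necklaces (p := p) hF
  have hconst : ∀ u ∈ U, ∀ y : ZMod p → Y, (∀ i, y i ∈ F) →
      (IsConstWord (φ ∘ (u • y)) ↔ IsConstWord (φ ∘ y)) := by
    intro u hu y hy
    have : φ ∘ (u • y) = u • (φ ∘ y) := funext fun i => hφ u hu _ (hy i)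
    rw [this, isConstWord_smul]
  have hfibst : ∀ z, IsStable (U ⊓ MulAction.stabilizer G z) (F ∩ φ ⁻¹' {z}) := by
    rintro z u ⟨hu, hu'⟩ y ⟨hy, h⟩
    refine ⟨hF u hu y hy, ?_⟩
    rw [Set.mem_preimage, Set.mem_singleton_iff] at h ⊢
    rw [hφ u hu y hy, h]
    exact hu'
  have hsplit : necklaces p F =
      Necklace.mk '' {y | ((∀ i, y i ∈ F) ∧ ¬ IsConstWord y) ∧ IsConstWord (φ ∘ y)} ∪
      Necklace.mk '' {y | (∀ i, y i ∈ F) ∧ ¬ IsConstWord (φ ∘ y)} := by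
    rw [← Set.image_union, necklaces]
    congr 1
    ext y
    simp only [Set.mem_ofPred_eq, Set.mem_union]
    have : IsConstWord y → IsConstWord (φ ∘ y) := fun h i => congrArg φ (h i)
    tauto
  rw [nu, hsplit, mu_union hU]
  · congr 1
    · refine mu_fibration hU ?_ (fun t => φ (t.out 0)) ?_ ?_ d ?_
      · rintro u hu _ ⟨y, ⟨⟨h1, h2⟩, h3⟩, rfl⟩
        exact ⟨u • y, ⟨⟨fun i => hF u hu _ (h1 i), fun h => h2 (isConstWord_smul.1 h)⟩,
          (hconst u hu y h1).2 h3⟩, rfl⟩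
      all_goals
        have hout : ∀ y : ZMod p → Y, IsConstWord (φ ∘ y) → ∀ i, φ ((Necklace.mk y).out 0) = φ (y i) := by
          intro y hy i
          obtain ⟨c, hc⟩ := Necklace.mk_eq_mk.1 (Necklace.mk_out (Necklace.mk y)).symm
          rw [hc, cyclicShift_apply]
          exact (hy _).trans (hy i).symm
      · rintro _ ⟨y, ⟨⟨h1, h2⟩, h3⟩, rfl⟩
        change φ _ ∈ F'
        rw [hout y h3 0]
        exact hmaps (h1 0)
      · rintro u hu _ ⟨y, ⟨⟨h1, h2⟩, h3⟩, rfl⟩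
        rw [Necklace.smul_mk, hout y h3 0, hout (u • y) ((hconst u hu y h1).2 h3) 0]
        exact hφ u hu _ (h1 0)
      · intro z hz
        rw [← hd z hz, nu]
        congr 1
        ext t
        obtain ⟨y, rfl⟩ := Necklace.mk_surjective t
        rw [mk_mem_necklaces]
        constructor
        · rintro ⟨⟨y', ⟨⟨h1, h2⟩, h3⟩, h⟩, h4⟩
          rw [← h, Set.mem_preimage, Set.mem_singleton_iff] at h4
          obtain ⟨c, rfl⟩ := Necklace.mk_eq_mk.1 h
          refine ⟨fun i => ⟨h1 _, ?_⟩, fun h => h2 (isConstWord_cyclicShift.1 h)⟩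
          rw [Set.mem_preimage, Set.mem_singleton_iff, ← h4, hout y' h3 (i + c), cyclicShift_apply]
        · rintro ⟨h1, h2⟩
          have h3 : IsConstWord (φ ∘ y) := fun i => Eq.trans (h1 i).2 (Eq.symm (h1 0).2)
          exact ⟨⟨y, ⟨⟨fun i => (h1 i).1, h2⟩, h3⟩, rfl⟩, (hout y h3 0).trans (h1 0).2⟩
    · refine mu_fibration hU ?_ (Necklace.map φ) ?_ ?_ (c ^ p) ?_
      · rintro u hu _ ⟨y, ⟨h1, h2⟩, rfl⟩
        exact ⟨u • y, ⟨fun i => hF u hu _ (h1 i), fun h => h2 ((hconst u hu y h1).1 h)⟩, rfl⟩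
      · rintro _ ⟨y, ⟨h1, h2⟩, rfl⟩
        exact ⟨φ ∘ y, ⟨fun i => hmaps (h1 i), h2⟩, rfl⟩
      · rintro u hu _ ⟨y, ⟨h1, h2⟩, rfl⟩
        exact congrArg Necklace.mk (funext fun i => hφ u hu _ (h1 i))
      · rintro _ ⟨z, ⟨hz, hz'⟩, rfl⟩
        have hV : U ⊓ MulAction.stabilizer G z ∈ E := inf_stabilizer_mem hU z
        have hle : ∀ i, U ⊓ MulAction.stabilizer G z ≤ U ⊓ MulAction.stabilizer G (z i) := fun i =>
          inf_le_inf_left _ fun g hg => congrFun hg i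
        -- The stabilizer of the image necklace fixes each of its letters, so the fibres over the
        -- letters are stable and the product formula applies.
        rw [stabilizer_necklace E]
        have e1 : Necklace.mk '' {y | (∀ i, y i ∈ F) ∧ ¬ IsConstWord (φ ∘ y)} ∩
            Necklace.map φ ⁻¹' {Necklace.mk z} =
            Necklace.mk '' {y : ZMod p → Y | ∀ i, y i ∈ F ∩ φ ⁻¹' {z i}} := by
          ext t
          constructor
          · rintro ⟨⟨y, ⟨h1, h2⟩, rfl⟩, h⟩
            rw [Set.mem_preimage, Set.mem_singleton_iff, Necklace.map_mk, Necklace.mk_eq_mk] at h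
            obtain ⟨c, rfl⟩ := h
            exact ⟨cyclicShift c y, fun i => ⟨h1 _, rfl⟩, Necklace.mk_cyclicShift _ _⟩
          · rintro ⟨y, hy, rfl⟩
            have hyz : φ ∘ y = z := funext fun i => (hy i).2
            refine ⟨⟨y, ⟨fun i => (hy i).1, hyz ▸ hz'⟩, rfl⟩, ?_⟩
            rw [Set.mem_preimage, Set.mem_singleton_iff, Necklace.map_mk, hyz]
        have e2 : Set.InjOn Necklace.mk {y : ZMod p → Y | ∀ i, y i ∈ F ∩ φ ⁻¹' {z i}} := by
          intro y hy y' hy' h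
          obtain ⟨c, rfl⟩ := Necklace.mk_eq_mk.1 h
          have h1 : φ ∘ y = z := funext fun i => (hy i).2
          have h2 : φ ∘ cyclicShift c y = z := funext fun i => (hy' i).2
          rw [comp_cyclicShift, h1] at h2
          have hc : c = 0 := by
            by_contra hc
            exact hz' (isConstWord_of_cyclicShift_eq hc h2)
          rw [hc, cyclicShift_zero]
        have st : ∀ i, IsStable (U ⊓ MulAction.stabilizer G z) (F ∩ φ ⁻¹' {z i}) := fun i =>
          (hfibst (z i)).mono (hle i)
        rw [e1, mu_mk_image hV (isStable_words st) e2, mu_pi hV _ st,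
          Finset.prod_congr rfl fun i _ => (mu_of_le (inf_stabilizer_mem hU (z i)) hV (hle i)
            (hfibst (z i))).trans (hc _ (hz i)), Finset.prod_const, Finset.card_univ, ZMod.card]
  · rw [Set.disjoint_left]
    rintro _ ⟨y, ⟨_, h1⟩, rfl⟩ ⟨y', ⟨_, h2⟩, h⟩
    obtain ⟨c, rfl⟩ := Necklace.mk_eq_mk.1 h
    exact h2 (isConstWord_cyclicShift.1 h1)

end Nu

/-! ### The necklace operation on Θ -/

section Delta

variable {G : Type u} [Group G] {E : Set (Subgroup G)} [IsStabilizerClass E]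

open IsStabilizerClass IsSmoothAction

variable {p : ℕ} [hp : Fact p.Prime] [IsPrimeToIndex E p]

variable (E p) in
/-- The measure of the nonconstant necklaces in a fibre of a map. -/
noncomputable def nuSymbol (s : ThetaSymbol G E) : Theta G E :=
  nu E p (MulAction.stabilizer G s.transitive.1.some) (s.map ⁻¹' {s.transitive.1.some})

theorem nuSymbol_eq {Y X : SmoothSet G E} (f : Y →[G] X) (hX : X.IsTransitive) (x : X) :
    nuSymbol E p ⟨f, hX⟩ = nu E p (MulAction.stabilizer G x) (f ⁻¹' {x}) := by
  obtain ⟨g, hg⟩ := hX.exists_smul_eq x hX.1.some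
  rw [nuSymbol, ← hg]
  exact nu_stabilizer_smul f g x

variable (E p) in
-- All compatibilities are checked on one fibre: addition is the disjoint union formula, composition
-- is the fibration formula, and base change identifies fibres and shrinks the group.
theorem isDeltaOperation_nuSymbol : IsDeltaOperation p (nuSymbol E p) where
  pow s := by
    rw [ThetaSymbol.cls, thetaClass_eq_mu s.transitive s.map s.transitive.1.some]
    exact mu_pow_eq (s.target.smooth _) (isStable_stabilizer_preimage _ _)
  iso {Y X} hX f hf := by
    rw [nuSymbol_eq f hX hX.1.some]
    obtain ⟨y, hy⟩ := hf.2 hX.1.some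
    have : f ⁻¹' {hX.1.some} = {y} := by
      ext z
      rw [Set.mem_preimage, Set.mem_singleton_iff, Set.mem_singleton_iff, ← hy, hf.1.eq_iff]
    rw [this, nu_singleton]
  add {Y Y₁ Y₂ X} hX f i₁ i₂ h₁ h₂ h := by
    have hU := X.smooth hX.1.some
    have key : ∀ {Y' : SmoothSet G E} (i : Y' →[G] Y), Function.Injective i →
        Set.BijOn i ((f.comp i) ⁻¹' {hX.1.some}) (f ⁻¹' {hX.1.some} ∩ Set.range i) := by
      intro Y' i hi
      refine ⟨fun y hy => ⟨hy, y, rfl⟩, hi.injOn, ?_⟩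
      rintro _ ⟨hy, y, rfl⟩
      exact ⟨y, hy, rfl⟩
    have hst : ∀ {Y' : SmoothSet G E} (i : Y' →[G] Y),
        IsStable (MulAction.stabilizer G hX.1.some) (f ⁻¹' {hX.1.some} ∩ Set.range i) := by
      rintro Y' i u hu _ ⟨hy, y, rfl⟩
      exact ⟨isStable_stabilizer_preimage f _ u hu _ hy, u • y, map_smul i u y⟩
    have hF : f ⁻¹' {hX.1.some} =
        (f ⁻¹' {hX.1.some} ∩ Set.range i₁) ∪ (f ⁻¹' {hX.1.some} ∩ Set.range i₂) := by
      have huniv : Set.range i₁ ∪ Set.range i₂ = Set.univ := h.sup_eq_top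
      rw [← Set.inter_union_distrib_left, huniv, Set.inter_univ]
    rw [nuSymbol_eq f hX hX.1.some, nuSymbol_eq (f.comp i₁) hX hX.1.some,
      nuSymbol_eq (f.comp i₂) hX hX.1.some, thetaClass_eq_mu hX _ hX.1.some,
      thetaClass_eq_mu hX (f.comp i₂) hX.1.some]
    rw [nu_eq_of_bijOn hU (isStable_stabilizer_preimage _ _) i₁ (key i₁ h₁)
        fun u _ y _ => map_smul i₁ u y,
      nu_eq_of_bijOn hU (isStable_stabilizer_preimage _ _) i₂ (key i₂ h₂)
        fun u _ y _ => map_smul i₂ u y,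
      mu_eq_of_bijOn hU (isStable_stabilizer_preimage _ _) i₁ (key i₁ h₁)
        fun u _ y _ => map_smul i₁ u y,
      mu_eq_of_bijOn hU (isStable_stabilizer_preimage _ _) i₂ (key i₂ h₂)
        fun u _ y _ => map_smul i₂ u y]
    conv_lhs => rw [hF]
    exact nu_union hU (hst i₁) (hst i₂) (h.disjoint.mono inf_le_right inf_le_right)
  comp {Z Y X} hZ hY hX g f := by
    rw [nuSymbol_eq (f.comp g) hX hX.1.some, nuSymbol_eq f hX hX.1.some,
      thetaClass_eq_mu hX f hX.1.some, mul_comm (mu E _ _)]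
    have hfib : ∀ y ∈ f ⁻¹' {hX.1.some},
        MulAction.stabilizer G hX.1.some ⊓ MulAction.stabilizer G y = MulAction.stabilizer G y ∧
        (f.comp g) ⁻¹' {hX.1.some} ∩ g ⁻¹' {y} = g ⁻¹' {y} := by
      intro y hy
      rw [Set.mem_preimage, Set.mem_singleton_iff] at hy
      refine ⟨inf_eq_right.2 (hy ▸ f.stabilizer_le y), Set.inter_eq_right.2 ?_⟩
      intro z hz
      rw [Set.mem_preimage, Set.mem_singleton_iff] at hz ⊢
      rw [MulActionHom.comp_apply, hz, hy]
    refine nu_fibration (X.smooth _) (isStable_stabilizer_preimage _ _) g (fun z hz => hz)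
      (fun u _ z _ => map_smul g u z) _ _ (fun y hy => ?_) fun y hy => ?_
    · rw [(hfib y hy).1, (hfib y hy).2, thetaClass_eq_mu hY g y]
    · rw [(hfib y hy).1, (hfib y hy).2, nuSymbol_eq g hY y]
  baseChange {Y' Y X' X} hX hX' g' f' f g h := by
    have hle := g.stabilizer_le hX'.1.some
    rw [nuSymbol_eq f hX (g hX'.1.some), nuSymbol_eq f' hX' hX'.1.some,
      ← nu_of_le (X.smooth _) (X'.smooth _) hle (isStable_stabilizer_preimage _ _)]
    refine (nu_eq_of_bijOn (X'.smooth _) (isStable_stabilizer_preimage _ _) g' ⟨?_, ?_, ?_⟩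
      fun u _ y _ => map_smul g' u y).symm
    · intro y hy
      rw [Set.mem_preimage, Set.mem_singleton_iff] at hy ⊢
      rw [h.1, hy]
    · intro y hy z hz hyz
      rw [Set.mem_preimage, Set.mem_singleton_iff] at hy hz
      refine (h.2 (g' y) hX'.1.some (by rw [h.1, hy])).unique ⟨rfl, hy⟩ ⟨hyz.symm, hz⟩
    · intro y hy
      obtain ⟨y', ⟨h1, h2⟩, -⟩ := h.2 y hX'.1.some hy
      exact ⟨y', h2, h1⟩

theorem orbSum_mem {Y : Type*} [MulAction G Y] {A : Type*} [AddCommMonoid A] (M : AddSubmonoid A)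
    {U : Subgroup G} {F : Set Y} {w : Y → A} (h : ∀ y ∈ F, w y ∈ M) : orbSum U F w ∈ M :=
  finsum_mem_induction (· ∈ M) M.zero_mem (fun _ _ => M.add_mem) fun _ ho => h _ ho

/-- The `p`-th necklace class of a map is a sum of classes of tuples in a fibre. -/
theorem nuSymbol_mem {Y X : SmoothSet G E} (f : Y →[G] X) (hX : X.IsTransitive) (x : X)
    (M : AddSubmonoid (Theta G E))
    (h : ∀ y : ZMod p → Y, (∀ i, f (y i) = x) →
      relClass E (MulAction.stabilizer G x) (MulAction.stabilizer G x ⊓ MulAction.stabilizer G y) ∈ M) :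
    nuSymbol E p ⟨f, hX⟩ ∈ M := by
  rw [nuSymbol_eq f hX x, nu, mu]
  refine orbSum_mem M ?_
  rintro _ ⟨y, ⟨h1, -⟩, rfl⟩
  rw [stabilizer_necklace E]
  exact h y h1

/-- The stabilizer of a word is contained in that of its letter at 0, so the class of each orbit of
words factors through [f]. Transitivity of Y makes [f] the class attached to any letter. -/
theorem thetaClass_dvd_nuSymbol {Y X : SmoothSet G E} (f : Y →[G] X) (hY : Y.IsTransitive)
    (hX : X.IsTransitive) : thetaClass f hX ∣ nuSymbol E p ⟨f, hX⟩ := by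
  rw [← Ideal.mem_span_singleton]
  refine nuSymbol_mem f hX hX.1.some (Submodule.toAddSubmonoid (Ideal.span {thetaClass f hX})) ?_
  intro y hy
  have hU := X.smooth hX.1.some
  rw [Submodule.mem_toAddSubmonoid, Ideal.mem_span_singleton]
  have hle : MulAction.stabilizer G (y 0) ≤ MulAction.stabilizer G hX.1.some :=
    hy 0 ▸ f.stabilizer_le (y 0)
  rw [thetaClass_eq_relClass hY hX f (y 0), hy 0,
    ← relClass_mul hU (Y.smooth (y 0)) (inf_stabilizer_mem hU y) hle
      (inf_le_right.trans fun g hg => congrFun hg 0)]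
  exact dvd_mul_right _ _

theorem thetaClass_pow_eq {Y X : SmoothSet G E} (f : Y →[G] X) (hX : X.IsTransitive) :
    thetaClass f hX ^ p = thetaClass f hX + p * nuSymbol E p ⟨f, hX⟩ :=
  (isDeltaOperation_nuSymbol E p).pow ⟨f, hX⟩

end Delta

/-! ### Oligomorphic groups and the index condition -/

section Oligomorphic

variable {G Ω : Type u} [Group G] [MulAction G Ω]

open IsStabilizerClass IsSmoothAction

theorem Subgroup.conjBy_fixingSubgroup (g : G) (s : Set Ω) :
    (fixingSubgroup G s).conjBy g = fixingSubgroup G (g • s) := by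
  ext h
  rw [Subgroup.mem_conjBy, mem_fixingSubgroup_iff, mem_fixingSubgroup_iff]
  constructor
  · rintro H _ ⟨a, ha, rfl⟩
    have := H a ha
    rw [mul_smul, mul_smul, inv_smul_eq_iff] at this
    exact this
  · intro H a ha
    rw [mul_smul, mul_smul, inv_smul_eq_iff]
    exact H _ (Set.smul_mem_smul_set ha)

theorem exists_stabilizer_eq_of_mem_stabClass {U : Subgroup G} (hU : U ∈ stabClass G Ω) :
    ∃ (n : ℕ) (a : Fin n → Ω), MulAction.stabilizer G a = U := by
  obtain ⟨A, rfl⟩ := hU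
  refine ⟨A.card, fun i => (A.equivFin.symm i : Ω), ?_⟩
  ext g
  rw [MulAction.mem_stabilizer_iff, mem_fixingSubgroup_iff, funext_iff]
  constructor
  · intro h a ha
    simpa using h (A.equivFin ⟨a, ha⟩)
  · exact fun h i => h _ (A.equivFin.symm i).2

theorem stabilizer_point_mem (ω : Ω) : MulAction.stabilizer G ω ∈ stabClass G Ω := by
  refine ⟨{ω}, ?_⟩
  ext g
  simp [mem_fixingSubgroup_iff, MulAction.mem_stabilizer_iff]

theorem IsOligomorphic.isStabilizerClass (hG : IsOligomorphic G Ω) :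
    IsStabilizerClass (stabClass G Ω) where
  top_mem := ⟨∅, by ext g; simp⟩
  inf_mem := by
    classical
    rintro _ _ ⟨A, rfl⟩ ⟨B, rfl⟩
    exact ⟨A ∪ B, by rw [Finset.coe_union, fixingSubgroup_union]⟩
  conjBy_mem := by
    classical
    rintro _ g ⟨A, rfl⟩
    exact ⟨g • A, by rw [Subgroup.conjBy_fixingSubgroup, Finset.coe_smul_finset]⟩
  finite_orb {U V} hU hV := by
    obtain ⟨n, a, rfl⟩ := exists_stabilizer_eq_of_mem_stabClass hU
    obtain ⟨k, b, rfl⟩ := exists_stabilizer_eq_of_mem_stabClass hV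
    -- With U and V the stabilizers of tuples a and b, the U-orbit of a translate of b is determined
    -- by the G-orbit of the concatenation with a.
    have := finite_orb_top_iff.2 (hG.finite_orbits (n + k))
    refine Finite.of_injective
      (fun o : Orb (MulAction.stabilizer G a) (G ⧸ MulAction.stabilizer G b) =>
        Orb.mk (⊤ : Subgroup G) (Fin.append a (MulAction.ofQuotientStabilizer G b o.out)))
      fun o o' h => ?_
    obtain ⟨g, -, hg⟩ := Orb.mk_eq_mk.1 h
    rw [← Orb.mk_out o, ← Orb.mk_out o', Orb.mk_eq_mk]
    refine ⟨g, ?_, MulAction.injective_ofQuotientStabilizer G b ?_⟩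
    · rw [MulAction.mem_stabilizer_iff]
      funext i
      simpa using congrFun hg (Fin.castAdd k i)
    · rw [MulAction.ofQuotientStabilizer_smul]
      funext i
      simpa using congrFun hg (Fin.natAdd n i)

theorem IsOligomorphic.isSmoothAction (hG : IsOligomorphic G Ω) :
    IsSmoothAction (stabClass G Ω) Ω where
  finite_orb_top := by
    have := finite_orb_top_iff.2 (hG.finite_orbits 1)
    refine Finite.of_injective (fun o : Orb (⊤ : Subgroup G) Ω =>
      Orb.mk (⊤ : Subgroup G) fun _ : Fin 1 => o.out) fun o o' h => ?_
    obtain ⟨g, hg, h⟩ := Orb.mk_eq_mk.1 h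
    rw [← Orb.mk_out o, ← Orb.mk_out o', Orb.mk_eq_mk]
    exact ⟨g, hg, congrFun h 0⟩
  stabilizer_mem := stabilizer_point_mem

/-- Let B be the set of all points fixed by V. It is finite, because fixed points are one-point
orbits, and V = G(B). An element g normalizing V preserves B, so it lies in G[B], in which V is
normal of index prime to p. Both g^p and the power of g by that index lie in V, hence so does g by
Bézout. -/
theorem IsOligomorphic.isPrimeToIndex (hG : IsOligomorphic G Ω) {m p : ℕ} (hIND : IND G Ω m)
    (hp : p.Prime) (hpm : ¬ p ∣ m) : IsPrimeToIndex (stabClass G Ω) p where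
  mem_of_pow_mem {V} hV {g} hg h := by
    classical
    have := hG.isStabilizerClass
    have := hG.isSmoothAction
    have hfin := finite_orb (E := stabClass G Ω) (Y := Ω) hV
    let B : Set Ω := {ω | ∀ u ∈ V, u • ω = ω}
    have hB : B.Finite := by
      refine Set.Finite.of_injOn (f := Orb.mk V) (t := Set.univ) (fun _ _ => trivial) ?_
        Set.finite_univ
      intro a ha b _ hab
      obtain ⟨u, hu, rfl⟩ := Orb.mk_eq_mk.1 hab
      exact (ha u hu).symm
    have hVB : V = fixingSubgroup G B := by
      apply le_antisymm
      · exact fun u hu => (mem_fixingSubgroup_iff G).2 fun b hb => hb u hu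
      · obtain ⟨A, rfl⟩ := hV
        exact fixingSubgroup_antitone G Ω fun a ha u hu => (mem_fixingSubgroup_iff G).1 hu a ha
    have hgB : ∀ {g : G}, V.conjBy g = V → g • B ⊆ B := by
      rintro g hg _ ⟨b, hb, rfl⟩ u hu
      rw [← hg, Subgroup.mem_conjBy] at hu
      have := hb _ hu
      rwa [mul_smul, mul_smul, inv_smul_eq_iff] at this
    have hg' : V.conjBy g⁻¹ = V := by
      conv_lhs => rw [← hg]
      ext u
      simp [Subgroup.mem_conjBy, mul_assoc]
    have hgst : g ∈ MulAction.stabilizer G B := by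
      rw [MulAction.mem_stabilizer_iff]
      refine (hgB hg).antisymm ?_
      have := hgB hg'
      rwa [Set.smul_set_subset_iff_subset_inv_smul_set, inv_inv] at this
    obtain ⟨k, hk⟩ := hIND hB.toFinset
    rw [hB.coe_toFinset, ← hVB] at hk
    have hnormal : (V.subgroupOf (MulAction.stabilizer G B)).Normal := by
      refine ⟨fun u hu w => ?_⟩
      rw [Subgroup.mem_subgroupOf, hVB, mem_fixingSubgroup_iff] at hu ⊢
      intro b hb
      have hb' : (w : G)⁻¹ • b ∈ B := by
        have := inv_mem w.2
        rw [MulAction.mem_stabilizer_iff] at this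
        exact this.subset (Set.smul_mem_smul_set hb)
      have := hu _ hb'
      simp only [Subgroup.coe_mul, InvMemClass.coe_inv, mul_smul]
      rw [this, smul_inv_smul]
    have hmem := (V.subgroupOf (MulAction.stabilizer G B)).pow_index_mem ⟨g, hgst⟩
    rw [Subgroup.mem_subgroupOf] at hmem
    have hcop : Nat.Coprime p (V.relIndex (MulAction.stabilizer G B)) := by
      rw [hp.coprime_iff_not_dvd]
      exact fun hd => hpm (hp.dvd_of_dvd_pow (hd.trans hk))
    have hz := Nat.gcd_eq_gcd_ab p (V.relIndex (MulAction.stabilizer G B))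
    rw [Nat.coprime_iff_gcd_eq_one.1 hcop, Nat.cast_one] at hz
    rw [← zpow_one g, hz, zpow_add, zpow_mul, zpow_mul, zpow_natCast, zpow_natCast]
    exact mul_mem (zpow_mem h _) (zpow_mem hmem _)

end Oligomorphic

/-! ### Generation by basic classes -/

section BasicClasses

variable {G Ω : Type u} [Group G] [MulAction G Ω]

variable (G Ω) in
/-- The set of basic classes. -/
def basicClasses : Set (Theta G (stabClass G Ω)) :=
  {x | ∃ (l : ℕ) (a : Fin (l + 1) → Ω), x = thetaClass (basicMap (G := G) a) (orbitSet_isTransitive _)}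

theorem stabilizer_orbitSet {n : ℕ} {a : Fin n → Ω} (y : orbitSet (G := G) a) :
    MulAction.stabilizer G y = MulAction.stabilizer G y.1 := by
  ext g
  rw [MulAction.mem_stabilizer_iff, MulAction.mem_stabilizer_iff]
  exact Subtype.ext_iff

open IsStabilizerClass IsSmoothAction

variable [IsStabilizerClass (stabClass G Ω)]

/-- If V is the stabilizer of a tuple a, the relevant map is the projection from the orbit of a
extended by ω. -/
theorem relClass_inf_stabilizer_mem_basicClasses {V : Subgroup G} (hV : V ∈ stabClass G Ω) (ω : Ω) :
    relClass (stabClass G Ω) V (V ⊓ MulAction.stabilizer G ω) ∈ basicClasses G Ω := by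
  obtain ⟨n, a, rfl⟩ := exists_stabilizer_eq_of_mem_stabClass hV
  refine ⟨n, Fin.snoc a ω, ?_⟩
  let y : orbitSet (G := G) (Fin.snoc a ω : Fin (n + 1) → Ω) := ⟨_, MulAction.mem_orbit_self _⟩
  have h2 : MulAction.stabilizer G (Fin.snoc a ω : Fin (n + 1) → Ω) =
      MulAction.stabilizer G a ⊓ MulAction.stabilizer G ω := by
    ext g
    simp only [Subgroup.mem_inf, MulAction.mem_stabilizer_iff, funext_iff, Pi.smul_apply]
    constructor
    · intro h
      refine ⟨fun i => ?_, ?_⟩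
      · simpa using h i.castSucc
      · simpa using h (Fin.last n)
    · rintro ⟨h, h'⟩ i
      induction i using Fin.lastCases with
      | last => simpa using h'
      | cast i => simpa using h i
  have h1 : MulAction.stabilizer G (basicMap (G := G) (Fin.snoc a ω : Fin (n + 1) → Ω) y) =
      MulAction.stabilizer G a := (stabilizer_orbitSet _).trans
    (congrArg (MulAction.stabilizer G) (Fin.init_snoc (α := fun _ => Ω) ω a))
  rw [thetaClass_eq_relClass (orbitSet_isTransitive _) (orbitSet_isTransitive _) _ y, h1, ← h2]
  exact congrArg _ (stabilizer_orbitSet y).symm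

/-- Adding finitely many points to the fixed set gives a product of basic classes. -/
theorem exists_relClass_iInf_eq_prod {ι : Type*} (s : Finset ι) (ω : ι → Ω) {V : Subgroup G}
    (hV : V ∈ stabClass G Ω) : ∃ b : ι → Theta G (stabClass G Ω), (∀ i ∈ s, b i ∈ basicClasses G Ω) ∧
      V ⊓ ⨅ i ∈ s, MulAction.stabilizer G (ω i) ∈ stabClass G Ω ∧
      relClass (stabClass G Ω) V (V ⊓ ⨅ i ∈ s, MulAction.stabilizer G (ω i)) = ∏ i ∈ s, b i := by
  classical
  induction s using Finset.induction_on with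
  | empty => exact ⟨0, by simp, by simpa using hV, by simpa using relClass_self hV⟩
  | @insert j s hj ih =>
    obtain ⟨b, hb, hW, h⟩ := ih
    have e : V ⊓ ⨅ i ∈ insert j s, MulAction.stabilizer G (ω i) =
        (V ⊓ ⨅ i ∈ s, MulAction.stabilizer G (ω i)) ⊓ MulAction.stabilizer G (ω j) := by
      rw [Finset.iInf_insert, inf_comm (MulAction.stabilizer G (ω j)), inf_assoc]
    have hW' := inf_mem hW (stabilizer_point_mem (ω j))
    refine ⟨Function.update b j (relClass (stabClass G Ω) (V ⊓ ⨅ i ∈ s, MulAction.stabilizer G (ω i))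
      ((V ⊓ ⨅ i ∈ s, MulAction.stabilizer G (ω i)) ⊓ MulAction.stabilizer G (ω j))), ?_, e ▸ hW', ?_⟩
    · intro i hi
      rcases eq_or_ne i j with rfl | hij
      · rw [Function.update_self]
        exact relClass_inf_stabilizer_mem_basicClasses hW _
      · rw [Function.update_of_ne hij]
        exact hb i (Finset.mem_of_mem_insert_of_ne hi hij)
    · rw [e, ← relClass_mul hV hW hW' inf_le_left inf_le_left, Finset.prod_insert hj,
        Function.update_self, mul_comm, h]
      congr 1
      exact Finset.prod_congr rfl fun i hi => by
        rw [Function.update_of_ne (ne_of_mem_of_not_mem hi hj)]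

theorem relClass_mem_closure {U V : Subgroup G} (hU : U ∈ stabClass G Ω) (hV : V ∈ stabClass G Ω)
    (h : V ≤ U) : relClass (stabClass G Ω) U V ∈ Subring.closure (basicClasses G Ω) := by
  obtain ⟨n, a, rfl⟩ := exists_stabilizer_eq_of_mem_stabClass hV
  obtain ⟨b, hb, -, hprod⟩ := exists_relClass_iInf_eq_prod Finset.univ a hU
  have e : U ⊓ ⨅ i ∈ Finset.univ, MulAction.stabilizer G (a i) = MulAction.stabilizer G a := by
    refine (inf_eq_right.2 ?_).trans ?_
    · refine le_trans (le_of_eq ?_) h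
      ext g
      simp [Subgroup.mem_iInf, MulAction.mem_stabilizer_iff, funext_iff]
    · ext g
      simp [Subgroup.mem_iInf, MulAction.mem_stabilizer_iff, funext_iff]
  rw [e] at hprod
  rw [hprod]
  exact prod_mem fun i hi => Subring.subset_closure (hb i hi)

variable (G Ω) in
/-- The basic classes generate the ring. -/
theorem closure_basicClasses : Subring.closure (basicClasses G Ω) = ⊤ := by
  rw [eq_top_iff]
  intro x _
  obtain ⟨x, rfl⟩ := Theta.mk_surjective x
  induction x using MvPolynomial.induction_on with
  | C a =>
    rw [← MvPolynomial.algebraMap_eq, eq_intCast, map_intCast]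
    exact intCast_mem _ a
  | add a b iha ihb =>
    rw [map_add]
    exact add_mem (iha trivial) (ihb trivial)
  | mul_X a s iha =>
    rw [map_mul]
    refine mul_mem (iha trivial) ?_
    rw [Theta.mk_X, ThetaSymbol.cls, thetaClass_eq_orbSum_top]
    refine orbSum_mem (Subring.closure (basicClasses G Ω)).toAddSubgroup.toAddSubmonoid ?_
    exact fun y _ => relClass_mem_closure (s.target.smooth _) (s.source.smooth _)
      (s.map.stabilizer_le y)

variable {p : ℕ} [hp : Fact p.Prime] [IsPrimeToIndex (stabClass G Ω) p]

/-- The necklace class of a basic class is a sum of products of `p` basic classes. -/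
theorem exists_pow_eq_add_mul_of_mem_basicClasses {b : Theta G (stabClass G Ω)}
    (hb : b ∈ basicClasses G Ω) : ∃ w ∈ AddSubmonoid.closure
      {x | ∃ c : ZMod p → Theta G (stabClass G Ω), (∀ i, c i ∈ basicClasses G Ω) ∧ x = ∏ i, c i},
      b ^ p = b + p * w := by
  obtain ⟨l, a, rfl⟩ := hb
  refine ⟨_, ?_, thetaClass_pow_eq _ _⟩
  let x : orbitSet (G := G) (Fin.init a) := ⟨_, MulAction.mem_orbit_self _⟩
  refine nuSymbol_mem _ _ x _ fun y hy => AddSubmonoid.subset_closure ?_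
  -- The letters of a word over x share their first l coordinates, those of x. Fixing the word thus
  -- means fixing x and the p last coordinates, and adding these one at a time costs p basic
  -- classes.
  obtain ⟨b, hb, -, h⟩ := exists_relClass_iInf_eq_prod Finset.univ
    (fun i : ZMod p => (y i).1 (Fin.last l)) ((orbitSet (G := G) (Fin.init a)).smooth x)
  refine ⟨b, fun i => hb i (Finset.mem_univ i), ?_⟩
  rw [← h]
  congr 1
  ext g
  have hx : ∀ i j, (y i).1 (Fin.castSucc j) = x.1 j := fun i j =>
    congrFun (congrArg Subtype.val (hy i)) j
  have key : ∀ i, g • x = x → (g • y i = y i ↔ g • (y i).1 (Fin.last l) = (y i).1 (Fin.last l)) := by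
    intro i hgx
    refine (Subtype.ext_iff.trans funext_iff).trans ?_
    constructor
    · exact fun h => h (Fin.last l)
    · intro h j
      induction j using Fin.lastCases with
      | last => exact h
      | cast j =>
        change g • (y i).1 (Fin.castSucc j) = _
        rw [hx]
        exact congrFun (congrArg Subtype.val hgx) j
  simp only [Subgroup.mem_inf, Subgroup.mem_iInf, MulAction.mem_stabilizer_iff, Finset.mem_univ,
    true_imp_iff]
  refine and_congr_right fun hgx => ?_
  rw [funext_iff]
  exact forall_congr' fun i => key i hgx

end BasicClasses

/-! ### p-adic integrality and units -/

section PadicIntegrality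

variable {p : ℕ} [hp : Fact p.Prime]

theorem Padic.exists_pow_mul_mem_subring (x : ℚ_[p]) :
    ∃ n : ℕ, (p : ℚ_[p]) ^ n * x ∈ PadicInt.subring p := by
  have hp1 : (1 : ℝ) < p := by exact_mod_cast hp.out.one_lt
  obtain ⟨n, hn⟩ := pow_unbounded_of_one_lt ‖x‖ hp1
  refine ⟨n, ?_⟩
  rw [PadicInt.mem_subring_iff, norm_mul, norm_pow, Padic.norm_p, inv_pow,
    inv_mul_le_one₀ (by positivity)]
  exact hn.le

variable {R : Type*} [CommRing R]

/-- Let `B` be a set such that `(b ^ p - b) / p` is a sum of products of `p` elements of `B` for all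
`b ∈ B`. Then a homomorphism to `ℚ_[p]` that is bounded on `B` is integral on `B`. -/
theorem RingHom.mem_subring_of_pow_eq_add_mul (ψ : R →+* ℚ_[p]) {B : Set R}
    (hB : ∀ b ∈ B, ∃ w ∈ AddSubmonoid.closure
      {x | ∃ c : ZMod p → R, (∀ i, c i ∈ B) ∧ x = ∏ i, c i}, b ^ p = b + p * w)
    (n : ℕ) (hn : ∀ b ∈ B, (p : ℚ_[p]) ^ n * ψ b ∈ PadicInt.subring p) :
    ∀ b ∈ B, ψ b ∈ PadicInt.subring p := by
  induction n with
  | zero => simpa using hn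
  | succ n ih =>
    refine ih fun b hb => ?_
    obtain ⟨w, hw, e⟩ := hB b hb
    have hw' : (p : ℚ_[p]) ^ ((n + 1) * p) * ψ w ∈ PadicInt.subring p := by
      clear e
      induction hw using AddSubmonoid.closure_induction with
      | mem x hx =>
        obtain ⟨c, hc, rfl⟩ := hx
        have : (p : ℚ_[p]) ^ ((n + 1) * p) * ψ (∏ i, c i) =
            ∏ i, ((p : ℚ_[p]) ^ (n + 1) * ψ (c i)) := by
          rw [Finset.prod_mul_distrib, Finset.prod_const, Finset.card_univ, ZMod.card, ← pow_mul,
            map_prod]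
        rw [this]
        exact prod_mem fun i _ => hn _ (hc i)
      | zero => simp
      | add x y _ _ hx hy => rw [map_add, mul_add]; exact add_mem hx hy
    let z : ℤ_[p] := ⟨_, hn b hb⟩
    -- Since p ≥ 2, (n + 1) p ≥ n + 2. So the p-th power of z = p^(n+1) ψ(b) is divisible by p,
    -- hence z is too, and the exponent n + 1 can be lowered to n.
    obtain ⟨k, hk⟩ : ∃ k, (n + 1) * p = (n + 1) + 1 + k := by
      obtain ⟨q, hq⟩ := Nat.exists_eq_add_of_le hp.out.two_le
      exact ⟨n + q + n * q, by rw [hq]; ring⟩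
    have hz : z ^ p = p * (p ^ k * z + ⟨_, hw'⟩) := by
      apply Subtype.ext
      push_cast
      change ((p : ℚ_[p]) ^ (n + 1) * ψ b) ^ p = p * (p ^ k * (p ^ (n + 1) * ψ b) +
        p ^ ((n + 1) * p) * ψ w)
      have e' := congrArg ψ e
      rw [map_pow, map_add, map_mul, map_natCast] at e'
      rw [mul_pow, e', ← pow_mul, mul_add, mul_add]
      nth_rw 1 [hk]
      ring
    obtain ⟨t, ht⟩ := PadicInt.prime_p.dvd_of_dvd_pow ⟨_, hz⟩
    have ht' : (p : ℚ_[p]) ^ (n + 1) * ψ b = p * t := congrArg Subtype.val ht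
    have hp0 : (p : ℚ_[p]) ≠ 0 := by exact_mod_cast hp.out.ne_zero
    have : (p : ℚ_[p]) ^ n * ψ b = t := by
      apply mul_left_cancel₀ hp0
      rw [← ht']
      ring
    rw [this]
    exact t.2

/-- Cancelling x gives x^(p−1) = 1 + p w, which is not divisible by p. -/
theorem Padic.norm_eq_one_of_pow_eq_add_mul {x w : ℚ_[p]} (hx : x ∈ PadicInt.subring p)
    (hw : w ∈ PadicInt.subring p) (hx0 : x ≠ 0) (h : x ^ p = x + p * (x * w)) : ‖x‖ = 1 := by
  by_contra hne
  let z : ℤ_[p] := ⟨x, hx⟩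
  have hz : ‖z‖ < 1 := lt_of_le_of_ne hx hne
  rw [PadicInt.norm_lt_one_iff_dvd] at hz
  have h1 : z ^ (p - 1) = 1 + p * ⟨w, hw⟩ := by
    apply Subtype.ext
    push_cast
    change x ^ (p - 1) = 1 + p * w
    apply mul_left_cancel₀ hx0
    rw [← pow_succ', Nat.sub_add_cancel hp.out.one_le, h]
    ring
  have h2 : (p : ℤ_[p]) ∣ z ^ (p - 1) :=
    hz.trans (dvd_pow_self z (Nat.sub_ne_zero_of_lt hp.out.one_lt))
  rw [h1] at h2
  exact PadicInt.prime_p.not_dvd_one ((dvd_add_left (dvd_mul_right _ _)).1 h2)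

/-- A rational number that is integral at all primes not dividing `m` is in `ℤ[1/m]`. -/
theorem Rat.exists_natCast_pow_mul_eq {m : ℕ} (hm : 0 < m) {q : ℚ}
    (h : ∀ (p : ℕ) [Fact p.Prime], ¬ p ∣ m → ‖(q : ℚ_[p])‖ ≤ 1) :
    ∃ (k : ℕ) (z : ℤ), (m : ℚ) ^ k * q = z := by
  have : q.den.primeFactors ⊆ m.primeFactors := by
    intro p hp
    have := Fact.mk (Nat.prime_of_mem_primeFactors hp)
    rw [Nat.mem_primeFactors]
    refine ⟨this.out, ?_, hm.ne'⟩
    by_contra hpm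
    have hu := PadicInt.isUnit_den q (h p hpm)
    rw [PadicInt.isUnit_iff, PadicInt.norm_natCast_eq_one_iff,
      Nat.Prime.coprime_iff_not_dvd this.out] at hu
    exact hu (Nat.dvd_of_mem_primeFactors hp)
  obtain ⟨k, c, hc⟩ := (Nat.exists_dvd_pow_iff q.den_nz hm.ne').2 this
  refine ⟨k, c * q.num, ?_⟩
  have hc' : (m : ℚ) ^ k = q.den * c := by exact_mod_cast hc
  rw [hc']
  push_cast
  rw [mul_right_comm, Rat.den_mul_eq_num, mul_comm]

end PadicIntegrality

/-! ### Passing to localizations -/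

section LocalizationTransfer

variable {R S : Type*} [CommRing R] [CommRing S] [Algebra R S] (M : Submonoid R)
  [IsLocalization M S] {p : ℕ}

include M in
theorem IsLocalization.exists_pow_sub_self_eq (h : ∀ x : R, ∃ w, x ^ p - x = p * w) (x : S) :
    ∃ w, x ^ p - x = p * w := by
  obtain ⟨⟨a, s⟩, hx⟩ := IsLocalization.surj M x
  have hs := IsLocalization.map_units S s
  obtain ⟨u, hu⟩ := hs.exists_right_inv
  obtain ⟨w, hw⟩ := h a
  obtain ⟨v, hv⟩ := h s
  have hw' := congrArg (algebraMap R S) hw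
  have hv' := congrArg (algebraMap R S) hv
  simp only [map_sub, map_pow, map_mul, map_natCast] at hw' hv'
  change x * algebraMap R S s = algebraMap R S a at hx
  have hup : (algebraMap R S s) ^ p * u ^ p = 1 := by rw [← mul_pow, hu, one_pow]
  -- With x s = a, a^p = a + p w and s^p = s + p v, one finds s^p (x^p − x) = p (w − x v).
  refine ⟨u ^ p * (algebraMap R S w - x * algebraMap R S v), ?_⟩
  rw [← hx, mul_pow] at hw'
  linear_combination (-x ^ p + x) * hup + u ^ p * hw' - u ^ p * x * hv'

include M in
theorem IsLocalization.eq_zero_of_natCast_mul_eq_zero (h : ∀ x : R, p * x = 0 → x = 0) {x : S}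
    (hx : p * x = 0) : x = 0 := by
  obtain ⟨⟨a, s⟩, hxa⟩ := IsLocalization.surj M x
  change x * algebraMap R S s = algebraMap R S a at hxa
  have h0 : algebraMap R S (p * a) = 0 := by
    rw [map_mul, map_natCast, ← hxa, ← mul_assoc, hx, zero_mul]
  obtain ⟨c, hc⟩ := (IsLocalization.map_eq_zero_iff M S _).1 h0
  have h1 : algebraMap R S a = 0 :=
    (IsLocalization.map_eq_zero_iff M S _).2 ⟨c, h _ (by rw [← hc]; ring)⟩
  rw [h1] at hxa
  exact (IsLocalization.map_units S s).mul_left_eq_zero.1 hxa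

end LocalizationTransfer

/-! ### Counting characters modulo p -/

section Counting

/-- The number of homomorphisms to `𝔽_p` that do not vanish on a set `B` of generators, if `B` is
contained in the span of `r` elements. -/
theorem card_le_pow_of_forall_ne_zero {R : Type*} [CommRing R] {p : ℕ} [hp : Fact p.Prime] {m r l : ℕ}
    (hpm : ¬ p ∣ m) {B : Set R} (hB : Subring.closure B = ⊤) (t : Fin r → R)
    (ht : ∀ b ∈ B, ∃ (k : ℕ) (c : Fin r → ℤ), (m : R) ^ k * b = ∑ i, c i * t i)
    (χ : Fin l → R →+* ZMod p) (hχ : Function.Injective χ) (hne : ∀ i, ∀ b ∈ B, χ i b ≠ 0) :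
    l ≤ (p - 1) ^ r := by
  classical
  have hm : (m : ZMod p) ≠ 0 := by rwa [Ne, ZMod.natCast_eq_zero_iff]
  choose k c hc using fun b : B => ht b b.2
  -- Coordinates of b modulo p with respect to t; each character is a linear form in these
  -- coordinates.
  let v : B → Fin r → ZMod p := fun b i => ((m : ZMod p) ^ k b)⁻¹ * c b i
  let L : Fin l → (Fin r → ZMod p) →ₗ[ZMod p] ZMod p := fun j =>
    ∑ i, (χ j (t i)) • LinearMap.proj i
  have hL : ∀ j (b : B), χ j (b : R) = L j (v b) := by
    intro j b
    have := congrArg (χ j) (hc b)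
    rw [map_mul, map_pow, map_natCast, map_sum] at this
    rw [← inv_mul_cancel_left₀ (pow_ne_zero (k b) hm) (χ j (b : R)), this, Finset.mul_sum,
      LinearMap.sum_apply]
    refine Finset.sum_congr rfl fun i _ => ?_
    simp only [v, map_mul, map_intCast, LinearMap.smul_apply, LinearMap.proj_apply, smul_eq_mul]
    ring
  -- Elements of B whose coordinate vectors form a basis of the span: at most r of them, and the
  -- nonzero values on them determine a character.
  obtain ⟨κ, a, -, hspan, hli⟩ := exists_linearIndependent' (ZMod p) v
  have hfin : Finite κ := hli.finite
  have := Fintype.ofFinite κ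
  have hκ : Fintype.card κ ≤ r := by
    simpa using hli.fintype_card_le_finrank
  have hinj : Function.Injective fun (j : Fin l) (x : κ) =>
      Units.mk0 (χ j (a x : R)) (hne j _ (a x).2) := by
    intro j j' h
    apply hχ
    have hLL : ∀ y ∈ Submodule.span (ZMod p) (Set.range v), L j y = L j' y := by
      rw [← hspan]
      intro y hy
      refine LinearMap.eqOn_span (f := L j) (g := L j') ?_ hy
      rintro _ ⟨x, rfl⟩
      have := congrArg Units.val (congrFun h x)
      simp only [Units.val_mk0] at this
      rw [Function.comp_apply, ← hL, ← hL, this]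
    have hle : Subring.closure B ≤ (χ j).eqLocus (χ j') :=
      Subring.closure_le.2 fun b hb => by
        change χ j b = χ j' b
        exact (hL j ⟨b, hb⟩).trans ((hLL _ (Submodule.subset_span ⟨_, rfl⟩)).trans
          (hL j' ⟨b, hb⟩).symm)
    rw [hB] at hle
    exact RingHom.ext fun x => hle (x := x) trivial
  have h1 := Fintype.card_le_of_injective _ hinj
  rw [Fintype.card_fin, Fintype.card_fun, ZMod.card_units_eq_totient,
    Nat.totient_prime hp.out] at h1
  exact h1.trans (Nat.pow_le_pow_right (Nat.sub_pos_of_lt hp.out.one_lt) hκ)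

end Counting

/-! ### Finite generation after inverting m -/

section LocalizedGenerators

/-- Generators of a localized module give generators of the module up to denominators. -/
theorem LocalizedModule.exists_smul_eq_sum_of_span_eq_top {R M : Type*} [CommRing R]
    [AddCommGroup M] [Module R M] (S : Submonoid R) {ι : Type*} [Fintype ι]
    (x : ι → LocalizedModule S M) (hx : Submodule.span (Localization S) (Set.range x) = ⊤) :
    ∃ t : ι → M, ∀ y : M, ∃ (s : S) (c : ι → R), s • y = ∑ i, c i • t i := by
  have hsurj : ∀ z : LocalizedModule S M, ∃ (s : S) (t : M), s • z = LocalizedModule.mkLinearMap S M t := by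
    intro z
    obtain ⟨⟨t, s⟩, h⟩ := IsLocalizedModule.surj S (LocalizedModule.mkLinearMap S M) z
    exact ⟨s, t, h⟩
  choose s t hst using fun i => hsurj (x i)
  refine ⟨t, fun y => ?_⟩
  have key : ∀ z : LocalizedModule S M, ∃ s : S, ∃ n ∈ Submodule.span R (Set.range t),
      s • z = LocalizedModule.mkLinearMap S M n := by
    intro z
    have hz : z ∈ Submodule.span (Localization S) (Set.range x) := hx ▸ Submodule.mem_top
    induction hz using Submodule.span_induction with
    | mem z hz =>
      obtain ⟨i, rfl⟩ := hz
      exact ⟨s i, t i, Submodule.subset_span ⟨i, rfl⟩, hst i⟩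
    | zero => exact ⟨1, 0, zero_mem _, by simp⟩
    | add z w _ _ hz hw =>
      obtain ⟨s, n, hn, hz⟩ := hz
      obtain ⟨s', n', hn', hw⟩ := hw
      refine ⟨s * s', (s' : R) • n + (s : R) • n',
        add_mem (Submodule.smul_mem _ _ hn) (Submodule.smul_mem _ _ hn'), ?_⟩
      rw [smul_add, map_add, map_smul, map_smul, ← hz, ← hw, mul_smul, smul_comm s s' z, mul_smul]
      rfl
    | smul a z _ hz =>
      obtain ⟨s, n, hn, hz⟩ := hz
      obtain ⟨⟨c, d⟩, h⟩ := IsLocalization.surj S a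
      refine ⟨d * s, c • n, Submodule.smul_mem _ _ hn, ?_⟩
      have h' : (d : R) • a = algebraMap R _ c := by rw [Algebra.smul_def, mul_comm]; exact h
      rw [map_smul, ← hz, ← algebraMap_smul (Localization S) c (s • z), ← h', smul_assoc, mul_smul]
      change (d : R) • (s : R) • a • z = (d : R) • a • (s : R) • z
      rw [smul_comm a]
  obtain ⟨s, n, hn, h⟩ := key (LocalizedModule.mkLinearMap S M y)
  rw [Submonoid.smul_def, ← map_smul] at h
  obtain ⟨u, hu⟩ := (IsLocalizedModule.eq_iff_exists S (LocalizedModule.mkLinearMap S M)).1 h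
  obtain ⟨c, hc⟩ := (Submodule.mem_span_range_iff_exists_fun R).1 hn
  refine ⟨u * s, fun i => u * c i, ?_⟩
  rw [mul_smul]
  refine hu.trans ?_
  rw [← hc, Submonoid.smul_def, Finset.smul_sum]
  exact Finset.sum_congr rfl fun i _ => (mul_smul _ _ _).symm

variable {A : Type*} [CommRing A] {m : ℕ} {B : Set A} {r : ℕ} {t : Fin r → A}

/-- The inverse of m and the images of the t i generate: they give B after division by powers of m,
then all of A, then all fractions. -/
theorem Algebra.finiteType_of_isLocalizationAway {R : Type*} [CommRing R] [Algebra A R]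
    [IsLocalization.Away (m : A) R] (hB : Subring.closure B = ⊤)
    (ht : ∀ b ∈ B, ∃ (k : ℕ) (c : Fin r → ℤ), (m : A) ^ k * b = ∑ i, c i * t i) :
    Algebra.FiniteType ℤ R := by
  classical
  have hu : IsUnit (algebraMap A R m) := IsLocalization.Away.algebraMap_isUnit (m : A)
  obtain ⟨u, hu⟩ := hu.exists_right_inv
  let C : Subalgebra ℤ R := Algebra.adjoin ℤ (insert u (Set.range fun i => algebraMap A R (t i)))
  have huC : u ∈ C := Algebra.subset_adjoin (Set.mem_insert _ _)
  have hdiv : ∀ (k : ℕ) (x : R), algebraMap A R m ^ k * x ∈ C → x ∈ C := by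
    intro k x hx
    have : x = u ^ k * (algebraMap A R m ^ k * x) := by
      rw [← mul_assoc, ← mul_pow, mul_comm u, hu, one_pow, one_mul]
    rw [this]
    exact mul_mem (pow_mem huC k) hx
  have hBC : Subring.closure B ≤ C.toSubring.comap (algebraMap A R) := by
    refine Subring.closure_le.2 fun b hb => ?_
    obtain ⟨k, c, h⟩ := ht b hb
    refine hdiv k _ ?_
    rw [← map_pow, ← map_mul, h, map_sum]
    refine sum_mem fun i _ => ?_
    rw [map_mul, map_intCast]
    exact mul_mem (intCast_mem C _) (Algebra.subset_adjoin (Set.mem_insert_of_mem _ ⟨i, rfl⟩))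
  have hC : C = ⊤ := by
    refine Algebra.eq_top_iff.2 fun x => ?_
    obtain ⟨⟨a, _, k, rfl⟩, h⟩ := IsLocalization.surj (Submonoid.powers (m : A)) x
    refine hdiv k x ?_
    change x * algebraMap A R (m ^ k) = algebraMap A R a at h
    rw [mul_comm, ← map_pow, h]
    rw [hB] at hBC
    exact hBC trivial
  exact ⟨⟨(insert u (Set.range fun i => algebraMap A R (t i))).toFinset, by simpa using hC⟩⟩

/-- A ring in which `x ^ p ≡ x` modulo all primes `p` not dividing `m`, and which is generated by a
set contained in a finitely generated subgroup up to powers of `m`, has finitely many homomorphisms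
to `ℚ`, and the elements in all their kernels are torsion. -/
theorem finite_ringHom_rat_of_generators (hm : 0 < m)
    (h : ∀ p : ℕ, p.Prime → ¬ p ∣ m → ∀ x : A, ∃ w, x ^ p - x = p * w)
    (hB : Subring.closure B = ⊤)
    (ht : ∀ b ∈ B, ∃ (k : ℕ) (c : Fin r → ℤ), (m : A) ^ k * b = ∑ i, c i * t i) :
    Finite (A →+* ℚ) ∧ ∀ x : A, (∀ χ : A →+* ℚ, χ x = 0) → ∃ n : ℕ, n ≠ 0 ∧ (n : A) * x = 0 := by
  have key : ∀ (R : Type _) [CommRing R] [Algebra A R] [IsLocalization.Away (m : A) R],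
      Finite (A →+* ℚ) ∧
        ∀ x : A, (∀ χ : A →+* ℚ, χ x = 0) → ∃ n : ℕ, n ≠ 0 ∧ (n : A) * x = 0 := by
    intro R _ _ _
    have hft : Algebra.FiniteType ℤ R := Algebra.finiteType_of_isLocalizationAway hB ht
    have hu : IsUnit (m : R) := by
      have := IsLocalization.Away.algebraMap_isUnit (S := R) (m : A)
      rwa [map_natCast] at this
    obtain ⟨hfin, hker⟩ := finite_ringHom_rat_and_exists_mul_eq_zero hm hu fun p hp hpm x =>
      IsLocalization.exists_pow_sub_self_eq (Submonoid.powers (m : A)) (h p hp hpm) x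
    have hunit : ∀ χ : A →+* ℚ, IsUnit (χ m) := fun χ => by
      rw [map_natCast, isUnit_iff_ne_zero]
      exact_mod_cast hm.ne'
    constructor
    · refine Finite.of_injective (fun χ : A →+* ℚ => IsLocalization.Away.lift (S := R) (m : A) (hunit χ))
        fun χ χ' e => RingHom.ext fun a => ?_
      have := RingHom.congr_fun e (algebraMap A R a)
      simpa only [IsLocalization.Away.lift_eq] using this
    · intro x hx
      obtain ⟨n, hn, hnx⟩ := hker (algebraMap A R x) fun χ => hx (χ.comp (algebraMap A R))
      rw [← map_natCast (algebraMap A R), ← map_mul] at hnx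
      obtain ⟨⟨_, k, rfl⟩, hk⟩ :=
        (IsLocalization.map_eq_zero_iff (Submonoid.powers (m : A)) R _).1 hnx
      refine ⟨m ^ k * n, mul_ne_zero (pow_ne_zero _ hm.ne') hn, ?_⟩
      push_cast
      rw [mul_assoc]
      exact hk
  exact key (Localization.Away (m : A))

end LocalizedGenerators

/-! ### Extending characters to the localization and detecting its elements -/

section RegularLocalization

/-- Strip the prime factors of n one at a time: those dividing m are units, and the others are not
zero divisors by hypothesis. -/
theorem eq_zero_of_natCast_mul_eq_zero {S : Type*} [CommRing S] {m : ℕ} (hu : IsUnit (m : S))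
    (h : ∀ p : ℕ, p.Prime → ¬ p ∣ m → ∀ x : S, p * x = 0 → x = 0) {n : ℕ} (hn : n ≠ 0) :
    ∀ {x : S}, n * x = 0 → x = 0 := by
  induction n using induction_on_primes with
  | zero => exact absurd rfl hn
  | one => intro x hx; simpa using hx
  | prime_mul p a hp ih =>
    intro x hx
    refine ih (by rintro rfl; simp at hn) ?_
    rw [Nat.cast_mul, mul_assoc] at hx
    by_cases hpm : p ∣ m
    · obtain ⟨c, rfl⟩ := hpm
      rw [Nat.cast_mul] at hu
      exact (isUnit_of_mul_isUnit_left hu).mul_right_eq_zero.1 hx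
    · exact h p hp hpm _ hx

variable {m : ℕ}

variable (m) in
/-- The inclusion of `ℤ[1/m]` in the rational numbers. -/
noncomputable def Localization.Away.toRat (hm : 0 < m) : Localization.Away (m : ℤ) →+* ℚ :=
  IsLocalization.Away.lift (m : ℤ) (g := Int.castRingHom ℚ)
    (by rw [isUnit_iff_ne_zero]; simpa using hm.ne')

theorem Localization.Away.toRat_injective (hm : 0 < m) :
    Function.Injective (Localization.Away.toRat m hm) := by
  rw [injective_iff_map_eq_zero]
  intro x hx
  obtain ⟨k, z, hz⟩ := Localization.Away.exists_natCast_pow_mul_eq x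
  have h1 := congrArg (Localization.Away.toRat m hm) hz
  rw [map_mul, hx, mul_zero, map_intCast] at h1
  have h2 : z = 0 := by exact_mod_cast h1.symm
  rw [h2, Int.cast_zero] at hz
  exact (Localization.Away.isUnit_natCast.pow k).mul_right_eq_zero.1 hz

theorem Localization.Away.mem_range_toRat (hm : 0 < m) {q : ℚ}
    (h : ∀ (p : ℕ) [Fact p.Prime], ¬ p ∣ m → ‖(q : ℚ_[p])‖ ≤ 1) :
    q ∈ (Localization.Away.toRat m hm).range := by
  obtain ⟨k, z, hz⟩ := Rat.exists_natCast_pow_mul_eq hm h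
  obtain ⟨u, hu⟩ := (Localization.Away.isUnit_natCast (m := m)).exists_right_inv
  refine ⟨u ^ k * z, ?_⟩
  have hu' := congrArg (Localization.Away.toRat m hm) hu
  rw [map_mul, map_natCast, map_one] at hu'
  rw [map_mul, map_pow, map_intCast, ← hz, ← mul_assoc, ← mul_pow, mul_comm _ (m : ℚ), hu', one_pow,
    one_mul]

variable {A A' S : Type*} [CommRing A] [CommRing A'] [CommRing S] [Algebra A A'] [Algebra A' S]
  {M : Submonoid A} [IsLocalization M A'] [IsLocalization.Away (m : A') S]

variable (A A' S) in
/-- The localization map of the two-step localization `A → A' → S`. -/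
def algebraMapTwo : A →+* S := (algebraMap A' S).comp (algebraMap A A')

include M m in
theorem algebraMapTwo_ringHom_ext {T : Type*} [CommRing T] {f g : S →+* T}
    (h : ∀ a, f (algebraMapTwo A A' S a) = g (algebraMapTwo A A' S a)) : f = g := by
  refine IsLocalization.ringHom_ext (Submonoid.powers (m : A')) ?_
  refine IsLocalization.ringHom_ext M ?_
  exact RingHom.ext h

theorem isUnit_algebraMapTwo {d : A} (hd : d ∈ M) : IsUnit (algebraMapTwo A A' S d) :=
  (IsLocalization.map_units A' (⟨d, hd⟩ : M)).map (algebraMap A' S)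

include A' in
theorem isUnit_natCast_of_away : IsUnit (m : S) := by
  have := IsLocalization.Away.algebraMap_isUnit (S := S) (m : A')
  rwa [map_natCast] at this

include M in
theorem exists_mul_eq_algebraMapTwo (s : S) :
    ∃ a, ∃ d ∈ M, ∃ k : ℕ, s * (m : S) ^ k * algebraMapTwo A A' S d = algebraMapTwo A A' S a := by
  obtain ⟨⟨a', _, k, rfl⟩, h⟩ := IsLocalization.surj (Submonoid.powers (m : A')) s
  obtain ⟨⟨a, d⟩, h'⟩ := IsLocalization.surj M a'
  refine ⟨a, d, d.2, k, ?_⟩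
  change s * algebraMap A' S (m ^ k) = algebraMap A' S a' at h
  rw [map_pow, map_natCast] at h
  rw [h]
  exact (map_mul _ _ _).symm.trans (congrArg (algebraMap A' S) h')

include M in
/-- Extension of an integral regular character. -/
theorem exists_ringHom_away_of_ringHom_rat (hm : 0 < m) (χ : A →+* ℚ) (hreg : ∀ d ∈ M, χ d ≠ 0)
    (hint : ∀ (p : ℕ) [Fact p.Prime], ¬ p ∣ m → ∀ x, ‖(χ x : ℚ_[p])‖ ≤ 1)
    (hone : ∀ (p : ℕ) [Fact p.Prime], ¬ p ∣ m → ∀ d ∈ M, ‖(χ d : ℚ_[p])‖ = 1) :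
    ∃ φ : S →+* Localization.Away (m : ℤ),
      ∀ a, Localization.Away.toRat m hm (φ (algebraMapTwo A A' S a)) = χ a := by
  let ψ₁ : A' →+* ℚ := IsLocalization.lift (M := M) (g := χ)
    fun d => isUnit_iff_ne_zero.2 (hreg d d.2)
  have hu : IsUnit (ψ₁ m) := by
    rw [map_natCast, isUnit_iff_ne_zero]
    exact_mod_cast hm.ne'
  let ψ : S →+* ℚ := IsLocalization.Away.lift (m : A') hu
  have hψ : ∀ a, ψ (algebraMapTwo A A' S a) = χ a := by
    intro a
    change ψ (algebraMap A' S (algebraMap A A' a)) = χ a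
    rw [IsLocalization.Away.lift_eq, IsLocalization.lift_eq]
  have hmem : ∀ s, ψ s ∈ (Localization.Away.toRat m hm).range := by
    intro s
    refine Localization.Away.mem_range_toRat hm fun p hp hpm => ?_
    obtain ⟨a, d, hd, k, h⟩ := exists_mul_eq_algebraMapTwo (M := M) (m := m) (A' := A') s
    have h' := congrArg ψ h
    rw [map_mul, map_mul, map_pow, map_natCast, hψ, hψ] at h'
    have h2 := congrArg (fun q : ℚ => ‖(q : ℚ_[p])‖) h'
    simp only [Rat.cast_mul, Rat.cast_pow, Rat.cast_natCast, norm_mul, norm_pow] at h2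
    rw [hone p hpm d hd, Padic.norm_natCast_eq_one_iff.2
      ((Nat.Prime.coprime_iff_not_dvd hp.out).2 hpm), one_pow, mul_one, mul_one] at h2
    rw [h2]
    exact hint p hpm a
  let e := RingEquiv.ofBijective (Localization.Away.toRat m hm).rangeRestrict
    ⟨fun x y hxy => Localization.Away.toRat_injective hm (congrArg Subtype.val hxy),
      RingHom.rangeRestrict_surjective _⟩
  refine ⟨(e.symm : _ →+* _).comp (ψ.codRestrict _ hmem), fun a => ?_⟩
  rw [← hψ]
  exact congrArg Subtype.val (e.apply_symm_apply (ψ.codRestrict _ hmem (algebraMapTwo A A' S a)))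

variable (A A' S M) in
include A' M in
theorem finite_ringHom_away (hm : 0 < m) [Finite (A →+* ℚ)] :
    Finite (S →+* Localization.Away (m : ℤ)) := by
  refine Finite.of_injective (fun φ : S →+* Localization.Away (m : ℤ) =>
    ((Localization.Away.toRat m hm).comp φ).comp (algebraMapTwo A A' S)) fun φ φ' h => ?_
  refine algebraMapTwo_ringHom_ext (M := M) (m := m) (A' := A') fun a => ?_
  exact Localization.Away.toRat_injective hm (RingHom.congr_fun h a)

include A' M in
/-- The homomorphisms to `ℤ[1/m]` detect the elements of a localization at elements that are units
or zero under each of them. -/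
theorem eq_zero_of_forall_ringHom_away (hm : 0 < m) [Finite (A →+* ℚ)]
    (hker : ∀ x : A, (∀ χ : A →+* ℚ, χ x = 0) → ∃ n : ℕ, n ≠ 0 ∧ (n : A) * x = 0)
    (htors : ∀ p : ℕ, p.Prime → ¬ p ∣ m → ∀ x : S, p * x = 0 → x = 0)
    (hint : ∀ (χ : A →+* ℚ) (p : ℕ) [Fact p.Prime], ¬ p ∣ m → ∀ x, ‖(χ x : ℚ_[p])‖ ≤ 1)
    (hone : ∀ (χ : A →+* ℚ) (p : ℕ) [Fact p.Prime], ¬ p ∣ m → ∀ d ∈ M, χ d ≠ 0 →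
      ‖(χ d : ℚ_[p])‖ = 1)
    {s : S} (hs : ∀ φ : S →+* Localization.Away (m : ℤ), φ s = 0) : s = 0 := by
  classical
  have := Fintype.ofFinite (A →+* ℚ)
  obtain ⟨a, d, hd, k, h⟩ := exists_mul_eq_algebraMapTwo (M := M) (m := m) (A' := A') s
  -- A character that vanishes somewhere on M gets an element of M that it kills; the remaining ones
  -- extend to S and get 1.
  have hex : ∀ χ : A →+* ℚ, ∃ c ∈ M, χ c = 0 ∨ ∀ d ∈ M, χ d ≠ 0 := by
    intro χ
    by_cases hχ : ∀ d ∈ M, χ d ≠ 0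
    · exact ⟨1, one_mem _, Or.inr hχ⟩
    · push Not at hχ
      obtain ⟨c, hc, h0⟩ := hχ
      exact ⟨c, hc, Or.inl h0⟩
  choose c hc hχc using hex
  -- Multiplying by all the c χ, which become units in S, kills the values of the characters that do
  -- not extend; on the others a vanishes because s does.
  obtain ⟨n, hn, hna⟩ := hker ((∏ χ, c χ) * a) fun χ => by
    rw [map_mul, map_prod]
    rcases hχc χ with h0 | hreg
    · rw [Finset.prod_eq_zero (Finset.mem_univ χ) h0, zero_mul]
    · obtain ⟨φ, hφ⟩ := exists_ringHom_away_of_ringHom_rat (M := M) (A' := A') (S := S) hm χ hreg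
        (hint χ) fun p hp hpm d hd => hone χ p hpm d hd (hreg d hd)
      rw [← hφ a, ← h, map_mul φ, map_mul φ, hs, zero_mul, zero_mul, map_zero, mul_zero]
  have hg := isUnit_algebraMapTwo (A' := A') (S := S) (prod_mem fun χ _ => hc χ : ∏ χ, c χ ∈ M)
  have hum : IsUnit (m : S) := isUnit_natCast_of_away (A' := A')
  have h1 : (n : S) * algebraMapTwo A A' S a = 0 := by
    have := congrArg (algebraMapTwo A A' S) hna
    rw [map_mul, map_mul, map_natCast, map_zero, mul_left_comm] at this
    exact hg.mul_right_eq_zero.1 this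
  have h2 := eq_zero_of_natCast_mul_eq_zero hum htors hn h1
  rw [← h] at h2
  exact (hum.pow k).mul_left_eq_zero.1
    ((isUnit_algebraMapTwo (A' := A') (S := S) hd).mul_left_eq_zero.1 h2)

end RegularLocalization

/-! ### Reduction of ℤ[1/m] modulo p -/

section Residue

variable {m p : ℕ}

/-- The reduction of `ℤ[1/m]` modulo a prime `p` not dividing `m`. -/
noncomputable def Localization.Away.toZMod (hp : p.Prime) (hpm : ¬ p ∣ m) :
    Localization.Away (m : ℤ) →+* ZMod p :=
  IsLocalization.Away.lift (m : ℤ) (g := Int.castRingHom (ZMod p)) (by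
    have := (ZMod.isUnit_iff_coprime m p).2 ((hp.coprime_iff_not_dvd.2 hpm).symm)
    simpa using this)

theorem Localization.Away.dvd_of_toZMod_eq_zero (hp : p.Prime) (hpm : ¬ p ∣ m)
    {x : Localization.Away (m : ℤ)} (hx : Localization.Away.toZMod hp hpm x = 0) :
    (p : Localization.Away (m : ℤ)) ∣ x := by
  obtain ⟨k, z, hz⟩ := Localization.Away.exists_natCast_pow_mul_eq x
  have h1 := congrArg (Localization.Away.toZMod hp hpm) hz
  rw [map_mul, hx, mul_zero, map_intCast, eq_comm, ZMod.intCast_zmod_eq_zero_iff_dvd] at h1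
  rw [← (Localization.Away.isUnit_natCast (m := m)).pow k |>.dvd_mul_left, hz]
  have := map_dvd (Int.castRingHom (Localization.Away (m : ℤ))) h1
  simpa using this

end Residue

/-! ### The main theorem -/

section Main

variable {G Ω : Type u} [Group G] [MulAction G Ω]

open IsStabilizerClass IsSmoothAction

/-- Generators of `Θ_{≤ 1}[1/m]` span the basic classes up to powers of `m`. -/
theorem exists_generators {m r : ℕ} (x : Fin r → ThetaLeOneAway G Ω m)
    (hx : Submodule.span (Localization.Away (m : ℤ)) (Set.range x) = ⊤) :
    ∃ t : Fin r → Theta G (stabClass G Ω), ∀ b ∈ basicClasses G Ω, ∃ (k : ℕ) (c : Fin r → ℤ),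
      (m : Theta G (stabClass G Ω)) ^ k * b = ∑ i, c i * t i := by
  obtain ⟨t, ht⟩ := LocalizedModule.exists_smul_eq_sum_of_span_eq_top _ x hx
  refine ⟨fun i => t i, fun b hb => ?_⟩
  obtain ⟨⟨_, k, rfl⟩, c, h⟩ := ht ⟨b, Submodule.subset_span hb⟩
  refine ⟨k, c, ?_⟩
  have := congrArg Subtype.val h
  simpa [Submonoid.smul_def, zsmul_eq_mul] using this

section Valuation

variable [IsStabilizerClass (stabClass G Ω)] {p : ℕ} [hp : Fact p.Prime]
  [IsPrimeToIndex (stabClass G Ω) p]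

/-- Characters of `Θ` are integral at the primes not dividing `m`. -/
theorem norm_ringHom_le_one {m r : ℕ} (hpm : ¬ p ∣ m) {t : Fin r → Theta G (stabClass G Ω)}
    (ht : ∀ b ∈ basicClasses G Ω, ∃ (k : ℕ) (c : Fin r → ℤ),
      (m : Theta G (stabClass G Ω)) ^ k * b = ∑ i, c i * t i)
    (ψ : Theta G (stabClass G Ω) →+* ℚ_[p]) (x : Theta G (stabClass G Ω)) : ‖ψ x‖ ≤ 1 := by
  choose n hn using fun i => Padic.exists_pow_mul_mem_subring (ψ (t i))
  have hm : ‖(m : ℚ_[p])‖ = 1 := Padic.norm_natCast_eq_one_iff.2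
    ((Nat.Prime.coprime_iff_not_dvd hp.out).2 hpm)
  have hpmem : ∀ k : ℕ, (p : ℚ_[p]) ^ k ∈ PadicInt.subring p := fun k => pow_mem (natCast_mem _ p) k
  -- One exponent bounds the denominators of all basic classes at once, because m is a p-adic unit
  -- and finitely many t i span.
  have hbd : ∀ b ∈ basicClasses G Ω, (p : ℚ_[p]) ^ (∑ i, n i) * ψ b ∈ PadicInt.subring p := by
    intro b hb
    obtain ⟨k, c, h⟩ := ht b hb
    have h' := congrArg ψ h
    rw [map_mul, map_pow, map_natCast, map_sum] at h'
    have : (p : ℚ_[p]) ^ (∑ i, n i) * ((m : ℚ_[p]) ^ k * ψ b) ∈ PadicInt.subring p := by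
      rw [h', Finset.mul_sum]
      refine sum_mem fun i _ => ?_
      rw [map_mul, map_intCast, ← Finset.add_sum_erase _ _ (Finset.mem_univ i), pow_add]
      convert! mul_mem (mul_mem (hpmem (∑ j ∈ Finset.univ.erase i, n j)) (intCast_mem _ (c i))) (hn i)
        using 1
      ring
    rw [PadicInt.mem_subring_iff] at this ⊢
    rwa [norm_mul, norm_mul, norm_pow (m : ℚ_[p]), hm, one_pow, one_mul, ← norm_mul] at this
  have hB := ψ.mem_subring_of_pow_eq_add_mul (fun b => exists_pow_eq_add_mul_of_mem_basicClasses)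
    _ hbd
  have hle : Subring.closure (basicClasses G Ω) ≤ (PadicInt.subring p).comap ψ :=
    Subring.closure_le.2 hB
  rw [closure_basicClasses] at hle
  exact hle (x := x) trivial

/-- Nonzero values of characters on classes of maps of transitive sets are units at the primes not
dividing `m`. -/
theorem norm_ringHom_eq_one {ψ : Theta G (stabClass G Ω) →+* ℚ_[p]} (hψ : ∀ x, ‖ψ x‖ ≤ 1)
    {d : Theta G (stabClass G Ω)} (hd : d ∈ regularSubmonoid G (stabClass G Ω)) (h0 : ψ d ≠ 0) :
    ‖ψ d‖ = 1 := by
  induction hd using Submonoid.closure_induction with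
  | mem d hd =>
    obtain ⟨Y, X, hY, hX, f, rfl⟩ := hd
    obtain ⟨w, hw⟩ := thetaClass_dvd_nuSymbol (p := p) f hY hX
    refine Padic.norm_eq_one_of_pow_eq_add_mul (hψ _) (hψ w) h0 ?_
    have := congrArg ψ (thetaClass_pow_eq (p := p) f hX)
    rwa [hw, map_pow, map_add, map_mul, map_natCast, map_mul] at this
  | one => simp
  | mul x y _ _ hx hy =>
    rw [map_mul] at h0
    rw [map_mul, norm_mul, hx (left_ne_zero_of_mul h0), hy (right_ne_zero_of_mul h0), one_mul]

end Valuation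

theorem isUnit_thetaStarAwayClass (m : ℕ) {Y X : SmoothSet G (stabClass G Ω)}
    (hY : Y.IsTransitive) (hX : X.IsTransitive) (f : Y →[G] X) :
    IsUnit (thetaStarAwayClass m f hX) :=
  isUnit_algebraMapTwo (M := regularSubmonoid G (stabClass G Ω))
    (Submonoid.subset_closure ⟨Y, X, hY, hX, f, rfl⟩)

end Main

theorem mainTheorem5 {G Ω : Type u} [Group G] [MulAction G Ω] (hG : IsOligomorphic G Ω)
    (m : ℕ) (hm : 0 < m) (hIND : IND G Ω m) (hGEN : GEN G Ω m) :
    ∃ (l : ℕ) (e : ThetaStarAway G Ω m ≃+* (Fin l → Localization.Away (m : ℤ))),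
      (∀ (Y X : SmoothSet G (stabClass G Ω)) (_ : Y.IsTransitive) (hX : X.IsTransitive)
        (f : Y →[G] X) (i : Fin l), IsUnit (e (thetaStarAwayClass m f hX) i)) ∧
      ∀ (r p : ℕ),
        (∃ x : Fin r → ThetaLeOneAway G Ω m,
          Submodule.span (Localization.Away (m : ℤ)) (Set.range x) = ⊤) →
        IsLeast {q : ℕ | q.Prime ∧ ¬ q ∣ m} p →
        l ≤ (p - 1) ^ r := by
  have hE := hG.isStabilizerClass
  have hδ : ∀ p : ℕ, p.Prime → ¬ p ∣ m → (∀ x : Theta G (stabClass G Ω), p * x = 0 → x = 0) ∧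
      ∀ x : Theta G (stabClass G Ω), ∃ w, x ^ p - x = p * w := by
    intro p hp hpm
    have := Fact.mk hp
    have := hG.isPrimeToIndex hIND hp hpm
    exact (isDeltaOperation_nuSymbol (stabClass G Ω) p).torsionFree_and_pow_sub_self
  obtain ⟨r₀, x₀, hx₀⟩ := hGEN.exists_fin
  obtain ⟨t₀, ht₀⟩ := exists_generators x₀ hx₀
  obtain ⟨hfin, hker⟩ := finite_ringHom_rat_of_generators hm (fun p hp hpm => (hδ p hp hpm).2)
    (closure_basicClasses G Ω) ht₀
  let M := regularSubmonoid G (stabClass G Ω)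
  let A' := ThetaStar G (stabClass G Ω)
  let S := ThetaStarAway G Ω m
  have hfinS : Finite (S →+* Localization.Away (m : ℤ)) :=
    finite_ringHom_away (Theta G (stabClass G Ω)) A' S M hm
  have htors : ∀ p : ℕ, p.Prime → ¬ p ∣ m → ∀ x : S, p * x = 0 → x = 0 := fun p hp hpm x =>
    IsLocalization.eq_zero_of_natCast_mul_eq_zero (Submonoid.powers (m : A'))
      fun x => IsLocalization.eq_zero_of_natCast_mul_eq_zero M (hδ p hp hpm).1
  have hpow : ∀ p : ℕ, p.Prime → ¬ p ∣ m → ∀ x : S, ∃ w, x ^ p - x = p * w := fun p hp hpm =>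
    IsLocalization.exists_pow_sub_self_eq (Submonoid.powers (m : A'))
      (IsLocalization.exists_pow_sub_self_eq M (hδ p hp hpm).2)
  have hnorm : ∀ (χ : Theta G (stabClass G Ω) →+* ℚ) (p : ℕ) [Fact p.Prime], ¬ p ∣ m →
      (∀ x, ‖(χ x : ℚ_[p])‖ ≤ 1) ∧ ∀ d ∈ M, χ d ≠ 0 → ‖(χ d : ℚ_[p])‖ = 1 := by
    intro χ p hp hpm
    have := hG.isPrimeToIndex hIND hp.out hpm
    have h1 := norm_ringHom_le_one hpm ht₀ ((Rat.castHom ℚ_[p]).comp χ)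
    refine ⟨h1, fun d hd h0 => norm_ringHom_eq_one h1 hd ?_⟩
    rw [RingHom.comp_apply, eq_ratCast]
    exact_mod_cast h0
  -- The coordinates of the isomorphism are all the characters of Θ*[1/m] to ℤ[1/m], and l is their
  -- number.
  obtain ⟨l, ⟨σ⟩⟩ := Finite.exists_equiv_fin (S →+* Localization.Away (m : ℤ))
  have hbij := bijective_ringHom_pi_of_pow_sub_self hm
    (isUnit_natCast_of_away (A' := A') (S := S)) hpow σ.symm σ.symm.injective fun s hs =>
      eq_zero_of_forall_ringHom_away (A' := A') (M := M) hm hker htors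
        (fun χ p hp hpm => (hnorm χ p hpm).1) (fun χ p hp hpm => (hnorm χ p hpm).2)
        fun φ => by simpa using hs (σ φ)
  refine ⟨l, RingEquiv.ofBijective _ hbij, fun Y X hY hX f i =>
    (isUnit_thetaStarAwayClass m hY hX f).map (σ.symm i), ?_⟩
  rintro r p ⟨x, hx⟩ ⟨⟨hp, hpm⟩, -⟩
  have hpf := Fact.mk hp
  obtain ⟨t, ht⟩ := exists_generators x hx
  let ρ := Localization.Away.toZMod hp hpm
  let α := algebraMapTwo (Theta G (stabClass G Ω)) A' S
  refine card_le_pow_of_forall_ne_zero hpm (closure_basicClasses G Ω) t ht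
    (fun i => (ρ.comp (σ.symm i)).comp α) (fun i j hij => ?_) ?_
  -- Characters agreeing modulo p on Θ agree modulo p on the localization, and then they are equal.
  · have hS : ρ.comp (σ.symm i) = ρ.comp (σ.symm j) :=
      algebraMapTwo_ringHom_ext (M := M) (m := m) (A' := A') fun a => RingHom.congr_fun hij a
    refine σ.symm.injective (RingHom.eq_of_forall_dvd_sub hm hp hpm (hpow p hp hpm) _ _ fun s => ?_)
    refine Localization.Away.dvd_of_toZMod_eq_zero hp hpm ?_
    rw [map_sub, sub_eq_zero]
    exact RingHom.congr_fun hS s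
  -- Basic classes are classes of maps of transitive sets, hence units in the localization, so their
  -- residues are nonzero.
  · rintro i _ ⟨n, a, rfl⟩
    exact ((isUnit_thetaStarAwayClass m (orbitSet_isTransitive _) (orbitSet_isTransitive _)
      (basicMap a)).map (ρ.comp (σ.symm i))).ne_zero
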